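/- **Notation.** Let $q\ge 1$ be an integer and $\alpha\in\mathbb R$. Write $A\ge 0$ (resp. $A\ge B$) if the complex $q\times q$ matrix $A$ (resp. $A-B$) is nonnegative Hermitian, $A^*$ for the conjugate transpose, $\operatorname{Im}A=\frac1{2i}(A-A^*)$, and $A^\dagger$ for the Moore–Penrose inverse. Let $\Omega=\mathbb C\setminus[\alpha,\infty)$ and $J=\begin{pmatrix}0&-iI_q\\ iI_q&0\end{pmatrix}$. A set $D\subseteq\mathbb C$ is *discrete* if every bounded set contains only finitely many points of $D$. A pair $(\phi,\psi)$ of $q\times q$ matrix functions meromorphic in $\Omega$ is a *Stieltjes pair* if there is a discrete set $D\subseteq\Omega$ such that 1. $\phi,\psi$ are holomorphic in $\Omega\setminus D$; 2. $\operatorname{rank}\begin{pmatrix}\phi(z)\\ \psi(z)\end{pmatrix}=q$ for all $z\in\Omega\setminus D$; 3. for all $z\in\mathbb C\setminus(\mathbb R\cup D)$, both $$\begin{pmatrix}\phi(z)\\ \psi(z)\end{pmatrix}^{*}\frac{-J}{2\operatorname{Im}z}\begin{pmatrix}\phi(z)\\ \psi(z)\end{pmatrix}\ge0,\qquad \begin{pmatrix}(z-\alpha)\phi(z)\\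 \psi(z)\end{pmatrix}^{*}\frac{-J}{2\operatorname{Im}z}\begin{pmatrix}(z-\alpha)\phi(z)\\ \psi(z)\end{pmatrix}\ge0 .$$ It is *proper* if $\det\psi$ does not vanish identically. For a $q\times q$ matrix $A$ let $\mathcal P[A]$ be the set of Stieltjes pairs $(\phi,\psi)$ such that the column space of $\phi(z)$ is contained in that of $A$ at each point of holomorphy $z\in\Omega$ of $\phi$. Put $$V_A(z)=\begin{pmatrix}0&-A\\ (z-\alpha)A^\dagger&(z-\alpha)I_q\end{pmatrix},\qquad W_A(z)=\begin{pmatrix}(z-\alpha)I_q&A\\ -(z-\alpha)A^\dagger&I_q-A^\dagger A\end{pmatrix}.$$ For $s_0\ge0$ let $\mathcal S[s_0,\le]$ be the set of all holomorphic $F:\Omega\to\mathbb C^{q\times q}$ with $\operatorname{Im}F(w)\ge0$ for $\operatorname{Im}w>0$, $F(x)\ge 0$ for real $x<\alpha$, and $\sup_{y\ge1}y\|F(iy)\|<\infty$, whose Stieltjes measure $\sigma$, i.e. the nonnegative Hermitian $q\times q$ measure on the Borel subsets of $[\alpha,\infty)$ with $F(z)=\int_{[\alpha,\infty)}\frac{\sigma(dt)}{t-z}$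 for all $z\in\Omega$, satisfies $\sigma([\alpha,\infty))\le s_0$. **Proposition.** Let $\alpha\in\mathbb R$ and let $s_0\ge0$ be a complex $q\times q$ matrix. (I) Let $(\phi,\psi)\in\mathcal P[s_0]$, let $\begin{pmatrix}X\\ Y\end{pmatrix}=V_{s_0}\begin{pmatrix}\phi\\ \psi\end{pmatrix}$ with $q\times q$ blocks $X,Y$, and let $D$ be any discrete subset of $\Omega$ for which 1. and 2. hold. Then: (a) $\det Y(z)\ne0$ for all $z\in\Omega\setminus D$; (b) $X$ and $Y$ are holomorphic in $\Omega\setminus D$; (c) $(X,Y)$ is a proper Stieltjes pair; (d) $\det Y$ does not vanish identically in $\Omega$, and $F=XY^{-1}$ belongs to $\mathcal S[s_0,\le]$ (that is, the function $XY^{-1}$ on $\Omega\setminus D$ extends to a function in $\mathcal S[s_0,\le]$). (II) Conversely, let $F\in\mathcal S[s_0,\le]$ and let $\begin{pmatrix}\phi\\ \psi\end{pmatrix}=W_{s_0}\begin{pmatrix}F\\ I_q\end{pmatrix}$ with $q\times q$ blocks $\phi,\psi$. Then $\phi$ and $\psi$ are holomorphic in $\Omega$, $(\phi,\psi)\in\mathcal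 P[s_0]$, and for all $z\in\Omega$ one has $$\det\big[(z-\alpha)s_0^\dagger\phi(z)+(z-\alpha)\psi(z)\big]\neq0\quad\text{and}\quad F(z)=\big[0\cdot\phi(z)-s_0\psi(z)\big]\big[(z-\alpha)s_0^\dagger\phi(z)+(z-\alpha)\psi(z)\big]^{-1}.$$ -/

import Mathlib

open MeasureTheory
open scoped ComplexOrder

namespace MatStieltjes

/-! ### Matrices -/

/-- The four Penrose equations: `P` is the Moore-Penrose inverse of the square matrix `A`. -/
structure IsMoorePenroseInverse {q : ℕ} (A P : Matrix (Fin q) (Fin q) ℂ) : Prop where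
  mul_mul_self : A * P * A = A
  self_mul_mul : P * A * P = P
  isHermitian_left : (A * P).IsHermitian
  isHermitian_right : (P * A).IsHermitian

theorem exists_isMoorePenroseInverse {q : ℕ} (A : Matrix (Fin q) (Fin q) ℂ) :
    ∃ P, IsMoorePenroseInverse A P := by
  have hH : (A.conjTranspose * A).IsHermitian := Matrix.isHermitian_conjTranspose_mul_self A
  obtain ⟨U, D, E, hU, hU', hA, hDE, hE⟩ : ∃ U D E : Matrix (Fin q) (Fin q) ℂ,
      U.conjTranspose * U = 1 ∧ U * U.conjTranspose = 1 ∧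
      A.conjTranspose * A = U * D * U.conjTranspose ∧ (D * E * D = D ∧ E * D * E = E) ∧
      (E.IsHermitian ∧ (E * D).IsHermitian) := by
    refine ⟨hH.eigenvectorUnitary, Matrix.diagonal (fun i => (hH.eigenvalues i : ℂ)),
      Matrix.diagonal (fun i => (hH.eigenvalues i : ℂ)⁻¹), ?_, ?_, ?_, ⟨?_, ?_⟩, ?_, ?_⟩
    · exact Unitary.coe_star_mul_self hH.eigenvectorUnitary
    · exact Unitary.coe_mul_star_self hH.eigenvectorUnitary
    · exact hH.spectral_theorem
    · rw [Matrix.diagonal_mul_diagonal, Matrix.diagonal_mul_diagonal]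
      congr 1; funext i
      exact mul_inv_mul_cancel _
    · rw [Matrix.diagonal_mul_diagonal, Matrix.diagonal_mul_diagonal]
      congr 1; funext i
      simpa using mul_inv_mul_cancel ((hH.eigenvalues i : ℂ)⁻¹)
    · apply Matrix.isHermitian_diagonal_of_self_adjoint
      ext i; simp
    · rw [Matrix.diagonal_mul_diagonal]
      apply Matrix.isHermitian_diagonal_of_self_adjoint
      ext i; simp
  have hPA : U * E * U.conjTranspose * A.conjTranspose * A = U * (E * D) * U.conjTranspose := by
    calc U * E * U.conjTranspose * A.conjTranspose * A
        = U * E * U.conjTranspose * (A.conjTranspose * A) := by simp only [Matrix.mul_assoc]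
      _ = U * E * (U.conjTranspose * U) * D * U.conjTranspose := by
          rw [hA]; simp only [Matrix.mul_assoc]
      _ = _ := by rw [hU]; simp only [Matrix.mul_assoc, Matrix.mul_one]
  refine ⟨U * E * U.conjTranspose * A.conjTranspose, ⟨?_, ?_, ?_, ?_⟩⟩
  · have h0 : A.conjTranspose * A * (1 - U * (E * D) * U.conjTranspose) = 0 := by
      rw [Matrix.mul_sub, Matrix.mul_one, hA]
      have : U * D * U.conjTranspose * (U * (E * D) * U.conjTranspose)
          = U * (D * E * D) * U.conjTranspose := by
        calc _ = U * D * (U.conjTranspose * U) * (E * D) * U.conjTranspose := by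
              simp only [Matrix.mul_assoc]
          _ = _ := by rw [hU]; simp only [Matrix.mul_assoc, Matrix.one_mul]
      rw [this, hDE.1, sub_self]
    rw [Matrix.conjTranspose_mul_self_mul_eq_zero, Matrix.mul_sub, Matrix.mul_one,
      sub_eq_zero] at h0
    rw [Matrix.mul_assoc, hPA, ← h0]
  · rw [hPA]
    calc _ = U * (E * D) * (U.conjTranspose * U) * E * U.conjTranspose * A.conjTranspose := by
          simp only [Matrix.mul_assoc]
      _ = U * (E * D * E) * U.conjTranspose * A.conjTranspose := by
          rw [hU]; simp only [Matrix.mul_assoc, Matrix.one_mul]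
      _ = _ := by rw [hDE.2]
  · unfold Matrix.IsHermitian
    simp only [Matrix.conjTranspose_mul, Matrix.conjTranspose_conjTranspose, hE.1.eq,
      Matrix.mul_assoc]
  · rw [hPA]
    unfold Matrix.IsHermitian
    rw [Matrix.conjTranspose_mul, Matrix.conjTranspose_mul, hE.2.eq,
      Matrix.conjTranspose_conjTranspose, ← Matrix.mul_assoc]

/-- The Moore-Penrose inverse of a complex square matrix. -/
noncomputable def mpInv {q : ℕ} (A : Matrix (Fin q) (Fin q) ℂ) : Matrix (Fin q) (Fin q) ℂ :=
  Classical.choose (exists_isMoorePenroseInverse A)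

theorem isMoorePenroseInverse_mpInv {q : ℕ} (A : Matrix (Fin q) (Fin q) ℂ) :
    IsMoorePenroseInverse A (mpInv A) :=
  Classical.choose_spec (exists_isMoorePenroseInverse A)

/-- The Penrose equations determine the inverse. -/
theorem IsMoorePenroseInverse.unique {q : ℕ} {A P Q : Matrix (Fin q) (Fin q) ℂ}
    (hP : IsMoorePenroseInverse A P) (hQ : IsMoorePenroseInverse A Q) : P = Q := by
  have h1 : A * P = A * Q := by
    have e := hP.isHermitian_left.eq
    calc A * P = (A * P).conjTranspose := e.symm
      _ = (A * Q * (A * P)).conjTranspose := by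
          rw [← Matrix.mul_assoc, hQ.mul_mul_self]
      _ = (A * P) * (A * Q) := by
          rw [Matrix.conjTranspose_mul, e, hQ.isHermitian_left.eq]
      _ = A * Q := by rw [← Matrix.mul_assoc, hP.mul_mul_self]
  have h2 : P * A = Q * A := by
    have e := hP.isHermitian_right.eq
    calc P * A = (P * A).conjTranspose := e.symm
      _ = (P * A * (Q * A)).conjTranspose := by
          rw [Matrix.mul_assoc, ← Matrix.mul_assoc A Q A, hQ.mul_mul_self]
      _ = (Q * A) * (P * A) := by
          rw [Matrix.conjTranspose_mul, e, hQ.isHermitian_right.eq]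
      _ = Q * A := by rw [Matrix.mul_assoc, ← Matrix.mul_assoc A P A, hP.mul_mul_self]
  calc P = P * A * P := hP.self_mul_mul.symm
    _ = Q * A * Q := by rw [Matrix.mul_assoc, h1, ← Matrix.mul_assoc, h2]
    _ = Q := hQ.self_mul_mul

/-- The imaginary part `(A - Aᴴ) / (2i)` of a square matrix. -/
noncomputable def imPart {q : ℕ} (A : Matrix (Fin q) (Fin q) ℂ) : Matrix (Fin q) (Fin q) ℂ :=
  (1 / (2 * Complex.I)) • (A - A.conjTranspose)

/-- The signature matrix with block rows `(0, -iI)` and `(iI, 0)`. -/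
noncomputable def signatureJ (q : ℕ) : Matrix (Fin q ⊕ Fin q) (Fin q ⊕ Fin q) ℂ :=
  Matrix.fromBlocks 0 (-(Complex.I • 1)) (Complex.I • 1) 0

/-- The matrix polynomial `V_A(z)` with block rows `(0, -A)` and `((z - α) A⁺, (z - α) I)`. -/
noncomputable def polyV {q : ℕ} (α : ℝ) (A : Matrix (Fin q) (Fin q) ℂ) (z : ℂ) :
    Matrix (Fin q ⊕ Fin q) (Fin q ⊕ Fin q) ℂ :=
  Matrix.fromBlocks 0 (-A) ((z - α) • mpInv A) ((z - α) • 1)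

/-- The matrix polynomial `W_A(z)` with block rows `((z - α) I, A)` and
`(-(z - α) A⁺, I - A⁺ A)`. -/
noncomputable def polyW {q : ℕ} (α : ℝ) (A : Matrix (Fin q) (Fin q) ℂ) (z : ℂ) :
    Matrix (Fin q ⊕ Fin q) (Fin q ⊕ Fin q) ℂ :=
  Matrix.fromBlocks ((z - α) • 1) A (-((z - α) • mpInv A)) (1 - mpInv A * A)

/-! ### Meromorphic matrix functions on the slit plane

A meromorphic matrix function on the slit plane is represented by any total function on `ℂ` whose
entries are meromorphic at each point of the slit plane; its values at poles carry no information,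
and every notion below only looks at values at points of holomorphy. -/

/-- The slit plane `ℂ ∖ [α, ∞)`. -/
def slit (α : ℝ) : Set ℂ := {z | z.im ≠ 0 ∨ z.re < α}

/-- A subset of `ℂ` is called discrete if every bounded set contains only finitely many of its
points. -/
def IsDiscreteSet (D : Set ℂ) : Prop :=
  ∀ B : Set ℂ, Bornology.IsBounded B → (D ∩ B).Finite

/-- Entrywise meromorphy on the slit plane. -/
def IsMeromorphic {q : ℕ} (α : ℝ) (f : ℂ → Matrix (Fin q) (Fin q) ℂ) : Prop :=
  ∀ i j, MeromorphicOn (fun z => f z i j) (slit α)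

/-- Entrywise holomorphy on a set (only used for open sets). -/
def IsHolomorphicOn {q : ℕ} (f : ℂ → Matrix (Fin q) (Fin q) ℂ) (U : Set ℂ) : Prop :=
  ∀ i j, DifferentiableOn ℂ (fun z => f z i j) U

/-- `z` is a point of holomorphy of `f`. -/
def IsHolomorphicAt {q : ℕ} (f : ℂ → Matrix (Fin q) (Fin q) ℂ) (z : ℂ) : Prop :=
  ∀ i j, AnalyticAt ℂ (fun w => f w i j) z

/-- The determinant of the meromorphic function `f` does not vanish identically in the slit
plane. -/
def DetNotIdenticallyZero {q : ℕ} (α : ℝ) (f : ℂ → Matrix (Fin q) (Fin q) ℂ) : Prop :=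
  ∃ z ∈ slit α, IsHolomorphicAt f z ∧ (f z).det ≠ 0

/-! ### Stieltjes pairs -/

/-- Regularity of a pair `(φ, ψ)` off an exceptional discrete set `D`: both
functions are holomorphic in `ℂ ∖ ([α, ∞) ∪ D)`, and there the block column `(φ; ψ)` has
rank `q`. -/
structure IsRegularOff {q : ℕ} (α : ℝ) (φ ψ : ℂ → Matrix (Fin q) (Fin q) ℂ) (D : Set ℂ) :
    Prop where
  subset_slit : D ⊆ slit α
  discrete : IsDiscreteSet D
  holomorphic_fst : IsHolomorphicOn φ (slit α \ D)
  holomorphic_snd : IsHolomorphicOn ψ (slit α \ D)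
  rank_eq : ∀ z ∈ slit α \ D, (Matrix.fromRows (φ z) (ψ z)).rank = q

/-- The matrix `(a; b)ᴴ (-J / (2 Im z)) (a; b)`. -/
noncomputable def signatureForm {q : ℕ} (z : ℂ) (a b : Matrix (Fin q) (Fin q) ℂ) :
    Matrix (Fin q) (Fin q) ℂ :=
  (Matrix.fromRows a b).conjTranspose * ((-1 / (2 * (z.im : ℂ))) • signatureJ q) *
    Matrix.fromRows a b

/-- `q × q` Stieltjes pairs in `ℂ ∖ [α, ∞)`. -/
def IsStieltjesPair {q : ℕ} (α : ℝ) (φ ψ : ℂ → Matrix (Fin q) (Fin q) ℂ) : Prop :=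
  IsMeromorphic α φ ∧ IsMeromorphic α ψ ∧
    ∃ D : Set ℂ, IsRegularOff α φ ψ D ∧
      ∀ z : ℂ, z.im ≠ 0 → z ∉ D →
        (signatureForm z (φ z) (ψ z)).PosSemidef ∧
        (signatureForm z ((z - α) • φ z) (ψ z)).PosSemidef

/-- Proper Stieltjes pairs: `det ψ` does not vanish identically. -/
def IsProperStieltjesPair {q : ℕ} (α : ℝ) (φ ψ : ℂ → Matrix (Fin q) (Fin q) ℂ) : Prop :=
  IsStieltjesPair α φ ψ ∧ DetNotIdenticallyZero α ψ

/-- The class `P[A]` of Stieltjes pairs `(φ, ψ)` such that the column space of `φ(z)` is contained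
in that of `A` at each point of holomorphy `z` of `φ`. -/
def MemPairClass {q : ℕ} (α : ℝ) (A : Matrix (Fin q) (Fin q) ℂ)
    (φ ψ : ℂ → Matrix (Fin q) (Fin q) ℂ) : Prop :=
  IsStieltjesPair α φ ψ ∧
    ∀ z ∈ slit α, IsHolomorphicAt φ z →
      LinearMap.range (φ z).mulVecLin ≤ LinearMap.range A.mulVecLin

/-! ### Matrix measures and Stieltjes functions -/

/-- A countably additive matrix-valued set function on the Borel subsets of `[α, ∞)` is a
nonnegative Hermitian measure if all its values are nonnegative Hermitian. -/
def IsNonnegHermitianMeasure {q : ℕ} {α : ℝ}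
    (σ : VectorMeasure (Set.Ici α) (Matrix (Fin q) (Fin q) ℂ)) : Prop :=
  ∀ B : Set (Set.Ici α), MeasurableSet B → (σ B).PosSemidef

/-- The `(j, k)` entry of a matrix measure, a complex measure. -/
noncomputable def entryMeasure {q : ℕ} {α : ℝ}
    (σ : VectorMeasure (Set.Ici α) (Matrix (Fin q) (Fin q) ℂ)) (j k : Fin q) :
    ComplexMeasure (Set.Ici α) :=
  σ.mapRange (Matrix.entryAddMonoidHom ℂ j k) (continuous_id.matrix_elem j k)

/-- The Stieltjes transform `z ↦ ∫ (t - z)⁻¹ σ(dt)`, the integral being taken entrywise against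
the complex measures which are the entries of `σ`. -/
noncomputable def stieltjesTransform {q : ℕ} {α : ℝ}
    (σ : VectorMeasure (Set.Ici α) (Matrix (Fin q) (Fin q) ℂ)) (z : ℂ) :
    Matrix (Fin q) (Fin q) ℂ :=
  Matrix.of fun j k =>
    VectorMeasure.integral (entryMeasure σ j k)
      (fun t : Set.Ici α => (((t : ℝ) : ℂ) - z)⁻¹) (ContinuousLinearMap.mul ℝ ℂ)

/-- `σ` is the Stieltjes measure of `F`: a nonnegative Hermitian measure on `[α, ∞)` with
Stieltjes transform `F`. -/
def IsStieltjesMeasureOf {q : ℕ} {α : ℝ}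
    (σ : VectorMeasure (Set.Ici α) (Matrix (Fin q) (Fin q) ℂ))
    (F : ℂ → Matrix (Fin q) (Fin q) ℂ) : Prop :=
  IsNonnegHermitianMeasure σ ∧ ∀ z ∈ slit α, F z = stieltjesTransform σ z

/-- `[α, ∞)`-Stieltjes functions of order `q`. -/
structure IsStieltjesFunction {q : ℕ} (α : ℝ) (F : ℂ → Matrix (Fin q) (Fin q) ℂ) : Prop where
  holomorphic : IsHolomorphicOn F (slit α)
  imPart_nonneg : ∀ w : ℂ, 0 < w.im → (imPart (F w)).PosSemidef
  nonneg_left : ∀ x : ℝ, x < α → (F x).PosSemidef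

/-- The class `S₀` of Stieltjes functions with `sup_{y ≥ 1} y ‖F(iy)‖ < ∞` (operator norm). -/
def MemS0 {q : ℕ} (α : ℝ) (F : ℂ → Matrix (Fin q) (Fin q) ℂ) : Prop :=
  IsStieltjesFunction α F ∧
    ∃ C : ℝ, ∀ y : ℝ, 1 ≤ y →
      y * ‖Matrix.toEuclideanCLM (n := Fin q) (𝕜 := ℂ) (F ((y : ℂ) * Complex.I))‖ ≤ C

/-- The class `S[s₀, ≤]`: functions in `S₀` whose Stieltjes measure `σ` satisfies
`σ([α, ∞)) ≤ s₀`. -/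
def MemSle {q : ℕ} (α : ℝ) (s₀ : Matrix (Fin q) (Fin q) ℂ)
    (F : ℂ → Matrix (Fin q) (Fin q) ℂ) : Prop :=
  MemS0 α F ∧
    ∃ σ : VectorMeasure (Set.Ici α) (Matrix (Fin q) (Fin q) ℂ),
      IsStieltjesMeasureOf σ F ∧ (s₀ - σ Set.univ).PosSemidef

end MatStieltjes

/-!
Both directions rest on algebraic identities for the pairing `(ψ v)ᴴ (φ v)`, since the
signature form of a column `(a; b)` at `v` is `Im ((b v)ᴴ (a v)) / Im z`
(`posSemidef_signatureForm_iff`).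

*From pairs to functions.* Write `a = φ η`, `b = ψ η`, `m = bᴴ a`, `t = bᴴ s₀ b`. The column
space condition gives `(Y η)ᴴ (X η) = -conj (z - α) (conj m + t)` (`pairing_polyV`). Hence the
positivity of `Im ((z - α) m) / Im z` yields `t ≤ Im ((Y η)ᴴ (X η)) / Im z`, and to the left of `α`
similarly `(α - Re z) t ≤ Re ((Y η)ᴴ (X η))`. On the kernel of `Y` the same positivity forces
`φ` and `ψ` to vanish, so `Y` is invertible (`MemPairClass.det_ne_zero`). For `v = Y η` and
`f = vᴴ X Y⁻¹ v = -vᴴ s₀ b`, Cauchy-Schwarz gives `|f|² ≤ (vᴴ s₀ v) t`, and therefore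
`|f| ≤ vᴴ s₀ v / max (|Im z|) (α - Re z)` (`MemPairClass.sform_div_bounds`). So `X Y⁻¹` is locally
bounded on the whole slit plane, its singularities are removable, and the extension `F` satisfies
`Im (vᴴ F v) / Im z ≥ 0` and `|vᴴ F v| ≤ vᴴ s₀ v / |Im z|`.

Such an `F` is the Stieltjes transform of a matrix measure of total mass at most `s₀`
(`exists_isStieltjesMeasureOf`). For each `v` the scalar function `vᴴ F v` is the Cauchy
transform of a positive measure on the real line: Cauchy's theorem on rectangles shows that
`Im (vᴴ F v)(t + iδ) / π` is a density of mass at most `vᴴ s₀ v` with Cauchy transform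
`(vᴴ F v)(z + iδ)`, and a weak limit as `δ → 0` is provided by the Riesz-Markov-Kakutani theorem
(`IsHerglotz.integral_inv_sub`). The limit does not charge `(-∞, α)`, where `vᴴ F v` is real.
The densities depend on `v` as a quadratic form does, hence so do the limits, which polarize to a
matrix measure.

*From functions to pairs.* With `x = F v`, `f = vᴴ x`, `p = xᴴ s₀⁺ x`, one finds
`(ψ v)ᴴ (φ v) = -|z - α|² p - conj ((z - α) f)` (`pairing_polyW`). The two positivity conditions
become `Im ((z - α) f) / Im z ≥ 0`, which is read off from the integral representation, and
`p ≤ Im f / Im z`, which is the Cauchy-Schwarz inequality for the measure of `F`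
(`norm_sform_matInt_sq_le`). The latter also shows `s₀ s₀⁺ F = F`, whence `s₀⁺ φ + ψ = 1` and
`-s₀ ψ = (z - α) F`, the remaining claims.
-/

namespace MatStieltjes

open Filter Topology
open scoped CompactlySupported

/-! ### Cauchy's theorem for the half-plane -/

/-- If `K` is holomorphic on the closed upper half-plane and decays slightly faster than `1 / ‖ζ‖`
away from the real axis, its integrals over `[-n³, n³]` tend to zero: Cauchy's theorem on the
rectangle of width `2 n³` and height `n²`. -/
theorem tendsto_integral_real_line_zero {K : ℂ → ℂ} {C δ R : ℝ} (hC : 0 ≤ C) (hδ : 0 < δ)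
    (hK : DifferentiableOn ℂ K {ζ | 0 ≤ ζ.im})
    (hb : ∀ ζ : ℂ, 0 ≤ ζ.im → R ≤ ‖ζ‖ → ‖K ζ‖ ≤ C / ((ζ.im + δ) * ‖ζ‖)) :
    Tendsto (fun n : ℕ => ∫ t in (-((n : ℝ) ^ 3))..((n : ℝ) ^ 3), K t) atTop (𝓝 0) := by
  have hev : ∀ᶠ n : ℕ in atTop,
      ‖∫ t in (-((n : ℝ) ^ 3))..((n : ℝ) ^ 3), K t‖ ≤ (2 * C + 2 * (C / δ)) * (1 / (n : ℝ)) := by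
    filter_upwards [eventually_ge_atTop 1, tendsto_natCast_atTop_atTop.eventually_ge_atTop R]
      with n hn hnR
    have hn1 : (1 : ℝ) ≤ n := by exact_mod_cast hn
    have hn0 : (0 : ℝ) < n := by linarith
    have h2 : (n : ℝ) ≤ (n : ℝ) ^ 2 := by nlinarith
    have h3 : (n : ℝ) ≤ (n : ℝ) ^ 3 := by nlinarith
    set N : ℝ := (n : ℝ) ^ 3 with hN
    set H : ℝ := (n : ℝ) ^ 2 with hH
    have hN0 : 0 < N := by positivity
    have hH0 : 0 < H := by positivity
    have key := Complex.integral_boundary_rect_eq_zero_of_differentiableOn K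
      (⟨-N, 0⟩ : ℂ) (⟨N, H⟩ : ℂ) (hK.mono (by
        rintro ζ ⟨-, hζ⟩
        have : ζ.im ∈ Set.uIcc (0 : ℝ) H := hζ
        rw [Set.uIcc_of_le hH0.le] at this
        exact this.1))
    simp only [Complex.ofReal_zero, zero_mul, add_zero] at key
    have htop : ‖∫ x in (-N)..N, K (x + H * Complex.I)‖ ≤ C / ((H + δ) * H) * |N - -N| := by
      refine intervalIntegral.norm_integral_le_of_norm_le_const fun x _ => ?_
      have him : ((x : ℂ) + H * Complex.I).im = H := by simp
      have hle : H ≤ ‖(x : ℂ) + H * Complex.I‖ := by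
        have := Complex.abs_im_le_norm ((x : ℂ) + H * Complex.I)
        rw [him, abs_of_pos hH0] at this; exact this
      refine (hb _ (by rw [him]; exact hH0.le) (by linarith)).trans ?_
      rw [him]; gcongr
    have hside : ∀ X : ℝ, |X| = N → ‖∫ y in (0 : ℝ)..H, K (X + y * Complex.I)‖
        ≤ C / (δ * N) * |H - 0| := by
      intro X hX
      refine intervalIntegral.norm_integral_le_of_norm_le_const fun y hy => ?_
      rw [Set.uIoc_of_le hH0.le] at hy
      have him : ((X : ℂ) + y * Complex.I).im = y := by simp
      have hre : ((X : ℂ) + y * Complex.I).re = X := by simp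
      have hle : N ≤ ‖(X : ℂ) + y * Complex.I‖ := by
        have := Complex.abs_re_le_norm ((X : ℂ) + y * Complex.I)
        rw [hre, hX] at this; exact this
      refine (hb _ (by rw [him]; exact hy.1.le) (by linarith)).trans ?_
      rw [him]
      have : δ ≤ y + δ := by linarith [hy.1]
      have : 0 ≤ y + δ := by linarith
      gcongr
    have e1 := hside N (abs_of_pos hN0)
    have e2 := hside (-N) (by rw [abs_neg, abs_of_pos hN0])
    have hbot : (∫ t in (-N)..N, K t) = (∫ x in (-N)..N, K (x + H * Complex.I))
        - Complex.I • (∫ y in (0 : ℝ)..H, K (N + y * Complex.I))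
        + Complex.I • (∫ y in (0 : ℝ)..H, K ((-N : ℝ) + y * Complex.I)) := by
      linear_combination key
    rw [hbot]
    have hI : ∀ w : ℂ, ‖Complex.I • w‖ = ‖w‖ := fun w => by simp
    refine (norm_add_le _ _).trans ((add_le_add_left (norm_sub_le _ _) _).trans ?_)
    rw [hI, hI]
    have hside' : C / (δ * N) * |H - 0| = C / δ * (1 / n) := by
      rw [sub_zero, abs_of_pos hH0, hN, hH]; field_simp
    have htop' : C / ((H + δ) * H) * |N - -N| ≤ 2 * C * (1 / n) := by
      rw [sub_neg_eq_add, abs_of_pos (by linarith)]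
      have : C / ((H + δ) * H) ≤ C / (H * H) := by gcongr; linarith
      calc _ ≤ C / (H * H) * (N + N) := by gcongr
        _ = _ := by rw [hN, hH]; field_simp; ring
    rw [hside'] at e1 e2
    linarith
  refine squeeze_zero_norm' hev ?_
  simpa using (tendsto_one_div_atTop_nhds_zero_nat (𝕜 := ℝ)).const_mul (2 * C + 2 * (C / δ))

/-- The Poisson kernel has mass `π`. -/
theorem tendsto_integral_poisson_kernel {x y : ℝ} (hy : 0 < y) :
    Tendsto (fun n : ℕ => ∫ t in (-((n : ℝ) ^ 3))..((n : ℝ) ^ 3), y / ((t - x) ^ 2 + y ^ 2))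
      atTop (𝓝 Real.pi) := by
  have hder : ∀ t : ℝ, HasDerivAt (fun t => Real.arctan ((t - x) / y))
      (y / ((t - x) ^ 2 + y ^ 2)) t := by
    intro t
    have h : HasDerivAt (fun t => Real.arctan ((t - x) / y))
        (1 / (1 + ((t - x) / y) ^ 2) * (1 / y)) t :=
      (((hasDerivAt_id t).sub_const x).div_const y).arctan
    convert h using 1
    field_simp
    ring
  have hcont : Continuous fun t : ℝ => y / ((t - x) ^ 2 + y ^ 2) := by
    refine continuous_const.div (by fun_prop) fun t => ?_
    positivity
  have hint : ∀ n : ℕ, ∫ t in (-((n : ℝ) ^ 3))..((n : ℝ) ^ 3), y / ((t - x) ^ 2 + y ^ 2)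
      = Real.arctan ((((n : ℝ) ^ 3) - x) / y) - Real.arctan (((-((n : ℝ) ^ 3)) - x) / y) := fun n =>
    intervalIntegral.integral_eq_sub_of_hasDerivAt (fun t _ => hder t)
      (hcont.intervalIntegrable _ _)
  simp only [hint]
  have hcube : Tendsto (fun n : ℕ => (n : ℝ) ^ 3) atTop atTop :=
    (tendsto_pow_atTop (by norm_num)).comp tendsto_natCast_atTop_atTop
  have h1 : Tendsto (fun n : ℕ => Real.arctan ((((n : ℝ) ^ 3) - x) / y)) atTop
      (𝓝 (Real.pi / 2)) :=
    (tendsto_nhds_of_tendsto_nhdsWithin Real.tendsto_arctan_atTop).comp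
      ((tendsto_atTop_add_const_right _ _ hcube).atTop_div_const hy)
  have h2 : Tendsto (fun n : ℕ => Real.arctan (((-((n : ℝ) ^ 3)) - x) / y)) atTop
      (𝓝 (-(Real.pi / 2))) :=
    (tendsto_nhds_of_tendsto_nhdsWithin Real.tendsto_arctan_atBot).comp
      ((tendsto_atBot_add_const_right _ _ (tendsto_neg_atTop_atBot.comp hcube)).atBot_div_const hy)
  have := h1.sub h2
  rwa [show Real.pi / 2 - -(Real.pi / 2) = Real.pi by ring] at this

theorem norm_sub_ge_half {ζ w : ℂ} (h : 2 * ‖w‖ ≤ ‖ζ‖) : ‖ζ‖ / 2 ≤ ‖ζ - w‖ := by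
  have := norm_sub_norm_le ζ w
  linarith

theorem conj_intervalIntegral (f : ℝ → ℂ) (a b : ℝ) :
    (starRingEnd ℂ) (∫ t in a..b, f t) = ∫ t in a..b, (starRingEnd ℂ) (f t) := by
  simp only [intervalIntegral, map_sub, integral_conj]

section CauchyTransform

variable {g : ℂ → ℂ} {c δ : ℝ}

theorem tendsto_integral_div_sub_conj (hc : 0 ≤ c) (hδ : 0 < δ)
    (hg : DifferentiableOn ℂ g {ζ | 0 ≤ ζ.im})
    (hb : ∀ ζ : ℂ, 0 ≤ ζ.im → ‖g ζ‖ ≤ c / (ζ.im + δ)) {w : ℂ} (hw : w.im < 0) :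
    Tendsto (fun n : ℕ => ∫ t in (-((n : ℝ) ^ 3))..((n : ℝ) ^ 3), g t / (t - w)) atTop (𝓝 0) := by
  refine tendsto_integral_real_line_zero (K := fun ζ => g ζ / (ζ - w)) (C := 2 * c) (δ := δ)
    (R := 2 * ‖w‖ + 1) (by positivity) hδ ?_ ?_
  · refine hg.div (by fun_prop) fun ζ hζ h => ?_
    have : ζ = w := sub_eq_zero.mp h
    rw [this] at hζ
    exact absurd hζ (not_le.mpr hw)
  · intro ζ hζ hR
    have h1 : ‖ζ‖ / 2 ≤ ‖ζ - w‖ := norm_sub_ge_half (by linarith)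
    have h0 : 0 < ‖ζ‖ := by linarith [norm_nonneg w]
    rw [norm_div]
    calc ‖g ζ‖ / ‖ζ - w‖ ≤ (c / (ζ.im + δ)) / (‖ζ‖ / 2) := by
          gcongr
          exact hb ζ hζ
      _ = _ := by
          have : ζ.im + δ ≠ 0 := by positivity
          field_simp

theorem tendsto_integral_div_sub (hc : 0 ≤ c) (hδ : 0 < δ)
    (hg : DifferentiableOn ℂ g {ζ | 0 ≤ ζ.im})
    (hb : ∀ ζ : ℂ, 0 ≤ ζ.im → ‖g ζ‖ ≤ c / (ζ.im + δ)) {z : ℂ} (hz : 0 < z.im) :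
    Tendsto (fun n : ℕ => ∫ t in (-((n : ℝ) ^ 3))..((n : ℝ) ^ 3), g t / (t - z)) atTop
      (𝓝 (2 * Real.pi * Complex.I * g z)) := by
  set w : ℂ := (starRingEnd ℂ) z with hw
  have hwim : w.im = -z.im := Complex.conj_im z
  have hwn : ‖w‖ = ‖z‖ := Complex.norm_conj z
  have hne : ∀ ζ : ℂ, 0 ≤ ζ.im → ζ - w ≠ 0 := by
    intro ζ hζ h
    rw [sub_eq_zero.mp h, hwim] at hζ
    linarith
  -- Subtracting a multiple of `1 / (ζ - z̄)` makes the singularity at `z` removable.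
  set H : ℂ → ℂ := fun ζ => g ζ - g z * (z - w) / (ζ - w) with hH
  have hHz : H z = 0 := by
    simp only [hH]
    rw [mul_div_assoc, div_self (hne z hz.le), mul_one, sub_self]
  have hHd : DifferentiableOn ℂ H {ζ | 0 ≤ ζ.im} :=
    hg.sub ((differentiableOn_const _).div (by fun_prop) fun ζ hζ => hne ζ hζ)
  have hnhds : {ζ : ℂ | 0 ≤ ζ.im} ∈ 𝓝 z := by
    filter_upwards [(isOpen_lt continuous_const Complex.continuous_im).mem_nhds hz] with ζ hζ
    exact le_of_lt hζ
  have hds : DifferentiableOn ℂ (dslope H z) {ζ | 0 ≤ ζ.im} :=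
    (Complex.differentiableOn_dslope hnhds).mpr hHd
  have hform : ∀ ζ : ℂ, ζ ≠ z → dslope H z ζ = H ζ / (ζ - z) := by
    intro ζ hζ
    rw [dslope_of_ne _ hζ, slope_def_field, hHz, sub_zero]
  have hlim := tendsto_integral_real_line_zero (K := dslope H z)
    (C := 2 * (c + 4 * ‖g z * (z - w)‖)) (δ := δ)
    (R := 2 * ‖z‖ + 1 + δ) (by positivity) hδ hds (by
      intro ζ hζ hR
      have h0 : 0 < ‖ζ‖ := by linarith [norm_nonneg z]
      have h1 : ‖ζ‖ / 2 ≤ ‖ζ - w‖ := norm_sub_ge_half (by rw [hwn]; linarith)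
      have h2 : ‖ζ‖ / 2 ≤ ‖ζ - z‖ := norm_sub_ge_half (by linarith)
      have hζz : ζ ≠ z := by
        rintro rfl
        linarith [norm_nonneg ζ]
      have hy : 0 < ζ.im + δ := by positivity
      have h3 : ζ.im + δ ≤ 2 * ‖ζ‖ := by
        have := (le_abs_self _).trans (Complex.abs_im_le_norm ζ)
        linarith [norm_nonneg z]
      rw [hform ζ hζz, norm_div]
      have h4 : ‖H ζ‖ ≤ (c + 4 * ‖g z * (z - w)‖) / (ζ.im + δ) := by
        refine (norm_sub_le _ _).trans ?_
        rw [norm_div, add_div]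
        refine add_le_add (hb ζ hζ) ?_
        calc ‖g z * (z - w)‖ / ‖ζ - w‖ ≤ ‖g z * (z - w)‖ / (‖ζ‖ / 2) := by gcongr
          _ = 4 * ‖g z * (z - w)‖ / (2 * ‖ζ‖) := by field_simp; ring
          _ ≤ _ := by gcongr
      calc ‖H ζ‖ / ‖ζ - z‖ ≤ ((c + 4 * ‖g z * (z - w)‖) / (ζ.im + δ)) / (‖ζ‖ / 2) := by gcongr
        _ = _ := by field_simp)
  have hpois := (tendsto_integral_poisson_kernel (x := z.re) hz)
  have hpoisC : Tendsto (fun n : ℕ => 2 * Complex.I * g z *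
      ((∫ t in (-((n : ℝ) ^ 3))..((n : ℝ) ^ 3), z.im / ((t - z.re) ^ 2 + z.im ^ 2) : ℝ) : ℂ))
      atTop (𝓝 (2 * Complex.I * g z * (Real.pi : ℂ))) :=
    ((Complex.continuous_ofReal.tendsto _).comp hpois).const_mul _
  have hsum := hlim.add hpoisC
  have hzt : ∀ t : ℝ, (t : ℂ) - z ≠ 0 := by
    intro t h
    have := congrArg Complex.im h
    simp at this
    linarith
  refine (hsum.congr fun n => ?_).trans (by
    rw [show 0 + 2 * Complex.I * g z * (Real.pi : ℂ) = 2 * Real.pi * Complex.I * g z by ring])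
  rw [← intervalIntegral.integral_ofReal, ← intervalIntegral.integral_const_mul,
    ← intervalIntegral.integral_add]
  · refine intervalIntegral.integral_congr fun t _ => ?_
    rw [hform t (fun h => hzt t (sub_eq_zero.mpr h))]
    have e1 : ((z.im / ((t - z.re) ^ 2 + z.im ^ 2) : ℝ) : ℂ) * (2 * Complex.I)
        = (z - w) / ((t - w) * (t - z)) := by
      have : ((t : ℂ) - w) * (t - z) = (((t - z.re) ^ 2 + z.im ^ 2 : ℝ) : ℂ) := by
        apply Complex.ext <;> simp [hw, pow_two] <;> ring
      rw [this]
      have h' : z - w = ((2 * z.im : ℝ) : ℂ) * Complex.I := by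
        rw [hw, Complex.sub_conj]
      rw [h']
      push_cast
      ring
    have h1 := hne t (by simp)
    have h2 := hzt t
    simp only [hH]
    rw [show 2 * Complex.I * g z * ((z.im / ((t - z.re) ^ 2 + z.im ^ 2) : ℝ) : ℂ)
      = g z * (((z.im / ((t - z.re) ^ 2 + z.im ^ 2) : ℝ) : ℂ) * (2 * Complex.I)) by ring, e1]
    field_simp
    ring
  · refine ContinuousOn.intervalIntegrable ?_
    exact hds.continuousOn.comp Complex.continuous_ofReal.continuousOn fun t _ => by simp
  · refine Continuous.intervalIntegrable ?_ _ _
    refine continuous_const.mul (Complex.continuous_ofReal.comp ?_)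
    refine continuous_const.div (by fun_prop) fun t => ?_
    positivity

/-- Cauchy's formula for the half-plane, in the form that only uses the imaginary part of the
boundary values. -/
theorem tendsto_integral_im_div_sub (hc : 0 ≤ c) (hδ : 0 < δ)
    (hg : DifferentiableOn ℂ g {ζ | 0 ≤ ζ.im})
    (hb : ∀ ζ : ℂ, 0 ≤ ζ.im → ‖g ζ‖ ≤ c / (ζ.im + δ)) {z : ℂ} (hz : 0 < z.im) :
    Tendsto (fun n : ℕ => ∫ t in (-((n : ℝ) ^ 3))..((n : ℝ) ^ 3), ((g t).im : ℂ) / (t - z)) atTop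
      (𝓝 (Real.pi * g z)) := by
  have h1 := tendsto_integral_div_sub hc hδ hg hb hz
  have h2 := tendsto_integral_div_sub_conj hc hδ hg hb (w := (starRingEnd ℂ) z)
    (by rw [Complex.conj_im]; linarith)
  have h3 := (h1.sub ((Complex.continuous_conj.tendsto _).comp h2)).div_const (2 * Complex.I)
  have hgc : Continuous fun t : ℝ => g t :=
    hg.continuousOn.comp_continuous Complex.continuous_ofReal fun t => by simp
  have hzt : ∀ t : ℝ, (t : ℂ) - z ≠ 0 := by
    intro t h
    have := congrArg Complex.im h
    simp at this
    linarith
  refine (h3.congr fun n => ?_).trans (by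
    rw [map_zero, sub_zero, show 2 * Real.pi * Complex.I * g z / (2 * Complex.I)
      = Real.pi * g z by field_simp])
  simp only [Function.comp]
  rw [conj_intervalIntegral, ← intervalIntegral.integral_sub,
    ← intervalIntegral.integral_div]
  · refine intervalIntegral.integral_congr fun t _ => ?_
    simp only [map_div₀, map_sub, Complex.conj_conj, Complex.conj_ofReal]
    have h := hzt t
    rw [← sub_div, Complex.sub_conj]
    field_simp
    push_cast
    ring
  · exact (hgc.div (by fun_prop) hzt).intervalIntegrable _ _
  · refine Continuous.intervalIntegrable ?_ _ _
    refine Complex.continuous_conj.comp (hgc.div (by fun_prop) fun t h => hzt t ?_)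
    have := congrArg (starRingEnd ℂ) h
    simpa using this

/-- The imaginary part of the boundary values has total mass at most `π c`. -/
theorem intervalIntegral_im_le (hc : 0 ≤ c) (hδ : 0 < δ)
    (hg : DifferentiableOn ℂ g {ζ | 0 ≤ ζ.im})
    (hb : ∀ ζ : ℂ, 0 ≤ ζ.im → ‖g ζ‖ ≤ c / (ζ.im + δ)) (hpos : ∀ t : ℝ, 0 ≤ (g t).im) {N : ℝ}
    (hN : 0 ≤ N) : ∫ t in (-N)..N, (g t).im ≤ Real.pi * c := by
  have hgc : Continuous fun t : ℝ => (g t).im :=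
    Complex.continuous_im.comp
      (hg.continuousOn.comp_continuous Complex.continuous_ofReal fun t => by simp)
  have hcube : Tendsto (fun n : ℕ => (n : ℝ) ^ 3) atTop atTop :=
    (tendsto_pow_atTop (by norm_num)).comp tendsto_natCast_atTop_atTop
  -- Compare with the Poisson integral at `i y`.
  have key : ∀ y : ℝ, 0 < y →
      (∫ t in (-N)..N, (g t).im) * (y ^ 2 / (N ^ 2 + y ^ 2)) ≤ Real.pi * c := by
    intro y hy
    have hP : Continuous fun t : ℝ => (g t).im * (y / (t ^ 2 + y ^ 2)) := by
      refine hgc.mul (continuous_const.div (by fun_prop) fun t => ?_)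
      positivity
    have hlim := tendsto_integral_im_div_sub hc hδ hg hb (z := (y : ℂ) * Complex.I) (by simpa)
    have hlim' := (Complex.continuous_im.tendsto _).comp hlim
    have hle : ∀ᶠ n : ℕ in atTop, (∫ t in (-N)..N, (g t).im * (y / (t ^ 2 + y ^ 2))) ≤
        (Complex.im ∘ fun n : ℕ => ∫ t in (-((n : ℝ) ^ 3))..((n : ℝ) ^ 3),
          ((g t).im : ℂ) / (t - (y : ℂ) * Complex.I)) n := by
      filter_upwards [hcube.eventually_ge_atTop N] with n hn
      have hcont : Continuous fun t : ℝ => ((g t).im : ℂ) / (t - (y : ℂ) * Complex.I) := by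
        refine (Complex.continuous_ofReal.comp hgc).div (by fun_prop) fun t h => ?_
        have := congrArg Complex.im h
        simp at this
        exact hy.ne' this
      have e : (Complex.im ∘ fun n : ℕ => ∫ t in (-((n : ℝ) ^ 3))..((n : ℝ) ^ 3),
          ((g t).im : ℂ) / (t - (y : ℂ) * Complex.I)) n
          = ∫ t in (-((n : ℝ) ^ 3))..((n : ℝ) ^ 3), (g t).im * (y / (t ^ 2 + y ^ 2)) := by
        have := Complex.imCLM.intervalIntegral_comp_comm
          (hcont.intervalIntegrable (μ := volume) (-((n : ℝ) ^ 3)) ((n : ℝ) ^ 3))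
        simp only [Complex.imCLM_apply] at this
        rw [Function.comp, ← this]
        refine intervalIntegral.integral_congr fun t _ => ?_
        have hns : Complex.normSq ((t : ℂ) - y * Complex.I) = t ^ 2 + y ^ 2 := by
          simp [Complex.normSq_apply]; ring
        simp only [div_eq_mul_inv, Complex.im_ofReal_mul, Complex.inv_im, hns]
        simp
      rw [e]
      refine intervalIntegral.integral_mono_interval (by linarith) (by linarith) hn ?_
        (hP.intervalIntegrable _ _)
      refine Eventually.of_forall fun t => ?_
      have := hpos t
      simp only [Pi.zero_apply]
      positivity
    have h1 := le_of_tendsto_of_tendsto tendsto_const_nhds hlim' hle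
    have h2 : (Real.pi * g ((y : ℂ) * Complex.I)).im ≤ Real.pi * (c / y) := by
      rw [Complex.im_ofReal_mul]
      gcongr
      refine ((le_abs_self _).trans (Complex.abs_im_le_norm _)).trans ((hb _ (by simp; linarith)).trans ?_)
      have : ((y : ℂ) * Complex.I).im = y := by simp
      rw [this]
      gcongr
      linarith
    have h3 : (∫ t in (-N)..N, (g t).im * (y / (N ^ 2 + y ^ 2)))
        ≤ ∫ t in (-N)..N, (g t).im * (y / (t ^ 2 + y ^ 2)) := by
      refine intervalIntegral.integral_mono_on (by linarith)
        ((hgc.mul continuous_const).intervalIntegrable _ _) (hP.intervalIntegrable _ _)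
        fun t ht => ?_
      have h := hpos t
      have : t ^ 2 ≤ N ^ 2 := sq_le_sq' ht.1 ht.2
      gcongr
    rw [intervalIntegral.integral_mul_const] at h3
    have h4 := (h3.trans h1).trans h2
    calc _ = (∫ t in (-N)..N, (g t).im) * (y / (N ^ 2 + y ^ 2)) * y := by ring
      _ ≤ Real.pi * (c / y) * y := by gcongr
      _ = _ := by field_simp
  have hy2 : Tendsto (fun y : ℝ => y ^ 2 / (N ^ 2 + y ^ 2)) atTop (𝓝 1) := by
    have h0 : Tendsto (fun y : ℝ => N ^ 2 / (N ^ 2 + y ^ 2)) atTop (𝓝 0) :=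
      tendsto_const_nhds.div_atTop (tendsto_atTop_add_const_left _ _ (tendsto_pow_atTop (by norm_num)))
    have := (tendsto_const_nhds (x := (1 : ℝ))).sub h0
    rw [sub_zero] at this
    refine this.congr' ?_
    filter_upwards [eventually_gt_atTop 0] with y hy
    field_simp
    ring
  have := le_of_tendsto (hy2.const_mul (∫ t in (-N)..N, (g t).im))
    (by filter_upwards [eventually_gt_atTop 0] with y hy using key y hy)
  simpa using this

theorem integrable_im (hc : 0 ≤ c) (hδ : 0 < δ)
    (hg : DifferentiableOn ℂ g {ζ | 0 ≤ ζ.im})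
    (hb : ∀ ζ : ℂ, 0 ≤ ζ.im → ‖g ζ‖ ≤ c / (ζ.im + δ)) (hpos : ∀ t : ℝ, 0 ≤ (g t).im) :
    Integrable fun t : ℝ => (g t).im := by
  have hgc : Continuous fun t : ℝ => (g t).im :=
    Complex.continuous_im.comp
      (hg.continuousOn.comp_continuous Complex.continuous_ofReal fun t => by simp)
  refine integrable_of_intervalIntegral_norm_bounded (Real.pi * c) (a := fun n : ℕ => -(n : ℝ))
    (b := fun n : ℕ => (n : ℝ)) (l := atTop) (fun n => ?_)
    (tendsto_neg_atTop_atBot.comp tendsto_natCast_atTop_atTop) tendsto_natCast_atTop_atTop ?_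
  · exact hgc.integrableOn_Ioc
  · refine Eventually.of_forall fun n => ?_
    refine le_trans (le_of_eq ?_)
      (intervalIntegral_im_le hc hδ hg hb hpos (N := n) (Nat.cast_nonneg n))
    refine intervalIntegral.integral_congr fun t _ => ?_
    exact Real.norm_of_nonneg (hpos t)

theorem integral_im_le (hc : 0 ≤ c) (hδ : 0 < δ)
    (hg : DifferentiableOn ℂ g {ζ | 0 ≤ ζ.im})
    (hb : ∀ ζ : ℂ, 0 ≤ ζ.im → ‖g ζ‖ ≤ c / (ζ.im + δ)) (hpos : ∀ t : ℝ, 0 ≤ (g t).im) :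
    ∫ t : ℝ, (g t).im ≤ Real.pi * c :=
  le_of_tendsto (intervalIntegral_tendsto_integral (integrable_im hc hδ hg hb hpos)
    (tendsto_neg_atTop_atBot.comp tendsto_natCast_atTop_atTop) tendsto_natCast_atTop_atTop)
    (Eventually.of_forall fun n : ℕ =>
      intervalIntegral_im_le hc hδ hg hb hpos (N := n) (Nat.cast_nonneg n))

theorem norm_inv_ofReal_sub_le {z : ℂ} (hz : z.im ≠ 0) (t : ℝ) :
    ‖((t : ℂ) - z)⁻¹‖ ≤ |z.im|⁻¹ := by
  rw [norm_inv]
  have : |z.im| ≤ ‖(t : ℂ) - z‖ := by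
    have := Complex.abs_im_le_norm ((t : ℂ) - z)
    simpa using this
  have h0 : 0 < |z.im| := abs_pos.mpr hz
  gcongr

theorem ofReal_sub_ne_zero {z : ℂ} (hz : z.im ≠ 0) (t : ℝ) : (t : ℂ) - z ≠ 0 := by
  intro h
  have := congrArg Complex.im h
  simp at this
  exact hz this

theorem integral_im_div_sub (hc : 0 ≤ c) (hδ : 0 < δ)
    (hg : DifferentiableOn ℂ g {ζ | 0 ≤ ζ.im})
    (hb : ∀ ζ : ℂ, 0 ≤ ζ.im → ‖g ζ‖ ≤ c / (ζ.im + δ)) (hpos : ∀ t : ℝ, 0 ≤ (g t).im)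
    {z : ℂ} (hz : 0 < z.im) :
    ∫ t : ℝ, ((g t).im : ℂ) / (t - z) = Real.pi * g z := by
  have hcube : Tendsto (fun n : ℕ => (n : ℝ) ^ 3) atTop atTop :=
    (tendsto_pow_atTop (by norm_num)).comp tendsto_natCast_atTop_atTop
  have hint : Integrable fun t : ℝ => ((g t).im : ℂ) / (t - z) := by
    refine (integrable_im hc hδ hg hb hpos).ofReal.mul_bdd (c := |z.im|⁻¹) ?_ ?_
    · refine Continuous.aestronglyMeasurable ?_
      exact Continuous.inv₀ (by fun_prop) (ofReal_sub_ne_zero hz.ne')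
    · exact Eventually.of_forall (norm_inv_ofReal_sub_le hz.ne')
  exact tendsto_nhds_unique (intervalIntegral_tendsto_integral hint
    (tendsto_neg_atTop_atBot.comp hcube) hcube) (tendsto_integral_im_div_sub hc hδ hg hb hz)

end CauchyTransform

/-! ### The Herglotz representation -/

/-- Holomorphic functions on the upper half-plane with nonnegative imaginary part which are bounded
by `c / Im z`. These are the Cauchy transforms of the measures on `ℝ` of mass at most `c`. -/
structure IsHerglotz (c : ℝ) (f : ℂ → ℂ) : Prop where
  differentiableOn : DifferentiableOn ℂ f {z | 0 < z.im}
  im_nonneg : ∀ z : ℂ, 0 < z.im → 0 ≤ (f z).im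
  norm_le : ∀ z : ℂ, 0 < z.im → ‖f z‖ ≤ c / z.im

/-- The density `Im f(t + i / (n + 1)) / π`; the measures with these densities approximate the
representing measure of `f`. -/
noncomputable def density (f : ℂ → ℂ) (n : ℕ) (t : ℝ) : ℝ :=
  (f (t + ((1 / ((n : ℝ) + 1) : ℝ) : ℂ) * Complex.I)).im / Real.pi

namespace IsHerglotz

variable {c : ℝ} {f : ℂ → ℂ}

theorem const_nonneg (h : IsHerglotz c f) : 0 ≤ c := by
  simpa using (norm_nonneg _).trans (h.norm_le Complex.I (by simp))

theorem shift_differentiableOn (h : IsHerglotz c f) {δ : ℝ} (hδ : 0 < δ) :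
    DifferentiableOn ℂ (fun ζ => f (ζ + δ * Complex.I)) {ζ | 0 ≤ ζ.im} :=
  h.differentiableOn.comp (by fun_prop) fun ζ (hζ : 0 ≤ ζ.im) => by
    simpa using add_pos_of_nonneg_of_pos hζ hδ

theorem shift_norm_le (h : IsHerglotz c f) {δ : ℝ} (hδ : 0 < δ) (ζ : ℂ) (hζ : 0 ≤ ζ.im) :
    ‖f (ζ + δ * Complex.I)‖ ≤ c / (ζ.im + δ) := by
  have e : (ζ + δ * Complex.I).im = ζ.im + δ := by simp
  rw [← e]
  exact h.norm_le _ (by rw [e]; positivity)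

theorem shift_im_nonneg (h : IsHerglotz c f) {δ : ℝ} (hδ : 0 < δ) (t : ℝ) :
    0 ≤ (f (t + δ * Complex.I)).im :=
  h.im_nonneg _ (by simpa)

theorem density_nonneg (h : IsHerglotz c f) (n : ℕ) (t : ℝ) : 0 ≤ density f n t :=
  div_nonneg (h.shift_im_nonneg (by positivity) t) Real.pi_pos.le

theorem integrable_density (h : IsHerglotz c f) (n : ℕ) : Integrable (density f n) :=
  (integrable_im h.const_nonneg (by positivity) (h.shift_differentiableOn (by positivity))
    (h.shift_norm_le (by positivity)) (h.shift_im_nonneg (δ := 1 / ((n : ℝ) + 1))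
      (by positivity))).div_const _

theorem integral_density_le (h : IsHerglotz c f) (n : ℕ) : ∫ t, density f n t ≤ c := by
  have := integral_im_le h.const_nonneg (by positivity) (h.shift_differentiableOn (by positivity))
    (h.shift_norm_le (by positivity)) (h.shift_im_nonneg (δ := 1 / ((n : ℝ) + 1)) (by positivity))
  unfold density
  rw [integral_div, div_le_iff₀ Real.pi_pos]
  linarith

theorem integral_inv_sub_density (h : IsHerglotz c f) (n : ℕ) {z : ℂ} (hz : 0 < z.im) :
    ∫ t : ℝ, ((t : ℂ) - z)⁻¹ * density f n t
      = f (z + ((1 / ((n : ℝ) + 1) : ℝ) : ℂ) * Complex.I) := by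
  have := integral_im_div_sub h.const_nonneg (by positivity)
    (h.shift_differentiableOn (by positivity)) (h.shift_norm_le (by positivity))
    (h.shift_im_nonneg (δ := 1 / ((n : ℝ) + 1)) (by positivity)) hz
  have e : ∀ t : ℝ, ((t : ℂ) - z)⁻¹ * density f n t =
      (((f (t + ((1 / ((n : ℝ) + 1) : ℝ) : ℂ) * Complex.I)).im : ℂ) / (t - z)) / Real.pi := by
    intro t
    unfold density
    push_cast
    ring
  simp only [e]
  rw [integral_div, this]
  field_simp

theorem integrable_bdd_mul_density (h : IsHerglotz c f) (n : ℕ) {k : ℝ → ℂ} {b : ℝ}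
    (hk : Continuous k) (hb : ∀ t, ‖k t‖ ≤ b) : Integrable fun t => k t * density f n t :=
  (h.integrable_density n).ofReal.bdd_mul hk.aestronglyMeasurable (Eventually.of_forall hb)

theorem norm_integral_mul_density_le (h : IsHerglotz c f) (n : ℕ) {k : ℝ → ℂ} {b : ℝ}
    (hb : ∀ t, ‖k t‖ ≤ b) : ‖∫ t, k t * density f n t‖ ≤ b * c := by
  have hb0 : 0 ≤ b := (norm_nonneg _).trans (hb 0)
  refine (norm_integral_le_of_norm_le ((h.integrable_density n).const_mul b)
    (Eventually.of_forall fun t => ?_)).trans ?_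
  · rw [norm_mul, Complex.norm_real, Real.norm_of_nonneg (h.density_nonneg n t)]
    have := h.density_nonneg n t
    gcongr
    exact hb t
  · rw [integral_const_mul]
    have := h.integral_density_le n
    gcongr

theorem exists_tendsto (h : IsHerglotz c f) (g : C_c(ℝ, ℝ)) :
    ∃ x, |x| ≤ c * (⨆ t, |g t|) ∧ Tendsto (fun n => ∫ t, g t * density f n t)
      (hyperfilter ℕ : Filter ℕ) (𝓝 x) := by
  set b := ⨆ t, |g t|
  have hbd : ∀ t, |g t| ≤ b := fun t => by
    refine le_ciSup (f := fun t => |g t|) ?_ t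
    obtain ⟨C, hC⟩ := g.hasCompactSupport.exists_bound_of_continuous g.continuous
    exact ⟨C, by rintro _ ⟨s, rfl⟩; exact hC s⟩
  have hmem : ∀ n, (∫ t, g t * density f n t) ∈ Set.Icc (-(c * b)) (c * b) := by
    intro n
    rw [Set.mem_Icc, ← abs_le]
    have := h.norm_integral_mul_density_le n (k := fun t => (g t : ℂ)) (b := b) (fun t => by
      simpa using hbd t)
    have e : ∫ t, ((g t : ℂ)) * density f n t = ((∫ t, g t * density f n t : ℝ) : ℂ) := by
      rw [← integral_complex_ofReal]
      congr 1; funext t; simp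
    rw [e, Complex.norm_real, Real.norm_eq_abs] at this
    linarith
  obtain ⟨x, hx, hlim⟩ := isCompact_Icc.ultrafilter_le_nhds
    ((hyperfilter ℕ).map fun n => ∫ t, g t * density f n t)
    (by
      rw [le_principal_iff]
      exact Filter.mem_map.mpr (Filter.univ_mem' hmem))
  exact ⟨x, abs_le.mpr hx, hlim⟩

theorem integrable_mul_density (h : IsHerglotz c f) (g : C_c(ℝ, ℝ)) (n : ℕ) :
    Integrable fun t => g t * density f n t := by
  obtain ⟨C, hC⟩ := g.hasCompactSupport.exists_bound_of_continuous g.continuous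
  exact (h.integrable_density n).bdd_mul g.continuous.aestronglyMeasurable
    (Eventually.of_forall hC)

/-- The weak limit, along an ultrafilter, of the measures with density `density f n`. -/
noncomputable def limitFunctional (h : IsHerglotz c f) : C_c(ℝ, ℝ) →ₚ[ℝ] ℝ :=
  PositiveLinearMap.mk₀
    { toFun := fun g => (h.exists_tendsto g).choose
      map_add' := fun g₁ g₂ => by
        refine tendsto_nhds_unique (h.exists_tendsto (g₁ + g₂)).choose_spec.2
          (((h.exists_tendsto g₁).choose_spec.2.add (h.exists_tendsto g₂).choose_spec.2).congr
            fun n => ?_)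
        rw [← integral_add (h.integrable_mul_density g₁ n) (h.integrable_mul_density g₂ n)]
        congr 1; funext t
        simp [add_mul]
      map_smul' := fun r g => by
        refine tendsto_nhds_unique (h.exists_tendsto (r • g)).choose_spec.2
          (((h.exists_tendsto g).choose_spec.2.const_mul r).congr fun n => ?_)
        rw [← integral_const_mul]
        congr 1; funext t
        simp [mul_assoc] }
    fun g hg => ge_of_tendsto' (h.exists_tendsto g).choose_spec.2 fun n =>
      integral_nonneg fun t => mul_nonneg (hg t) (h.density_nonneg n t)

theorem tendsto_limitFunctional (h : IsHerglotz c f) (g : C_c(ℝ, ℝ)) :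
    Tendsto (fun n => ∫ t, g t * density f n t) (hyperfilter ℕ : Filter ℕ)
      (𝓝 (h.limitFunctional g)) :=
  (h.exists_tendsto g).choose_spec.2

/-- The representing measure of `f` on the real line. -/
noncomputable def measure (h : IsHerglotz c f) : Measure ℝ := RealRMK.rieszMeasure h.limitFunctional

theorem tendsto_integral (h : IsHerglotz c f) (g : C_c(ℝ, ℝ)) :
    Tendsto (fun n => ∫ t, g t * density f n t) (hyperfilter ℕ : Filter ℕ)
      (𝓝 (∫ t, g t ∂h.measure)) := by
  rw [measure, RealRMK.integral_rieszMeasure]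
  exact h.tendsto_limitFunctional g

end IsHerglotz

theorem integral_eq_re_add_im {X : Type*} [MeasurableSpace X] {μ : Measure X} {F : X → ℂ}
    (hF : Integrable F μ) : ∫ t, F t ∂μ
      = ((∫ t, (F t).re ∂μ : ℝ) : ℂ) + ((∫ t, (F t).im ∂μ : ℝ) : ℂ) * Complex.I :=
  (integral_re_add_im hF).symm

/-- A continuous cutoff function, equal to `1` on `[-N, N]` and to `0` off `[-N - 1, N + 1]`. -/
noncomputable def cutoff (N : ℕ) : C_c(ℝ, ℝ) where
  toFun t := max 0 (min 1 ((N : ℝ) + 1 - |t|))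
  continuous_toFun := by fun_prop
  hasCompactSupport' := by
    refine HasCompactSupport.intro (isCompact_Icc (a := -((N : ℝ) + 1)) (b := (N : ℝ) + 1))
      fun t ht => ?_
    have : (N : ℝ) + 1 ≤ |t| := by
      by_contra hlt
      exact ht (Set.mem_Icc.mpr (abs_le.mp (not_le.mp hlt).le))
    rw [max_eq_left]
    exact (min_le_right _ _).trans (by linarith)

theorem cutoff_apply (N : ℕ) (t : ℝ) : cutoff N t = max 0 (min 1 ((N : ℝ) + 1 - |t|)) := rfl

theorem cutoff_nonneg (N : ℕ) (t : ℝ) : 0 ≤ cutoff N t := le_max_left _ _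

theorem cutoff_le_one (N : ℕ) (t : ℝ) : cutoff N t ≤ 1 :=
  max_le zero_le_one (min_le_left _ _)

theorem cutoff_eq_one {N : ℕ} {t : ℝ} (ht : |t| ≤ N) : cutoff N t = 1 := by
  rw [cutoff_apply, min_eq_left (by linarith), max_eq_right zero_le_one]

namespace IsHerglotz

variable {c : ℝ} {f : ℂ → ℂ}

instance (h : IsHerglotz c f) : IsFiniteMeasureOnCompacts h.measure := by
  unfold measure; infer_instance

theorem integral_le_of_le_one (h : IsHerglotz c f) {g : C_c(ℝ, ℝ)} (hg : ∀ t, g t ≤ 1) :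
    ∫ t, g t ∂h.measure ≤ c := by
  refine le_of_tendsto' (h.tendsto_integral g) fun n =>
    (integral_mono (h.integrable_mul_density g n) (h.integrable_density n) fun t => ?_).trans
      (h.integral_density_le n)
  exact mul_le_of_le_one_left (h.density_nonneg n t) (hg t)

theorem measure_univ_le (h : IsHerglotz c f) : h.measure Set.univ ≤ ENNReal.ofReal c := by
  have hN : ∀ N : ℕ, h.measure (Set.Icc (-(N : ℝ)) N) ≤ ENNReal.ofReal c := by
    intro N
    calc h.measure (Set.Icc (-(N : ℝ)) N)
        = ∫⁻ t, (Set.Icc (-(N : ℝ)) N).indicator 1 t ∂h.measure := by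
          rw [lintegral_indicator_one measurableSet_Icc]
      _ ≤ ∫⁻ t, ENNReal.ofReal (cutoff N t) ∂h.measure := by
          refine lintegral_mono fun t => ?_
          by_cases ht : t ∈ Set.Icc (-(N : ℝ)) N
          · simp [Set.indicator_of_mem ht, cutoff_eq_one (abs_le.mpr ht)]
          · simp [Set.indicator_of_notMem ht]
      _ = ENNReal.ofReal (∫ t, cutoff N t ∂h.measure) := by
          rw [ofReal_integral_eq_lintegral_ofReal (f := fun t => cutoff N t)
            ((cutoff N).continuous.integrable_of_hasCompactSupport (cutoff N).hasCompactSupport)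
            (Eventually.of_forall (cutoff_nonneg N))]
      _ ≤ _ := ENNReal.ofReal_le_ofReal (h.integral_le_of_le_one (cutoff_le_one N))
  have hU : (⋃ N : ℕ, Set.Icc (-(N : ℝ)) N) = Set.univ := by
    refine Set.eq_univ_of_forall fun t => Set.mem_iUnion.mpr ?_
    obtain ⟨N, hN⟩ := exists_nat_ge |t|
    exact ⟨N, abs_le.mp hN⟩
  rw [← hU, Directed.measure_iUnion]
  · exact iSup_le hN
  · refine Monotone.directed_le fun a b hab => ?_
    have : (a : ℝ) ≤ b := by exact_mod_cast hab
    exact Set.Icc_subset_Icc (by linarith) this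

instance (h : IsHerglotz c f) : IsFiniteMeasure h.measure :=
  ⟨h.measure_univ_le.trans_lt ENNReal.ofReal_lt_top⟩

theorem measureReal_univ_le (h : IsHerglotz c f) : h.measure.real Set.univ ≤ c :=
  ENNReal.toReal_le_of_le_ofReal h.const_nonneg h.measure_univ_le

theorem tendsto_integral_complex (h : IsHerglotz c f) {k : ℝ → ℂ} (hk : Continuous k)
    {b : ℝ} (hb : ∀ t, ‖k t‖ ≤ b) (N : ℕ) :
    Tendsto (fun n => ∫ t, (k t * cutoff N t) * density f n t) (hyperfilter ℕ : Filter ℕ)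
      (𝓝 (∫ t, k t * cutoff N t ∂h.measure)) := by
  have hkb : ∀ t, ‖k t * cutoff N t‖ ≤ b := fun t => by
    rw [norm_mul, Complex.norm_real, Real.norm_of_nonneg (cutoff_nonneg N t)]
    exact (mul_le_of_le_one_right (norm_nonneg _) (cutoff_le_one N t)).trans (hb t)
  have hkc : Continuous fun t => k t * (cutoff N t : ℂ) :=
    hk.mul (Complex.continuous_ofReal.comp (cutoff N).continuous)
  let gr : C_c(ℝ, ℝ) := ⟨⟨fun t => (k t).re * cutoff N t, by fun_prop⟩,
    (cutoff N).hasCompactSupport.mul_left⟩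
  let gi : C_c(ℝ, ℝ) := ⟨⟨fun t => (k t).im * cutoff N t, by fun_prop⟩,
    (cutoff N).hasCompactSupport.mul_left⟩
  have e1 : ∀ n, ∫ t, (k t * cutoff N t) * density f n t
      = ((∫ t, gr t * density f n t : ℝ) : ℂ)
        + ((∫ t, gi t * density f n t : ℝ) : ℂ) * Complex.I := by
    intro n
    rw [integral_eq_re_add_im (h.integrable_bdd_mul_density n hkc hkb)]
    simp [gr, gi]
  have e2 : ∫ t, k t * cutoff N t ∂h.measure
      = ((∫ t, gr t ∂h.measure : ℝ) : ℂ) + ((∫ t, gi t ∂h.measure : ℝ) : ℂ) * Complex.I := by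
    rw [integral_eq_re_add_im (Integrable.of_bound hkc.aestronglyMeasurable b
      (Eventually.of_forall hkb))]
    simp [gr, gi]
  simp only [e1, e2]
  exact ((Complex.continuous_ofReal.tendsto _).comp (h.tendsto_integral gr)).add
    (((Complex.continuous_ofReal.tendsto _).comp (h.tendsto_integral gi)).mul_const _)

/-- The Herglotz representation on the upper half-plane. -/
theorem integral_inv_sub (h : IsHerglotz c f) {z : ℂ} (hz : 0 < z.im) :
    ∫ t : ℝ, ((t : ℂ) - z)⁻¹ ∂h.measure = f z := by
  set k : ℝ → ℂ := fun t => ((t : ℂ) - z)⁻¹ with hk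
  have hkc : Continuous k := Continuous.inv₀ (by fun_prop) (ofReal_sub_ne_zero hz.ne')
  have hkb : ∀ t, ‖k t‖ ≤ |z.im|⁻¹ := norm_inv_ofReal_sub_le hz.ne'
  have hc := h.const_nonneg
  have hkχ : ∀ N : ℕ, Continuous fun t => k t * (cutoff N t : ℂ) := fun N =>
    hkc.mul (Complex.continuous_ofReal.comp (cutoff N).continuous)
  have hkχb : ∀ (N : ℕ) t, ‖k t * cutoff N t‖ ≤ |z.im|⁻¹ := fun N t => by
    rw [norm_mul, Complex.norm_real, Real.norm_of_nonneg (cutoff_nonneg N t)]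
    exact (mul_le_of_le_one_right (norm_nonneg _) (cutoff_le_one N t)).trans (hkb t)
  have htail : ∀ (M : ℕ) (t : ℝ), ‖k t - k t * cutoff (⌈‖z‖⌉₊ + (M + 1)) t‖ ≤ 1 / ((M : ℝ) + 1) := by
    intro M t
    by_cases ht : |t| ≤ ((⌈‖z‖⌉₊ + (M + 1) : ℕ) : ℝ)
    · rw [cutoff_eq_one ht]
      simp
      positivity
    · have h1 : (M : ℝ) + 1 ≤ ‖(t : ℂ) - z‖ := by
        have h2 := norm_sub_norm_le (t : ℂ) z
        rw [Complex.norm_real, Real.norm_eq_abs] at h2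
        have h3 := Nat.le_ceil ‖z‖
        push_cast at ht
        linarith
      have h4 : ‖k t‖ ≤ 1 / ((M : ℝ) + 1) := by
        simp only [hk]
        rw [norm_inv, one_div]
        gcongr
      have e : k t - k t * cutoff (⌈‖z‖⌉₊ + (M + 1)) t
          = k t * ((1 - cutoff (⌈‖z‖⌉₊ + (M + 1)) t : ℝ) : ℂ) := by
        push_cast; ring
      rw [e, norm_mul, Complex.norm_real, Real.norm_of_nonneg
        (by linarith [cutoff_le_one (⌈‖z‖⌉₊ + (M + 1)) t])]
      exact (mul_le_of_le_one_right (norm_nonneg _)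
        (by linarith [cutoff_nonneg (⌈‖z‖⌉₊ + (M + 1)) t])).trans h4
  -- The values `f (z + i / (n + 1))` are the Cauchy transforms of the approximating measures.
  have hf : Tendsto (fun n : ℕ => f (z + ((1 / ((n : ℝ) + 1) : ℝ) : ℂ) * Complex.I))
      (hyperfilter ℕ : Filter ℕ) (𝓝 (f z)) := by
    have hca : ContinuousAt f z := (h.differentiableOn.differentiableAt
      ((isOpen_lt continuous_const Complex.continuous_im).mem_nhds hz)).continuousAt
    have h0 : Tendsto (fun n : ℕ => z + ((1 / ((n : ℝ) + 1) : ℝ) : ℂ) * Complex.I) atTop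
        (𝓝 z) := by
      have := ((Complex.continuous_ofReal.tendsto _).comp
        (tendsto_one_div_add_atTop_nhds_zero_nat (𝕜 := ℝ))).mul_const Complex.I |>.const_add z
      simpa using this
    exact (hca.tendsto.comp h0).mono_left Nat.hyperfilter_le_atTop
  have key : ∀ M : ℕ, ‖(∫ t, k t ∂h.measure) - f z‖ ≤ 2 * c * (1 / ((M : ℝ) + 1)) := by
    intro M
    set N := ⌈‖z‖⌉₊ + (M + 1) with hN
    have h1 : ‖(∫ t, k t ∂h.measure) - ∫ t, k t * cutoff N t ∂h.measure‖
        ≤ c * (1 / ((M : ℝ) + 1)) := by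
      rw [← integral_sub (Integrable.of_bound hkc.aestronglyMeasurable _
        (Eventually.of_forall hkb)) (Integrable.of_bound (hkχ N).aestronglyMeasurable _
        (Eventually.of_forall (hkχb N)))]
      refine (norm_integral_le_of_norm_le_const (Eventually.of_forall (htail M))).trans ?_
      rw [mul_comm]
      have := h.measureReal_univ_le
      gcongr
    have h2 : ‖(∫ t, k t * cutoff N t ∂h.measure) - f z‖ ≤ c * (1 / ((M : ℝ) + 1)) := by
      refine le_of_tendsto' ((h.tendsto_integral_complex hkc hkb N).sub hf).norm fun n => ?_
      rw [← h.integral_inv_sub_density n hz,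
        ← integral_sub (h.integrable_bdd_mul_density n (hkχ N) (hkχb N))
          (h.integrable_bdd_mul_density n hkc hkb)]
      simp only [← sub_mul]
      rw [mul_comm c]
      refine h.norm_integral_mul_density_le n fun t => ?_
      rw [norm_sub_rev]
      exact htail M t
    calc _ ≤ _ := norm_sub_le_norm_sub_add_norm_sub _ (∫ t, k t * cutoff N t ∂h.measure) _
      _ ≤ _ := by linarith
  have hlim : Tendsto (fun M : ℕ => 2 * c * (1 / ((M : ℝ) + 1))) atTop (𝓝 0) := by
    simpa using (tendsto_one_div_add_atTop_nhds_zero_nat (𝕜 := ℝ)).const_mul (2 * c)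
  have := ge_of_tendsto' hlim key
  exact sub_eq_zero.mp (norm_le_zero_iff.mp this)

/-- The representing measure does not charge an interval to which `f` extends continuously with
real values. -/
theorem measure_Iio_eq_zero (h : IsHerglotz c f) {α : ℝ} (hcont : ContinuousOn f (slit α))
    (hreal : ∀ x : ℝ, x < α → (f x).im = 0) : h.measure (Set.Iio α) = 0 := by
  have hK : ∀ N : ℕ, h.measure (Set.Icc (α - (N + 1 : ℝ)) (α - 2 / ((N : ℝ) + 1))) = 0 := by
    intro N
    have hN : (0 : ℝ) < 1 / ((N : ℝ) + 1) := by positivity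
    set a := α - (N + 1 : ℝ)
    set d := 1 / ((N : ℝ) + 1) with hd
    set b := α - 2 / ((N : ℝ) + 1) with hb
    have hbd : b = α - 2 * d := by rw [hb, hd]; ring
    -- A bump function, equal to `1` on `[a, b]` and supported in `[a - d, b + d]`.
    let g : C_c(ℝ, ℝ) := ⟨⟨fun t => max 0 (1 - (max (a - t) (max (t - b) 0)) / d), by fun_prop⟩, by
      refine HasCompactSupport.intro (isCompact_Icc (a := a - d) (b := b + d)) fun t ht => ?_
      have : d ≤ max (a - t) (max (t - b) 0) := by
        by_contra hlt
        push Not at hlt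
        have h1 := (le_max_left _ _).trans_lt hlt
        have h2 := ((le_max_left _ _).trans (le_max_right (a - t) _)).trans_lt hlt
        exact ht ⟨by linarith, by linarith⟩
      have : 1 ≤ max (a - t) (max (t - b) 0) / d := by rwa [one_le_div hN]
      exact max_eq_left (by linarith)⟩
    have hg0 : ∀ t, 0 ≤ g t := fun t => le_max_left _ _
    have hg1 : ∀ t, g t ≤ 1 := fun t => max_le zero_le_one (by
      have : 0 ≤ max (a - t) (max (t - b) 0) / d :=
        div_nonneg ((le_max_right _ _).trans (le_max_right _ _)) hN.le
      linarith)
    have hgsupp : ∀ t, t ∉ Set.Icc (a - d) (b + d) → g t = 0 := by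
      intro t ht
      have : d ≤ max (a - t) (max (t - b) 0) := by
        by_contra hlt
        push Not at hlt
        have h1 := (le_max_left _ _).trans_lt hlt
        have h2 := ((le_max_left _ _).trans (le_max_right (a - t) _)).trans_lt hlt
        exact ht ⟨by linarith, by linarith⟩
      have : 1 ≤ max (a - t) (max (t - b) 0) / d := by rwa [one_le_div hN]
      exact max_eq_left (by linarith)
    have hgK : ∀ t ∈ Set.Icc a b, g t = 1 := by
      intro t ht
      have : max (a - t) (max (t - b) 0) = 0 := by
        rw [max_eq_right (a := t - b) (by linarith [ht.2]), max_eq_right (by linarith [ht.1])]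
      change max 0 (1 - (max (a - t) (max (t - b) 0)) / d) = 1
      rw [this]; simp
    have hmem : ∀ t ∈ Set.Icc (a - d) (b + d), ∀ s : ℝ, (t + s * Complex.I : ℂ) ∈ slit α := by
      intro t ht s
      right
      have h1 : t ≤ b + d := ht.2
      simp
      linarith
    have hcont2 : ContinuousOn (fun p : ℝ × ℝ => (f (p.1 + p.2 * Complex.I)).im)
        (Set.Icc (a - d) (b + d) ×ˢ Set.Icc 0 1) :=
      Complex.continuous_im.comp_continuousOn (hcont.comp (by fun_prop)
        fun p hp => hmem p.1 hp.1 p.2)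
    obtain ⟨C, hC⟩ := (isCompact_Icc.prod isCompact_Icc).exists_bound_of_continuousOn hcont2
    have hzero : Tendsto (fun n => ∫ t, g t * density f n t) atTop (𝓝 (∫ _ : ℝ, (0 : ℝ))) := by
      refine tendsto_integral_of_dominated_convergence
        ((Set.Icc (a - d) (b + d)).indicator fun _ => C / Real.pi)
        (fun n => (h.integrable_mul_density g n).aestronglyMeasurable)
        ((integrable_indicator_iff measurableSet_Icc).mpr (by simp)) (fun n => ?_) ?_
      · refine Eventually.of_forall fun t => ?_
        by_cases ht : t ∈ Set.Icc (a - d) (b + d)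
        · rw [Set.indicator_of_mem ht, norm_mul, Real.norm_of_nonneg (hg0 t)]
          have h1 := hC (t, 1 / ((n : ℝ) + 1)) ⟨ht, by positivity, by
            rw [div_le_one (by positivity)]; linarith [Nat.cast_nonneg (α := ℝ) n]⟩
          refine (mul_le_of_le_one_left (norm_nonneg _) (hg1 t)).trans ?_
          unfold density
          rw [norm_div, Real.norm_of_nonneg Real.pi_pos.le]
          gcongr
        · rw [Set.indicator_of_notMem ht, hgsupp t ht]
          simp
      · refine Eventually.of_forall fun t => ?_
        by_cases ht : t ∈ Set.Icc (a - d) (b + d)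
        · have hta : t < α := by linarith [ht.2]
          have hlim : Tendsto (fun n : ℕ => (t : ℂ) + ((1 / ((n : ℝ) + 1) : ℝ) : ℂ) * Complex.I)
              atTop (𝓝 (t : ℂ)) := by
            have := ((Complex.continuous_ofReal.tendsto _).comp
              (tendsto_one_div_add_atTop_nhds_zero_nat (𝕜 := ℝ))).mul_const Complex.I
              |>.const_add (t : ℂ)
            simpa using this
          have hlim2 : Tendsto (fun n : ℕ => (t : ℂ) + ((1 / ((n : ℝ) + 1) : ℝ) : ℂ) * Complex.I)
              atTop (𝓝[slit α] (t : ℂ)) :=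
            tendsto_nhdsWithin_iff.mpr ⟨hlim, Eventually.of_forall fun n => hmem t ht _⟩
          have h1 := (Complex.continuous_im.tendsto _).comp
            ((hcont (t : ℂ) (Or.inr (by simpa using hta))).tendsto.comp hlim2)
          rw [hreal t hta] at h1
          have h2 := (h1.div_const Real.pi).const_mul (g t)
          rw [zero_div, mul_zero] at h2
          exact h2
        · simp [hgsupp t ht]
    rw [integral_zero] at hzero
    have hint : ∫ t, g t ∂h.measure = 0 :=
      tendsto_nhds_unique (h.tendsto_integral g) (hzero.mono_left Nat.hyperfilter_le_atTop)
    rw [integral_eq_zero_iff_of_nonneg hg0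
      (g.continuous.integrable_of_hasCompactSupport g.hasCompactSupport)] at hint
    refine measure_mono_null (fun t ht => ?_) hint
    simp [hgK t ht]
  refine measure_mono_null (t := ⋃ N : ℕ, Set.Icc (α - (N + 1 : ℝ)) (α - 2 / ((N : ℝ) + 1)))
    (fun t ht => ?_) (measure_iUnion_null hK)
  have ht' : 0 < α - t := sub_pos.mpr ht
  obtain ⟨N₁, h1⟩ := exists_nat_ge (α - t)
  obtain ⟨N₂, h2⟩ := exists_nat_ge (2 / (α - t))
  refine Set.mem_iUnion.mpr ⟨N₁ + N₂, ?_, ?_⟩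
  · push_cast
    have : (0 : ℝ) ≤ N₂ := Nat.cast_nonneg _
    linarith
  · have : 2 / (((N₁ + N₂ : ℕ) : ℝ) + 1) ≤ α - t := by
      rw [div_le_iff₀ (by positivity)]
      rw [div_le_iff₀ ht'] at h2
      push_cast
      have : (0 : ℝ) ≤ N₁ := Nat.cast_nonneg _
      nlinarith
    linarith

end IsHerglotz

/-- Complex linear relations between finite measures can be tested on compactly supported
continuous functions. -/
theorem sum_mul_measureReal_eq_zero {ι : Type*} [Fintype ι] (a : ι → ℂ) (μ : ι → Measure ℝ)
    [∀ i, IsFiniteMeasure (μ i)]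
    (h : ∀ g : C_c(ℝ, ℝ), ∑ i, a i * ((∫ t, g t ∂μ i : ℝ) : ℂ) = 0) (B : Set ℝ) :
    ∑ i, a i * ((μ i).real B : ℂ) = 0 := by
  have real : ∀ r : ι → ℝ, (∀ g : C_c(ℝ, ℝ), ∑ i, r i * ∫ t, g t ∂μ i = 0) →
      ∑ i, r i * (μ i).real B = 0 := by
    intro r hr
    let P : Measure ℝ := ∑ i, (r i).toNNReal • μ i
    let Q : Measure ℝ := ∑ i, (-r i).toNNReal • μ i
    have hPQ : P = Q := by
      refine Measure.ext_of_integral_eq_on_compactlySupported fun g => ?_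
      have hi : ∀ i, Integrable g (μ i) := fun i =>
        g.continuous.integrable_of_hasCompactSupport g.hasCompactSupport
      rw [integral_finsetSum_measure fun i _ => (hi i).smul_measure_nnreal,
        integral_finsetSum_measure fun i _ => (hi i).smul_measure_nnreal, ← sub_eq_zero,
        ← Finset.sum_sub_distrib, ← hr g]
      refine Finset.sum_congr rfl fun i _ => ?_
      rw [integral_smul_nnreal_measure, integral_smul_nnreal_measure, NNReal.smul_def,
        NNReal.smul_def, Real.coe_toNNReal', Real.coe_toNNReal', smul_eq_mul, smul_eq_mul,
        ← sub_mul]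
      congr 1
      rcases le_total 0 (r i) with h0 | h0
      · rw [max_eq_left h0, max_eq_right (by linarith)]; ring
      · rw [max_eq_right h0, max_eq_left (by linarith)]; ring
    have hfin : ∀ (p : NNReal) i, p • μ i B ≠ ⊤ := fun p i =>
      ENNReal.mul_ne_top ENNReal.coe_ne_top (measure_ne_top _ _)
    have hPB : P.real B = Q.real B := by rw [hPQ]
    simp only [P, Q, measureReal_def, Measure.finsetSum_apply, Measure.smul_apply] at hPB
    rw [ENNReal.toReal_sum (fun i _ => hfin _ i), ENNReal.toReal_sum (fun i _ => hfin _ i),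
      ← sub_eq_zero, ← Finset.sum_sub_distrib] at hPB
    rw [← hPB]
    refine Finset.sum_congr rfl fun i _ => ?_
    rw [ENNReal.smul_def, ENNReal.smul_def, smul_eq_mul, smul_eq_mul, ENNReal.toReal_mul,
      ENNReal.toReal_mul, ENNReal.coe_toReal, ENNReal.coe_toReal, Real.coe_toNNReal',
      Real.coe_toNNReal', ← sub_mul, measureReal_def]
    congr 1
    rcases le_total 0 (r i) with h0 | h0
    · rw [max_eq_left h0, max_eq_right (by linarith)]; ring
    · rw [max_eq_right h0, max_eq_left (by linarith)]; ring
  apply Complex.ext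
  · have := real (fun i => (a i).re) fun g => by simpa using congrArg Complex.re (h g)
    simpa using this
  · have := real (fun i => (a i).im) fun g => by simpa using congrArg Complex.im (h g)
    simpa using this

/-! ### Cauchy transforms on the slit plane -/

theorem isOpen_slit (α : ℝ) : IsOpen (slit α) :=
  (isOpen_ne_fun Complex.continuous_im continuous_const).union
    (isOpen_lt Complex.continuous_re continuous_const)

theorem sub_ne_zero_of_mem_slit {α : ℝ} {z : ℂ} (hz : z ∈ slit α) {t : ℝ} (ht : α ≤ t) :
    (t : ℂ) - z ≠ 0 := by
  intro h
  rw [← sub_eq_zero.mp h] at hz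
  rcases hz with h | h
  · exact h (Complex.ofReal_im t)
  · rw [Complex.ofReal_re] at h
    linarith

theorem isPreconnected_slit (α : ℝ) : IsPreconnected (slit α) := by
  have h1 : IsPreconnected Complex.slitPlane :=
    (Complex.starConvex_one_slitPlane.isPathConnected
      Complex.one_mem_slitPlane).isConnected.isPreconnected
  have h2 : slit α = (fun z : ℂ => (α : ℂ) - z) '' Complex.slitPlane := by
    ext z
    simp only [Set.mem_image, Complex.mem_slitPlane_iff, slit, Set.mem_ofPred_eq]
    constructor
    · intro h
      refine ⟨α - z, ?_, by ring⟩
      rcases h with h | h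
      · right; simpa using h
      · left; simpa using h
    · rintro ⟨w, hw, rfl⟩
      rcases hw with h | h
      · right; simpa using h
      · left; simpa using h
  rw [h2]
  exact h1.image _ (by fun_prop)

/-- Points of the slit plane keep a positive distance from the cut, locally uniformly. -/
theorem exists_ball_dist_le {α : ℝ} {z : ℂ} (hz : z ∈ slit α) :
    ∃ r > 0, Metric.ball z r ⊆ slit α ∧
      ∀ w ∈ Metric.ball z r, ∀ t : ℝ, α ≤ t → r ≤ ‖(t : ℂ) - w‖ := by
  obtain ⟨r, hr, hb⟩ := Metric.isOpen_iff.mp (isOpen_slit α) z hz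
  refine ⟨r / 2, by positivity, (Metric.ball_subset_ball (by linarith)).trans hb,
    fun w hw t ht => ?_⟩
  by_contra hlt
  push Not at hlt
  have : (t : ℂ) ∈ Metric.ball z r := by
    rw [Metric.mem_ball] at hw ⊢
    rw [← dist_eq_norm] at hlt
    linarith [dist_triangle (t : ℂ) w z]
  exact sub_ne_zero_of_mem_slit (hb this) ht (sub_self _)

variable {α : ℝ}

theorem continuous_inv_sub {z : ℂ} (hz : z ∈ slit α) :
    Continuous fun t : Set.Ici α => (((t : ℝ) : ℂ) - z)⁻¹ :=
  Continuous.inv₀ (by fun_prop) fun t => sub_ne_zero_of_mem_slit hz t.2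

theorem exists_norm_inv_sub_le {z : ℂ} (hz : z ∈ slit α) :
    ∃ b : ℝ, 0 ≤ b ∧ ∀ t : Set.Ici α, ‖(((t : ℝ) : ℂ) - z)⁻¹‖ ≤ b := by
  obtain ⟨r, hr, -, h⟩ := exists_ball_dist_le hz
  refine ⟨r⁻¹, by positivity, fun t => ?_⟩
  rw [norm_inv]
  have := h z (Metric.mem_ball_self hr) t t.2
  gcongr

theorem integrable_inv_sub (ν : Measure (Set.Ici α)) [IsFiniteMeasure ν] {z : ℂ}
    (hz : z ∈ slit α) : Integrable (fun t : Set.Ici α => (((t : ℝ) : ℂ) - z)⁻¹) ν := by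
  obtain ⟨b, -, hb⟩ := exists_norm_inv_sub_le hz
  exact Integrable.of_bound (continuous_inv_sub hz).aestronglyMeasurable b (Eventually.of_forall hb)

theorem differentiableOn_cauchyTransform (ν : Measure (Set.Ici α)) [IsFiniteMeasure ν] :
    DifferentiableOn ℂ (fun z => ∫ t : Set.Ici α, (((t : ℝ) : ℂ) - z)⁻¹ ∂ν) (slit α) := by
  intro z hz
  obtain ⟨r, hr, hsub, h⟩ := exists_ball_dist_le hz
  have := hasDerivAt_integral_of_dominated_loc_of_deriv_le (μ := ν) (𝕜 := ℂ)
    (F := fun w (t : Set.Ici α) => (((t : ℝ) : ℂ) - w)⁻¹)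
    (F' := fun w (t : Set.Ici α) => ((((t : ℝ) : ℂ) - w) ^ 2)⁻¹)
    (bound := fun _ => (r ^ 2)⁻¹) (Metric.ball_mem_nhds z hr)
    (by
      filter_upwards [Metric.ball_mem_nhds z hr] with w hw
      exact (continuous_inv_sub (hsub hw)).aestronglyMeasurable)
    (integrable_inv_sub ν hz)
    (by
      refine Continuous.aestronglyMeasurable (Continuous.inv₀ (by fun_prop) fun t => ?_)
      exact pow_ne_zero _ (sub_ne_zero_of_mem_slit hz t.2))
    (by
      refine Eventually.of_forall fun t w hw => ?_
      have := h w hw t t.2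
      rw [norm_inv, norm_pow]
      gcongr)
    (integrable_const _)
    (by
      refine Eventually.of_forall fun t w hw => ?_
      have h1 := ((hasDerivAt_id w).const_sub ((t : ℝ) : ℂ)).inv
        (sub_ne_zero_of_mem_slit (hsub hw) t.2)
      have e : ((((t : ℝ) : ℂ) - w) ^ 2)⁻¹ = - -1 / (((t : ℝ) : ℂ) - id w) ^ 2 := by
        simp [div_eq_mul_inv]
      rw [e]
      exact h1)
  exact this.2.differentiableAt.differentiableWithinAt

/-- The restriction to `[α, ∞)` of the representing measure. -/
noncomputable def IsHerglotz.measureIci {c : ℝ} {f : ℂ → ℂ} (h : IsHerglotz c f) (α : ℝ) :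
    Measure (Set.Ici α) :=
  h.measure.comap Subtype.val

theorem IsHerglotz.measureIci_real {c : ℝ} {f : ℂ → ℂ} (h : IsHerglotz c f)
    (B : Set (Set.Ici α)) :
    (h.measureIci α).real B = h.measure.real (Subtype.val '' B) := by
  rw [measureReal_def, measureReal_def, IsHerglotz.measureIci,
    comap_subtype_coe_apply measurableSet_Ici]

instance {c : ℝ} {f : ℂ → ℂ} (h : IsHerglotz c f) : IsFiniteMeasure (h.measureIci α) := by
  refine ⟨?_⟩
  rw [IsHerglotz.measureIci, comap_subtype_coe_apply measurableSet_Ici]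
  exact measure_lt_top _ _

theorem IsHerglotz.measureIci_real_univ_le {c : ℝ} {f : ℂ → ℂ} (h : IsHerglotz c f) :
    (h.measureIci α).real Set.univ ≤ c := by
  rw [h.measureIci_real Set.univ]
  exact (measureReal_mono (Set.subset_univ _)).trans h.measureReal_univ_le

/-- A function on the slit plane which is real to the left of the cut and a Cauchy transform on the
upper half-plane is the Cauchy transform of a measure on the cut. -/
theorem IsHerglotz.integral_measureIci {c : ℝ} {f : ℂ → ℂ} (h : IsHerglotz c f)
    (hd : DifferentiableOn ℂ f (slit α)) (hreal : ∀ x : ℝ, x < α → (f x).im = 0) {z : ℂ}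
    (hz : z ∈ slit α) : ∫ t : Set.Ici α, (((t : ℝ) : ℂ) - z)⁻¹ ∂(h.measureIci α) = f z := by
  have hup : ∀ z : ℂ, 0 < z.im →
      ∫ t : Set.Ici α, (((t : ℝ) : ℂ) - z)⁻¹ ∂(h.measureIci α) = f z := by
    intro z hz
    rw [← h.integral_inv_sub hz, IsHerglotz.measureIci,
      integral_subtype_comap measurableSet_Ici fun t : ℝ => ((t : ℂ) - z)⁻¹]
    congr 1
    refine Measure.restrict_eq_self_of_ae_mem ?_
    have h0 := h.measure_Iio_eq_zero hd.continuousOn hreal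
    rw [ae_iff]
    refine measure_mono_null (fun t ht => ?_) h0
    exact not_le.mp (show ¬ α ≤ t from ht)
  have hΦ := (differentiableOn_cauchyTransform (h.measureIci α)).analyticOnNhd (isOpen_slit α)
  have hf := hd.analyticOnNhd (isOpen_slit α)
  have hI : Complex.I ∈ slit α := Or.inl (by simp)
  refine hΦ.eqOn_of_preconnected_of_eventuallyEq hf (isPreconnected_slit α) hI ?_ hz
  filter_upwards [(isOpen_lt continuous_const Complex.continuous_im).mem_nhds
    (show (0 : ℝ) < Complex.I.im by simp)] with w hw using hup w hw

/-! ### Sesquilinear forms and integration against matrix measures -/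

variable {q : ℕ}

/-- The sesquilinear form `uᴴ A v` of a square matrix, conjugate linear in `u`. -/
noncomputable def sform (A : Matrix (Fin q) (Fin q) ℂ) (u v : Fin q → ℂ) : ℂ :=
  star u ⬝ᵥ A.mulVec v

section SesquilinearForm

variable (A B : Matrix (Fin q) (Fin q) ℂ) (u v w : Fin q → ℂ) (a : ℂ)

theorem sform_add_left : sform A (u + v) w = sform A u w + sform A v w := by
  simp [sform, add_dotProduct]

theorem sform_add_right : sform A u (v + w) = sform A u v + sform A u w := by
  simp [sform, Matrix.mulVec_add]

theorem sform_smul_left : sform A (a • u) w = star a * sform A u w := by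
  simp [sform, star_smul]

theorem sform_smul_right : sform A u (a • w) = a * sform A u w := by
  simp [sform, Matrix.mulVec_smul]

theorem sform_add : sform (A + B) u v = sform A u v + sform B u v := by
  simp [sform, Matrix.add_mulVec]

theorem sform_sub : sform (A - B) u v = sform A u v - sform B u v := by
  simp [sform, Matrix.sub_mulVec]

theorem sform_smul : sform (a • A) u v = a * sform A u v := by
  simp [sform, Matrix.smul_mulVec]

theorem sform_sum {ι : Type*} (s : Finset ι) (A : ι → Matrix (Fin q) (Fin q) ℂ) :
    sform (∑ i ∈ s, A i) u v = ∑ i ∈ s, sform (A i) u v := by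
  induction s using Finset.cons_induction with
  | empty => simp [sform]
  | cons i s hi ih => rw [Finset.sum_cons, Finset.sum_cons, sform_add, ih]

theorem sform_conjTranspose : sform A.conjTranspose u v = star (sform A v u) := by
  rw [sform, sform, ← Matrix.star_dotProduct_star, star_star, Matrix.star_mulVec, dotProduct_comm,
    ← Matrix.dotProduct_mulVec, dotProduct_comm]

theorem sform_eq_sum : sform A u v = ∑ j, ∑ k, star (u j) * v k * A j k := by
  simp only [sform, dotProduct, Matrix.mulVec, Pi.star_apply, Finset.mul_sum]
  exact Finset.sum_congr rfl fun j _ => Finset.sum_congr rfl fun k _ => by ring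

theorem sform_single (j k : Fin q) : sform A (Pi.single j 1) (Pi.single k 1) = A j k := by
  simp [sform, Pi.star_single]

theorem sform_mul : sform (A * B) u v = sform A u (B.mulVec v) := by
  rw [sform, sform, Matrix.mulVec_mulVec]

theorem sform_conjTranspose_mul :
    sform (A.conjTranspose * B) u v = star (A.mulVec u) ⬝ᵥ B.mulVec v := by
  rw [sform, ← Matrix.mulVec_mulVec, Matrix.dotProduct_mulVec, Matrix.star_mulVec]

/-- The polarization identity. -/
theorem sform_polarization :
    sform A u v = (1 / 4) * ∑ m : Fin 4, (-Complex.I) ^ (m : ℕ) *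
      sform A (u + Complex.I ^ (m : ℕ) • v) (u + Complex.I ^ (m : ℕ) • v) := by
  have h3 : Complex.I ^ 3 = -Complex.I := Complex.I_pow_three
  have h3' : (-Complex.I) ^ 3 = Complex.I := by rw [Odd.neg_pow (by decide), h3, neg_neg]
  have h2 : Complex.I * Complex.I = -1 := Complex.I_mul_I
  simp only [sform_add_left, sform_add_right, sform_smul_left, sform_smul_right,
    Fin.sum_univ_four, Fin.val_zero, Fin.val_one, Fin.val_two,
    show ((3 : Fin 4) : ℕ) = 3 from rfl, pow_zero, pow_one, h3, h3', neg_sq, Complex.I_sq,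
    Complex.star_def, Complex.conj_I, map_neg, map_one]
  linear_combination (1 / 2 * sform A u v - 1 / 2 * sform A v u) * h2

theorem entry_polarization (j k : Fin q) :
    A j k = (1 / 4) * ∑ m : Fin 4, (-Complex.I) ^ (m : ℕ) *
      sform A (Pi.single j 1 + Complex.I ^ (m : ℕ) • Pi.single k 1)
        (Pi.single j 1 + Complex.I ^ (m : ℕ) • Pi.single k 1) := by
  rw [← sform_polarization, sform_single]

variable {A B}

theorem eq_of_sform_self (h : ∀ v, sform A v v = sform B v v) : A = B := by
  ext j k
  rw [entry_polarization A, entry_polarization B]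
  simp only [h]

theorem isHermitian_of_im_eq_zero (h : ∀ v, (sform A v v).im = 0) : A.IsHermitian :=
  eq_of_sform_self fun v => by
    rw [sform_conjTranspose, Complex.star_def]
    exact Complex.conj_eq_iff_im.mpr (h v)

theorem posSemidef_of_sform_nonneg (h : ∀ v, 0 ≤ sform A v v) : A.PosSemidef :=
  Matrix.PosSemidef.of_dotProduct_mulVec_nonneg
    (isHermitian_of_im_eq_zero fun v => (Complex.le_def.mp (h v)).2.symm) h

theorem sform_self_nonneg (hA : A.PosSemidef) : 0 ≤ sform A v v := hA.dotProduct_mulVec_nonneg v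

theorem sform_self_re_nonneg (hA : A.PosSemidef) : 0 ≤ (sform A v v).re :=
  (Complex.le_def.mp (sform_self_nonneg v hA)).1

theorem sform_self_im_eq_zero (hA : A.IsHermitian) : (sform A v v).im = 0 := by
  have := sform_conjTranspose A v v
  rw [hA.eq, Complex.star_def] at this
  exact Complex.conj_eq_iff_im.mp this.symm

theorem sform_self_eq_re (hA : A.PosSemidef) : sform A v v = ((sform A v v).re : ℂ) :=
  Complex.ext rfl (sform_self_im_eq_zero v hA.isHermitian)

theorem sform_self_comb_re (hA : A.IsHermitian) (b : ℂ) :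
    (sform A (a • u + b • v) (a • u + b • v)).re
      = ‖a‖ ^ 2 * (sform A u u).re + 2 * (star a * (b * sform A u v)).re
        + ‖b‖ ^ 2 * (sform A v v).re := by
  have e : sform A v u = star (sform A u v) := by rw [← sform_conjTranspose, hA.eq]
  have hu := sform_self_im_eq_zero u hA
  have hv := sform_self_im_eq_zero v hA
  simp only [sform_add_left, sform_add_right, sform_smul_left, sform_smul_right, e]
  simp only [Complex.star_def, Complex.add_re, Complex.add_im, Complex.mul_re, Complex.mul_im, Complex.conj_re,
    Complex.conj_im, hu, hv, ← Complex.normSq_eq_norm_sq, Complex.normSq_apply]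
  ring

end SesquilinearForm

/-- Cauchy's inequality from the positivity of the associated quadratic polynomial. -/
theorem norm_sq_le_mul_of_forall_nonneg {a b : ℝ} {w : ℂ}
    (h : ∀ l : ℂ, 0 ≤ ‖l‖ ^ 2 * a + 2 * (star l * w).re + b) : ‖w‖ ^ 2 ≤ a * b := by
  have hd : discrim (‖w‖ ^ 2 * a) (2 * ‖w‖ ^ 2) b ≤ 0 := discrim_le_zero fun t => by
    have := h ((t : ℂ) * w)
    have e : (star ((t : ℂ) * w) * w).re = t * ‖w‖ ^ 2 := by
      rw [Complex.star_def, map_mul, Complex.conj_ofReal, mul_assoc, Complex.re_ofReal_mul,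
        mul_comm ((starRingEnd ℂ) w), Complex.mul_conj, Complex.ofReal_re,
        Complex.normSq_eq_norm_sq]
    rw [e, norm_mul, Complex.norm_real, mul_pow, Real.norm_eq_abs, sq_abs] at this
    linarith
  rw [discrim] at hd
  rcases (sq_nonneg ‖w‖).eq_or_lt' with h0 | h0
  · have h1 := h 0
    have h2 := h 1
    have h3 := h (-1)
    have hw : w = 0 := by simpa using h0
    subst hw
    by_contra hlt
    simp at h1 hlt h2
    -- `a` cannot be negative: otherwise large multipliers violate the hypothesis.
    have ha : a < 0 := by
      by_contra ha
      exact absurd (mul_nonneg (not_lt.mp ha) h1) (not_le.mpr hlt)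
    have h4 := h ((((b + 1) / (-a) + 1 : ℝ)) : ℂ)
    have hx : 0 < -a := by linarith
    simp only [mul_zero, Complex.zero_re, add_zero, Complex.norm_real, Real.norm_eq_abs,
      sq_abs] at h4
    have h5 : 0 < (b + 1) / (-a) := by positivity
    have h6 : (b + 1) / (-a) * (-a) = b + 1 := div_mul_cancel₀ _ hx.ne'
    nlinarith
  · have : ‖w‖ ^ 2 * (4 * (‖w‖ ^ 2 - a * b)) ≤ 0 := by linarith
    have := nonpos_of_mul_nonpos_right this h0
    linarith

theorem norm_sform_sq_le {A : Matrix (Fin q) (Fin q) ℂ} (hA : A.PosSemidef) (u v : Fin q → ℂ) :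
    ‖sform A u v‖ ^ 2 ≤ (sform A u u).re * (sform A v v).re :=
  norm_sq_le_mul_of_forall_nonneg fun l => by
    have h := sform_self_comb_re (A := A) u v l hA.isHermitian 1
    have h' := sform_self_re_nonneg (l • u + (1 : ℂ) • v) hA
    rw [h] at h'
    simpa using h'

theorem norm_entry_le {A : Matrix (Fin q) (Fin q) ℂ} (hA : A.PosSemidef) (j k : Fin q) :
    ‖A j k‖ ≤ (A j j).re + (A k k).re := by
  have h := norm_sform_sq_le hA (Pi.single j 1) (Pi.single k 1)
  have hj := sform_self_re_nonneg (Pi.single j 1) hA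
  have hk := sform_self_re_nonneg (Pi.single k 1) hA
  rw [sform_single] at hj hk
  rw [sform_single, sform_single, sform_single] at h
  nlinarith [norm_nonneg (A j k)]

section MatrixMeasure

variable {σ : VectorMeasure (Set.Ici α) (Matrix (Fin q) (Fin q) ℂ)}

/-- The real part of `vᴴ A v`, as an additive function of `A`. -/
noncomputable def quadHom (v : Fin q → ℂ) : Matrix (Fin q) (Fin q) ℂ →+ ℝ where
  toFun A := (sform A v v).re
  map_zero' := by simp [sform]
  map_add' A B := by rw [sform_add, Complex.add_re]

theorem continuous_quadHom (v : Fin q → ℂ) : Continuous (quadHom v) := by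
  change Continuous fun A : Matrix (Fin q) (Fin q) ℂ => (sform A v v).re
  simp only [sform_eq_sum]
  refine Complex.continuous_re.comp ?_
  refine continuous_finsetSum _ fun j _ => continuous_finsetSum _ fun k _ => ?_
  exact continuous_const.mul (continuous_id.matrix_elem j k)

/-- The positive measure `B ↦ vᴴ σ(B) v`. -/
noncomputable def quadMeasure (hσ : IsNonnegHermitianMeasure σ) (v : Fin q → ℂ) :
    Measure (Set.Ici α) :=
  SignedMeasure.toMeasureOfZeroLE (σ.mapRange (quadHom v) (continuous_quadHom v)) Set.univ
    MeasurableSet.univ (by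
      rw [VectorMeasure.le_restrict_univ_iff_le, VectorMeasure.le_iff]
      intro B hB
      exact sform_self_re_nonneg v (hσ B hB))

instance (hσ : IsNonnegHermitianMeasure σ) (v : Fin q → ℂ) : IsFiniteMeasure (quadMeasure hσ v) := by
  unfold quadMeasure; infer_instance

theorem quadMeasure_real (hσ : IsNonnegHermitianMeasure σ) (v : Fin q → ℂ) {B : Set (Set.Ici α)}
    (hB : MeasurableSet B) : (quadMeasure hσ v).real B = (sform (σ B) v v).re := by
  rw [quadMeasure, SignedMeasure.toMeasureOfZeroLE_real_apply _ _ _ hB, Set.univ_inter]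
  rfl

theorem sform_eq_quadMeasure (hσ : IsNonnegHermitianMeasure σ) (v : Fin q → ℂ)
    {B : Set (Set.Ici α)} (hB : MeasurableSet B) :
    sform (σ B) v v = ((quadMeasure hσ v).real B : ℂ) := by
  rw [quadMeasure_real hσ v hB, ← sform_self_eq_re v (hσ B hB)]

theorem entryMeasure_apply (j k : Fin q) (B : Set (Set.Ici α)) :
    entryMeasure σ j k B = σ B j k := rfl

theorem isFiniteMeasure_variation (hσ : IsNonnegHermitianMeasure σ) (j k : Fin q) :
    IsFiniteMeasure (entryMeasure σ j k).variation := by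
  refine isFiniteMeasure_of_le
    (quadMeasure hσ (Pi.single j 1) + quadMeasure hσ (Pi.single k 1)) ?_
  refine VectorMeasure.variation_le_of_forall_enorm_le fun B hB => ?_
  have h := norm_entry_le (hσ B hB) j k
  rw [entryMeasure_apply, ← ofReal_norm]
  refine (ENNReal.ofReal_le_ofReal h).trans ?_
  rw [← sform_single (σ B) j j, ← sform_single (σ B) k k, ← quadMeasure_real hσ _ hB,
    ← quadMeasure_real hσ _ hB, ENNReal.ofReal_add measureReal_nonneg measureReal_nonneg,
    ofReal_measureReal, ofReal_measureReal]
  exact le_rfl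

/-- The entrywise integral of a scalar function against a matrix measure. -/
noncomputable def matInt (σ : VectorMeasure (Set.Ici α) (Matrix (Fin q) (Fin q) ℂ))
    (f : Set.Ici α → ℂ) : Matrix (Fin q) (Fin q) ℂ :=
  Matrix.of fun j k => VectorMeasure.integral (entryMeasure σ j k) f (ContinuousLinearMap.mul ℝ ℂ)

theorem stieltjesTransform_eq_matInt (z : ℂ) :
    stieltjesTransform σ z = matInt σ fun t => (((t : ℝ) : ℂ) - z)⁻¹ := rfl

theorem matInt_simpleFunc (hσ : IsNonnegHermitianMeasure σ) (s : SimpleFunc (Set.Ici α) ℂ) :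
    matInt σ s = ∑ c ∈ s.range, c • σ (s ⁻¹' {c}) := by
  ext j k
  have := isFiniteMeasure_variation hσ j k
  rw [matInt, Matrix.of_apply, VectorMeasure.integral_eq_setToFun,
    setToFun_simpleFunc _ _ (SimpleFunc.integrable_of_isFiniteMeasure s), Matrix.sum_apply]
  rfl

theorem tendsto_matInt (hσ : IsNonnegHermitianMeasure σ) {f : Set.Ici α → ℂ}
    (hf : StronglyMeasurable f) {b : ℝ} (hb0 : 0 ≤ b) (hb : ∀ t, ‖f t‖ ≤ b) :
    Tendsto (fun n => matInt σ (hf.approxBounded b n)) atTop (𝓝 (matInt σ f)) := by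
  refine tendsto_pi_nhds.mpr fun j => tendsto_pi_nhds.mpr fun k => ?_
  have := isFiniteMeasure_variation hσ j k
  exact VectorMeasure.tendsto_integral_filter_of_norm_le_const
    (Eventually.of_forall fun n => (hf.approxBounded b n).stronglyMeasurable.aestronglyMeasurable)
    ⟨b, Eventually.of_forall fun n => Eventually.of_forall (hf.norm_approxBounded_le hb0 n)⟩
    (Eventually.of_forall fun t => hf.tendsto_approxBounded_of_norm_le (hb t))

theorem continuous_sform (u v : Fin q → ℂ) :
    Continuous fun A : Matrix (Fin q) (Fin q) ℂ => sform A u v := by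
  simp only [sform_eq_sum]
  refine continuous_finsetSum _ fun j _ => continuous_finsetSum _ fun k _ => ?_
  exact continuous_const.mul (continuous_id.matrix_elem j k)

theorem simpleFunc_integral_eq_sum {E : Type*} [NormedAddCommGroup E] [NormedSpace ℝ E]
    [CompleteSpace E] (μ : Measure (Set.Ici α)) [IsFiniteMeasure μ]
    (s : SimpleFunc (Set.Ici α) ℂ) (g : ℂ → E) (hg : g 0 = 0) :
    ∫ t, g (s t) ∂μ = ∑ c ∈ s.range, μ.real (s ⁻¹' {c}) • g c := by
  rw [← SimpleFunc.map_integral s g (SimpleFunc.integrable_of_isFiniteMeasure s) hg,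
    SimpleFunc.integral_eq_integral _ (SimpleFunc.integrable_of_isFiniteMeasure _)]
  rfl

/-- Integration commutes with taking quadratic forms. -/
theorem sform_matInt (hσ : IsNonnegHermitianMeasure σ) (v : Fin q → ℂ) {f : Set.Ici α → ℂ}
    (hf : StronglyMeasurable f) {b : ℝ} (hb0 : 0 ≤ b) (hb : ∀ t, ‖f t‖ ≤ b) :
    sform (matInt σ f) v v = ∫ t, f t ∂(quadMeasure hσ v) := by
  have h1 := ((continuous_sform v v).tendsto _).comp (tendsto_matInt hσ hf hb0 hb)
  have h2 : Tendsto (fun n => ∫ t, hf.approxBounded b n t ∂(quadMeasure hσ v)) atTop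
      (𝓝 (∫ t, f t ∂(quadMeasure hσ v))) :=
    tendsto_integral_of_dominated_convergence (fun _ => b)
      (fun n => (hf.approxBounded b n).stronglyMeasurable.aestronglyMeasurable)
      (integrable_const b)
      (fun n => Eventually.of_forall (hf.norm_approxBounded_le hb0 n))
      (Eventually.of_forall fun t => hf.tendsto_approxBounded_of_norm_le (hb t))
  refine tendsto_nhds_unique h1 (h2.congr fun n => ?_)
  set s := hf.approxBounded b n
  rw [show ∫ t, s t ∂(quadMeasure hσ v) = _ from simpleFunc_integral_eq_sum _ s id rfl,
    Function.comp, matInt_simpleFunc hσ, sform_sum]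
  refine Finset.sum_congr rfl fun c _ => ?_
  rw [sform_smul, sform_eq_quadMeasure hσ v (s.measurableSet_fiber c), Complex.real_smul, mul_comm]
  rfl

theorem norm_sform_matInt_simpleFunc_sq_le (hσ : IsNonnegHermitianMeasure σ) (u v : Fin q → ℂ)
    (s : SimpleFunc (Set.Ici α) ℂ) :
    ‖sform (matInt σ s) u v‖ ^ 2
      ≤ (sform (σ Set.univ) u u).re * ∫ t, ‖s t‖ ^ 2 ∂(quadMeasure hσ v) := by
  refine norm_sq_le_mul_of_forall_nonneg fun l => ?_
  have hu : (sform (σ Set.univ) u u).re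
      = ∑ c ∈ s.range, (sform (σ (s ⁻¹' {c})) u u).re := by
    rw [← quadMeasure_real hσ u MeasurableSet.univ, measureReal_def,
      ← s.sum_range_measure_preimage_singleton, ENNReal.toReal_sum fun c _ => measure_ne_top _ _]
    exact Finset.sum_congr rfl fun c _ => quadMeasure_real hσ u (s.measurableSet_fiber c)
  have hv : ∫ t, ‖s t‖ ^ 2 ∂(quadMeasure hσ v)
      = ∑ c ∈ s.range, ‖c‖ ^ 2 * (sform (σ (s ⁻¹' {c})) v v).re := by
    rw [simpleFunc_integral_eq_sum _ s (fun c => ‖c‖ ^ 2) (by simp)]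
    refine Finset.sum_congr rfl fun c _ => ?_
    rw [quadMeasure_real hσ v (s.measurableSet_fiber c), smul_eq_mul, mul_comm]
  have huv : (star l * sform (matInt σ s) u v).re
      = ∑ c ∈ s.range, (star l * (c * sform (σ (s ⁻¹' {c})) u v)).re := by
    rw [matInt_simpleFunc hσ, sform_sum, Finset.mul_sum, Complex.re_sum]
    exact Finset.sum_congr rfl fun c _ => by rw [sform_smul]
  rw [hu, hv, huv, Finset.mul_sum, Finset.mul_sum, ← Finset.sum_add_distrib,
    ← Finset.sum_add_distrib]
  refine Finset.sum_nonneg fun c _ => ?_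
  have hc := hσ _ (s.measurableSet_fiber c)
  rw [← sform_self_comb_re u v l hc.isHermitian c]
  exact sform_self_re_nonneg _ hc

/-- The Cauchy-Schwarz inequality for matrix measures:
`|∫ f d(uᴴσv)|² ≤ uᴴ σ([α, ∞)) u · ∫ |f|² d(vᴴσv)`. -/
theorem norm_sform_matInt_sq_le (hσ : IsNonnegHermitianMeasure σ) (u v : Fin q → ℂ)
    {f : Set.Ici α → ℂ} (hf : StronglyMeasurable f) {b : ℝ} (hb0 : 0 ≤ b) (hb : ∀ t, ‖f t‖ ≤ b) :
    ‖sform (matInt σ f) u v‖ ^ 2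
      ≤ (sform (σ Set.univ) u u).re * ∫ t, ‖f t‖ ^ 2 ∂(quadMeasure hσ v) := by
  have h1 := ((continuous_sform u v).tendsto _).comp (tendsto_matInt hσ hf hb0 hb)
  have h2 : Tendsto (fun n => ∫ t, ‖hf.approxBounded b n t‖ ^ 2 ∂(quadMeasure hσ v)) atTop
      (𝓝 (∫ t, ‖f t‖ ^ 2 ∂(quadMeasure hσ v))) :=
    tendsto_integral_of_dominated_convergence (fun _ => b ^ 2)
      (fun n => ((hf.approxBounded b n).stronglyMeasurable.norm.pow 2).aestronglyMeasurable)
      (integrable_const _)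
      (fun n => Eventually.of_forall fun t => by
        rw [norm_pow, norm_norm]
        have := hf.norm_approxBounded_le hb0 n t
        gcongr)
      (Eventually.of_forall fun t => (hf.tendsto_approxBounded_of_norm_le (hb t)).norm.pow 2)
  exact le_of_tendsto_of_tendsto' (h1.norm.pow 2) (h2.const_mul _) fun n =>
    norm_sform_matInt_simpleFunc_sq_le hσ u v _

end MatrixMeasure

/-! ### Removable singularities and matrix Stieltjes functions -/

theorem IsDiscreteSet.eventually_notMem {D : Set ℂ} (hD : IsDiscreteSet D) (z : ℂ) :
    ∀ᶠ w in 𝓝[≠] z, w ∉ D := by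
  have hfin := (hD (Metric.ball z 1) Metric.isBounded_ball).subset
    (Set.sdiff_subset (t := ({z} : Set ℂ)))
  have h1 : ((D ∩ Metric.ball z 1) \ {z})ᶜ ∈ 𝓝 z :=
    hfin.isClosed.isOpen_compl.mem_nhds fun h => h.2 rfl
  filter_upwards [nhdsWithin_le_nhds h1, nhdsWithin_le_nhds (Metric.ball_mem_nhds z one_pos),
    self_mem_nhdsWithin] with w hw hwb hwz hwD
  exact hw ⟨⟨hwD, hwb⟩, hwz⟩

theorem IsDiscreteSet.isClosed {D : Set ℂ} (hD : IsDiscreteSet D) : IsClosed D := by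
  rw [← isOpen_compl_iff, isOpen_iff_mem_nhds]
  intro z hz
  have h := hD.eventually_notMem z
  rw [eventually_nhdsWithin_iff] at h
  filter_upwards [h] with w hw
  rcases eq_or_ne w z with rfl | hne
  · exact hz
  · exact hw hne

/-- Riemann's theorem on removable singularities for a discrete exceptional set. -/
theorem exists_differentiableOn_extension {g : ℂ → ℂ} {U D : Set ℂ} (hU : IsOpen U)
    (hD : IsDiscreteSet D) (hg : DifferentiableOn ℂ g (U \ D))
    (hb : ∀ z ∈ U, ∃ C : ℝ, ∀ᶠ w in 𝓝 z, w ∉ D → ‖g w‖ ≤ C) :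
    ∃ G : ℂ → ℂ, DifferentiableOn ℂ G U ∧ ∀ z, z ∉ D → G z = g z := by
  classical
  refine ⟨fun z => if z ∈ D then limUnder (𝓝[≠] z) g else g z, fun z hz => ?_,
    fun z hz => if_neg hz⟩
  refine DifferentiableAt.differentiableWithinAt ?_
  by_cases hzD : z ∈ D
  · obtain ⟨C, hC⟩ := hb z hz
    have hev := hD.eventually_notMem z
    rw [eventually_nhdsWithin_iff] at hev
    obtain ⟨r, hr, hball⟩ := Metric.eventually_nhds_iff_ball.mp
      ((hC.and hev).and (hU.mem_nhds hz))
    have hnot : ∀ w ∈ Metric.ball z r \ {z}, w ∉ D := fun w hw => (hball w hw.1).1.2 hw.2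
    have hup := Complex.differentiableOn_update_limUnder_of_bddAbove (f := g)
      (Metric.ball_mem_nhds z hr)
      (hg.mono fun w hw => ⟨(hball w hw.1).2, hnot w hw⟩)
      (by
        refine ⟨C, ?_⟩
        rintro _ ⟨w, hw, rfl⟩
        exact (hball w hw.1).1.1 (hnot w hw))
    refine (hup.differentiableAt (Metric.ball_mem_nhds z hr)).congr_of_eventuallyEq ?_
    filter_upwards [Metric.ball_mem_nhds z hr] with w hw
    rcases eq_or_ne w z with rfl | hne
    · simp [hzD]
    · simp [hnot w ⟨hw, hne⟩, hne]
  · have hopen : IsOpen (U \ D) := hU.sdiff hD.isClosed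
    have hmem : U \ D ∈ 𝓝 z := hopen.mem_nhds ⟨hz, hzD⟩
    refine (hg.differentiableAt hmem).congr_of_eventuallyEq ?_
    filter_upwards [hmem] with w hw
    exact if_neg hw.2

section Polarization

/-- The vectors of the polarization identity expressing the value of a quadratic form at `v` by its
values at the vectors `e_j + i^m e_k`. -/
noncomputable def polarVec (v : Fin q → ℂ) : Option (Fin q × Fin q × Fin 4) → Fin q → ℂ
  | none => v
  | some (j, k, m) => Pi.single j 1 + Complex.I ^ (m : ℕ) • Pi.single k 1

/-- The coefficients of the polarization identity for `polarVec`. -/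
noncomputable def polarCoeff (v : Fin q → ℂ) : Option (Fin q × Fin q × Fin 4) → ℂ
  | none => -1
  | some (j, k, m) => star (v j) * v k * (1 / 4 * (-Complex.I) ^ (m : ℕ))

theorem sum_polarCoeff_mul (v : Fin q → ℂ) (Q : (Fin q → ℂ) → ℂ) :
    ∑ i, polarCoeff v i * Q (polarVec v i) = -Q v + ∑ j, ∑ k, star (v j) * v k *
      ((1 / 4) * ∑ m : Fin 4, (-Complex.I) ^ (m : ℕ) *
        Q (Pi.single j 1 + Complex.I ^ (m : ℕ) • Pi.single k 1)) := by
  rw [Fintype.sum_option]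
  simp only [Fintype.sum_prod_type, polarCoeff, polarVec, neg_one_mul]
  congr 1
  refine Finset.sum_congr rfl fun j _ => Finset.sum_congr rfl fun k _ => ?_
  rw [Finset.mul_sum, Finset.mul_sum]
  exact Finset.sum_congr rfl fun m _ => by ring

theorem sum_polarCoeff_mul_sform (N : Matrix (Fin q) (Fin q) ℂ) (v : Fin q → ℂ) :
    ∑ i, polarCoeff v i * sform N (polarVec v i) (polarVec v i) = 0 := by
  rw [sum_polarCoeff_mul v fun w => sform N w w]
  simp only [← entry_polarization]
  rw [← sform_eq_sum]
  ring

end Polarization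

theorem sform_imPart (A : Matrix (Fin q) (Fin q) ℂ) (v : Fin q → ℂ) :
    sform (imPart A) v v = ((sform A v v).im : ℂ) := by
  rw [imPart, sform_smul, sform_sub, sform_conjTranspose, Complex.star_def, Complex.sub_conj]
  push_cast
  field_simp

/-- The matrix measure obtained by polarization from a family of finite measures indexed by vectors.
Its quadratic form at `v` is `μ v` as soon as the values `μ v B` form a quadratic form in `v`. -/
noncomputable def polarMeasure (μ : (Fin q → ℂ) → Measure (Set.Ici α))
    [∀ v, IsFiniteMeasure (μ v)] : VectorMeasure (Set.Ici α) (Matrix (Fin q) (Fin q) ℂ) where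
  measureOf' B := Matrix.of fun j k => (1 / 4) * ∑ m : Fin 4, (-Complex.I) ^ (m : ℕ) *
    (((μ (Pi.single j 1 + Complex.I ^ (m : ℕ) • Pi.single k 1)).toSignedMeasure B : ℝ) : ℂ)
  empty' := by ext; simp
  not_measurable' B hB := by
    ext
    simp [VectorMeasure.not_measurable _ hB]
  m_iUnion' f hf hd := by
    refine Pi.hasSum.mpr fun j => Pi.hasSum.mpr fun k => ?_
    refine HasSum.mul_left _ (hasSum_sum fun m _ => HasSum.mul_left _ ?_)
    exact Complex.hasSum_ofReal.mpr (VectorMeasure.m_iUnion _ hf hd)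

theorem polarMeasure_apply (μ : (Fin q → ℂ) → Measure (Set.Ici α)) [∀ v, IsFiniteMeasure (μ v)]
    {B : Set (Set.Ici α)} (hB : MeasurableSet B) (j k : Fin q) :
    polarMeasure μ B j k = (1 / 4) * ∑ m : Fin 4, (-Complex.I) ^ (m : ℕ) *
      ((μ (Pi.single j 1 + Complex.I ^ (m : ℕ) • Pi.single k 1)).real B : ℂ) := by
  simp only [← Measure.toSignedMeasure_apply_measurable hB]
  rfl

theorem im_eq_zero_of_slit {f : ℂ → ℂ} (hd : DifferentiableOn ℂ f (slit α))
    (him : ∀ z : ℂ, z.im ≠ 0 → 0 ≤ (f z).im / z.im) {x : ℝ} (hx : x < α) : (f x).im = 0 := by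
  have hca : ContinuousAt f (x : ℂ) := (hd.differentiableAt
    ((isOpen_slit α).mem_nhds (Or.inr (by simpa using hx)))).continuousAt
  have hlim : ∀ s : ℝ, Tendsto (fun n : ℕ => (f (x + ((s * (1 / ((n : ℝ) + 1)) : ℝ) : ℂ)
      * Complex.I)).im) atTop (𝓝 (f x).im) := by
    intro s
    have h1 := ((tendsto_one_div_add_atTop_nhds_zero_nat (𝕜 := ℝ)).const_mul s)
    have h2 := (((Complex.continuous_ofReal.tendsto _).comp h1).mul_const Complex.I).const_add
      (x : ℂ)
    simp only [mul_zero, Complex.ofReal_zero, zero_mul, add_zero] at h2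
    exact (Complex.continuous_im.tendsto _).comp (hca.tendsto.comp h2)
  refine le_antisymm (le_of_tendsto' (hlim (-1)) fun n => ?_)
    (ge_of_tendsto' (hlim 1) fun n => ?_)
  · have hn : (0 : ℝ) < 1 / ((n : ℝ) + 1) := by positivity
    set e := (1 : ℝ) / ((n : ℝ) + 1)
    have hi : ((x : ℂ) + ((-1 * e : ℝ) : ℂ) * Complex.I).im = -e := by simp
    have := him (x + ((-1 * e : ℝ) : ℂ) * Complex.I) (by rw [hi]; linarith)
    rw [hi, div_neg, ← neg_div] at this
    have := (div_nonneg_iff.mp this).resolve_right (fun h => by linarith [h.2])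
    linarith [this.1]
  · have hn : (0 : ℝ) < 1 / ((n : ℝ) + 1) := by positivity
    set e := (1 : ℝ) / ((n : ℝ) + 1)
    have hi : ((x : ℂ) + ((1 * e : ℝ) : ℂ) * Complex.I).im = e := by simp
    have := him (x + ((1 * e : ℝ) : ℂ) * Complex.I) (by rw [hi]; linarith)
    rw [hi] at this
    exact ((div_nonneg_iff.mp this).resolve_right (fun h => by linarith [h.2])).1

theorem differentiableOn_sform {F : ℂ → Matrix (Fin q) (Fin q) ℂ} {U : Set ℂ}
    (hF : IsHolomorphicOn F U) (u v : Fin q → ℂ) :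
    DifferentiableOn ℂ (fun z => sform (F z) u v) U := by
  simp only [sform_eq_sum]
  refine DifferentiableOn.fun_sum fun j _ => DifferentiableOn.fun_sum fun k _ => ?_
  exact (hF j k).const_mul _

/-- The integral representation of matrix-valued Stieltjes functions whose quadratic forms decay
like `1 / |Im z|`. -/
theorem exists_isStieltjesMeasureOf {F : ℂ → Matrix (Fin q) (Fin q) ℂ} {c : (Fin q → ℂ) → ℝ}
    (hF : IsHolomorphicOn F (slit α))
    (him : ∀ v, ∀ z : ℂ, z.im ≠ 0 → 0 ≤ (sform (F z) v v).im / z.im)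
    (hb : ∀ v, ∀ z : ℂ, z.im ≠ 0 → ‖sform (F z) v v‖ ≤ c v / |z.im|) :
    ∃ σ : VectorMeasure (Set.Ici α) (Matrix (Fin q) (Fin q) ℂ), IsStieltjesMeasureOf σ F ∧
      ∀ v, (sform (σ Set.univ) v v).re ≤ c v := by
  have hH : ∀ v, IsHerglotz (c v) fun z => sform (F z) v v := fun v =>
    { differentiableOn := (differentiableOn_sform hF v v).mono fun z hz => Or.inl hz.ne'
      im_nonneg := fun z hz =>
        ((div_nonneg_iff.mp (him v z hz.ne')).resolve_right (fun h => by linarith [h.2])).1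
      norm_le := fun z hz => by
        have := hb v z hz.ne'
        rwa [abs_of_pos hz] at this }
  set μ : (Fin q → ℂ) → Measure (Set.Ici α) := fun v => (hH v).measureIci α with hμ
  have hfin : ∀ v, IsFiniteMeasure (μ v) := fun v => by simp only [hμ]; infer_instance
  -- The representing measures depend on the vector as a quadratic form does.
  have hrel : ∀ v (B : Set ℝ), ∑ i, polarCoeff v i * (((hH (polarVec v i)).measure.real B : ℝ) : ℂ)
      = 0 := by
    intro v B
    refine sum_mul_measureReal_eq_zero (polarCoeff v) (fun i => (hH (polarVec v i)).measure)
      (fun g => ?_) B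
    have hlim := tendsto_finsetSum Finset.univ fun i (_ : i ∈ Finset.univ) =>
      ((Complex.continuous_ofReal.tendsto _).comp
        ((hH (polarVec v i)).tendsto_integral g)).const_mul (polarCoeff v i)
    refine tendsto_nhds_unique hlim (tendsto_const_nhds.congr fun n => ?_)
    simp only [Function.comp, ← integral_complex_ofReal]
    have hint : ∀ i, Integrable fun t : ℝ => polarCoeff v i *
        ((g t * density (fun z => sform (F z) (polarVec v i) (polarVec v i)) n t : ℝ) : ℂ) :=
      fun i => (((hH (polarVec v i)).integrable_mul_density g n).ofReal).const_mul _
    simp only [← integral_const_mul]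
    rw [← integral_finsetSum _ fun i _ => hint i]
    symm
    refine (integral_congr_ae (Eventually.of_forall fun t => ?_)).trans (integral_zero' _ _)
    simp only [density, Pi.zero_apply]
    have h0 := sum_polarCoeff_mul_sform
      (imPart (F (t + ((1 / ((n : ℝ) + 1) : ℝ) : ℂ) * Complex.I))) v
    simp only [sform_imPart] at h0
    rw [← mul_zero ((g t : ℂ) / Real.pi), ← h0, Finset.mul_sum]
    refine Finset.sum_congr rfl fun i _ => ?_
    push_cast
    ring
  set σ := polarMeasure μ with hσdef
  have hval : ∀ v {B : Set (Set.Ici α)}, MeasurableSet B →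
      sform (σ B) v v = ((μ v).real B : ℂ) := by
    intro v B hB
    have h1 := hrel v (Subtype.val '' B)
    rw [sum_polarCoeff_mul v fun w => ((((hH w).measure.real (Subtype.val '' B) : ℝ)) : ℂ)] at h1
    simp only [← IsHerglotz.measureIci_real] at h1
    rw [sform_eq_sum]
    simp only [hσdef, polarMeasure_apply μ hB]
    linear_combination h1
  have hσ : IsNonnegHermitianMeasure σ := fun B hB => posSemidef_of_sform_nonneg fun v => by
    rw [hval v hB]
    exact_mod_cast measureReal_nonneg
  have hquad : ∀ v, quadMeasure hσ v = μ v := by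
    intro v
    refine Measure.ext fun B hB => ?_
    have : (quadMeasure hσ v).real B = (μ v).real B := by
      rw [quadMeasure_real hσ v hB, hval v hB, Complex.ofReal_re]
    rwa [measureReal_eq_measureReal_iff] at this
  refine ⟨σ, ⟨hσ, fun z hz => ?_⟩, fun v => ?_⟩
  · refine eq_of_sform_self fun v => ?_
    obtain ⟨b, hb0, hbd⟩ := exists_norm_inv_sub_le hz
    rw [stieltjesTransform_eq_matInt, sform_matInt hσ v
      (continuous_inv_sub hz).stronglyMeasurable hb0 hbd, hquad]
    exact ((hH v).integral_measureIci (differentiableOn_sform hF v v)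
      (fun x hx => im_eq_zero_of_slit (differentiableOn_sform hF v v) (him v) hx) hz).symm
  · rw [hval v MeasurableSet.univ, Complex.ofReal_re]
    exact (hH v).measureIci_real_univ_le

/-! ### Linear algebra of the transformations -/

section LinearAlgebra

theorem star_mulVec_dotProduct (A : Matrix (Fin q) (Fin q) ℂ) (u v : Fin q → ℂ) :
    star (A.mulVec u) ⬝ᵥ v = star u ⬝ᵥ A.conjTranspose.mulVec v := by
  rw [Matrix.star_mulVec, Matrix.dotProduct_mulVec]

theorem rank_fromRows_eq_iff (a b : Matrix (Fin q) (Fin q) ℂ) :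
    (Matrix.fromRows a b).rank = q ↔ ∀ v, a.mulVec v = 0 → b.mulVec v = 0 → v = 0 := by
  have h := (Matrix.fromRows a b).mulVecLin.finrank_range_add_finrank_ker
  rw [Module.finrank_fin_fun] at h
  have hker : (Matrix.fromRows a b).rank = q ↔
      Module.finrank ℂ (LinearMap.ker (Matrix.fromRows a b).mulVecLin) = 0 := by
    unfold Matrix.rank
    omega
  rw [hker, Submodule.finrank_eq_zero, LinearMap.ker_eq_bot']
  refine forall_congr' fun v => ?_
  rw [Matrix.mulVecLin_apply, Matrix.fromRows_mulVec]
  constructor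
  · intro h ha hb
    refine h ?_
    rw [ha, hb]
    funext i
    cases i <;> rfl
  · intro h he
    exact h (funext fun i => congrFun he (Sum.inl i)) (funext fun i => congrFun he (Sum.inr i))

theorem signatureForm_eq (z : ℂ) (a b : Matrix (Fin q) (Fin q) ℂ) :
    signatureForm z a b
      = (Complex.I / (2 * (z.im : ℂ))) • (a.conjTranspose * b - b.conjTranspose * a) := by
  rw [signatureForm, signatureJ, Matrix.conjTranspose_fromRows_eq_fromCols_conjTranspose,
    Matrix.mul_smul, Matrix.smul_mul, Matrix.fromCols_mul_fromBlocks, Matrix.fromCols_mul_fromRows]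
  simp only [Matrix.mul_zero, Matrix.mul_neg, Matrix.mul_smul, Matrix.mul_one, zero_add, add_zero,
    Matrix.smul_mul, Matrix.neg_mul]
  rw [smul_add, smul_neg, smul_smul, smul_smul, smul_sub, ← neg_smul, add_comm, sub_eq_add_neg,
    ← neg_smul]
  congr 2 <;> ring

/-- The signature form measures the imaginary part of the pairing of the two components. -/
theorem sform_signatureForm (z : ℂ) (a b : Matrix (Fin q) (Fin q) ℂ) (v : Fin q → ℂ) :
    sform (signatureForm z a b) v v
      = (((star (b.mulVec v) ⬝ᵥ a.mulVec v).im / z.im : ℝ) : ℂ) := by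
  rw [signatureForm_eq, sform_smul, sform_sub, sform_conjTranspose_mul, sform_conjTranspose_mul,
    Matrix.star_dotProduct (a.mulVec v), Complex.star_def]
  have h := Complex.sub_conj (star (b.mulVec v) ⬝ᵥ a.mulVec v)
  rw [← neg_sub, h]
  push_cast
  rcases eq_or_ne (z.im : ℂ) 0 with h0 | h0
  · simp [h0]
  · field_simp
    linear_combination (-(((star (b.mulVec v) ⬝ᵥ a.mulVec v).im : ℂ))) * Complex.I_sq

theorem posSemidef_signatureForm_iff (z : ℂ) (a b : Matrix (Fin q) (Fin q) ℂ) :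
    (signatureForm z a b).PosSemidef ↔
      ∀ v, 0 ≤ (star (b.mulVec v) ⬝ᵥ a.mulVec v).im / z.im := by
  constructor
  · intro h v
    have := sform_self_nonneg v h
    rw [sform_signatureForm] at this
    exact_mod_cast this
  · intro h
    refine posSemidef_of_sform_nonneg fun v => ?_
    rw [sform_signatureForm]
    exact_mod_cast h v

theorem posSemidef_signatureForm_smul_iff (z c : ℂ) (a b : Matrix (Fin q) (Fin q) ℂ) :
    (signatureForm z (c • a) b).PosSemidef ↔
      ∀ v, 0 ≤ (c * (star (b.mulVec v) ⬝ᵥ a.mulVec v)).im / z.im := by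
  rw [posSemidef_signatureForm_iff]
  simp only [Matrix.smul_mulVec, dotProduct_smul, smul_eq_mul]

variable {A : Matrix (Fin q) (Fin q) ℂ}

theorem mpInv_isHermitian (hA : A.IsHermitian) : (mpInv A).IsHermitian := by
  have h := isMoorePenroseInverse_mpInv A
  have hP : IsMoorePenroseInverse A (mpInv A).conjTranspose :=
    { mul_mul_self := by
        have := congrArg Matrix.conjTranspose h.mul_mul_self
        simpa [Matrix.conjTranspose_mul, hA.eq, Matrix.mul_assoc] using this
      self_mul_mul := by
        have := congrArg Matrix.conjTranspose h.self_mul_mul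
        simpa [Matrix.conjTranspose_mul, hA.eq, Matrix.mul_assoc] using this
      isHermitian_left := by
        have : A * (mpInv A).conjTranspose = mpInv A * A := by
          rw [← h.isHermitian_right.eq, Matrix.conjTranspose_mul, hA.eq]
        rw [this]; exact h.isHermitian_right
      isHermitian_right := by
        have : (mpInv A).conjTranspose * A = A * mpInv A := by
          rw [← h.isHermitian_left.eq, Matrix.conjTranspose_mul, hA.eq]
        rw [this]; exact h.isHermitian_left }
  exact hP.unique h

theorem mpInv_mul_comm (hA : A.IsHermitian) : mpInv A * A = A * mpInv A := by
  rw [← (isMoorePenroseInverse_mpInv A).isHermitian_left.eq, Matrix.conjTranspose_mul, hA.eq,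
    (mpInv_isHermitian hA).eq]

theorem mpInv_posSemidef (hA : A.PosSemidef) : (mpInv A).PosSemidef := by
  refine posSemidef_of_sform_nonneg fun v => ?_
  have e : sform (mpInv A) v v = sform A ((mpInv A).mulVec v) ((mpInv A).mulVec v) := by
    conv_lhs => rw [← (isMoorePenroseInverse_mpInv A).self_mul_mul]
    rw [sform_mul, sform, ← Matrix.mulVec_mulVec, sform, star_mulVec_dotProduct,
      (mpInv_isHermitian hA.isHermitian).eq]
  rw [e]
  exact sform_self_nonneg _ hA

end LinearAlgebra

/-- Pairing of the two components of the transformed column `V_A (a; b)`. -/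
theorem pairing_polyV {A : Matrix (Fin q) (Fin q) ℂ} (hA : A.IsHermitian) {a b : Fin q → ℂ}
    (ha : A.mulVec ((mpInv A).mulVec a) = a) (w : ℂ) :
    star (w • ((mpInv A).mulVec a + b)) ⬝ᵥ -(A.mulVec b)
      = -(star w * (star (star b ⬝ᵥ a) + sform A b b)) := by
  have h1 : star ((mpInv A).mulVec a) ⬝ᵥ A.mulVec b = star (star b ⬝ᵥ a) := by
    rw [star_mulVec_dotProduct, (mpInv_isHermitian hA).eq, Matrix.mulVec_mulVec,
      mpInv_mul_comm hA, ← Matrix.star_dotProduct]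
    have : star a ⬝ᵥ (A * mpInv A).mulVec b = star ((A * mpInv A).mulVec a) ⬝ᵥ b := by
      rw [star_mulVec_dotProduct, (isMoorePenroseInverse_mpInv A).isHermitian_left.eq]
    rw [this, ← Matrix.mulVec_mulVec, ha]
  rw [star_smul, star_add, smul_dotProduct, dotProduct_neg, add_dotProduct, h1, smul_eq_mul,
    sform]
  ring

section Estimates

variable {A : Matrix (Fin q) (Fin q) ℂ} {a b : Fin q → ℂ} {z : ℂ}

theorem sform_le_im_div (hA : A.PosSemidef) (ha : A.mulVec ((mpInv A).mulVec a) = a)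
    (hz : z.im ≠ 0) (h : 0 ≤ ((z - α) * (star b ⬝ᵥ a)).im / z.im) :
    (sform A b b).re ≤
      (star ((z - α) • ((mpInv A).mulVec a + b)) ⬝ᵥ -(A.mulVec b)).im / z.im := by
  rw [pairing_polyV hA.isHermitian ha, sform_self_eq_re b hA]
  have e : (-(star (z - (α : ℂ)) * (star (star b ⬝ᵥ a) + (((sform A b b).re : ℝ) : ℂ)))).im
      = ((z - α) * (star b ⬝ᵥ a)).im + z.im * (sform A b b).re := by
    simp [Complex.mul_im]
    ring
  rw [e, add_div, mul_div_cancel_left₀ _ hz, Complex.ofReal_re]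
  linarith

theorem mul_sform_le_re (hA : A.PosSemidef) (ha : A.mulVec ((mpInv A).mulVec a) = a)
    (h1 : z.im ≠ 0 → 0 ≤ (star b ⬝ᵥ a).im / z.im) (hz : z.re < α) (h2 : 0 ≤ (star b ⬝ᵥ a).re) :
    (α - z.re) * (sform A b b).re ≤
      (star ((z - α) • ((mpInv A).mulVec a + b)) ⬝ᵥ -(A.mulVec b)).re := by
  rw [pairing_polyV hA.isHermitian ha, sform_self_eq_re b hA]
  have e : (-(star (z - (α : ℂ)) * (star (star b ⬝ᵥ a) + (((sform A b b).re : ℝ) : ℂ)))).re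
      = (α - z.re) * ((star b ⬝ᵥ a).re + (sform A b b).re) + z.im * (star b ⬝ᵥ a).im := by
    simp [Complex.mul_re]
    ring
  have h3 : 0 ≤ z.im * (star b ⬝ᵥ a).im := by
    rcases eq_or_ne z.im 0 with h0 | h0
    · simp [h0]
    · have := mul_nonneg (h1 h0) (sq_nonneg z.im)
      have e2 : (star b ⬝ᵥ a).im / z.im * z.im ^ 2 = z.im * (star b ⬝ᵥ a).im := by
        field_simp
      rwa [e2] at this
  rw [e, Complex.ofReal_re]
  nlinarith [mul_nonneg (sub_nonneg.mpr hz.le) h2]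

theorem norm_pairing_sq_le (hA : A.PosSemidef) (v : Fin q → ℂ) :
    ‖star v ⬝ᵥ -(A.mulVec b)‖ ^ 2 ≤ (sform A v v).re * (sform A b b).re := by
  rw [dotProduct_neg, norm_neg]
  exact norm_sform_sq_le hA v b

end Estimates

/-- `x² ≤ c t` and `d t ≤ x` give `x ≤ c / d`. -/
theorem le_div_of_sq_le {x c t d : ℝ} (hd : 0 < d) (hc : 0 ≤ c) (h1 : x ^ 2 ≤ c * t)
    (h2 : d * t ≤ x) : x ≤ c / d := by
  rw [le_div_iff₀ hd]
  by_contra hlt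
  push Not at hlt
  have hx : 0 < x := by
    by_contra hx
    nlinarith
  nlinarith [mul_le_mul_of_nonneg_left h2 hc]

/-! ### Functions of the class `S[s₀, ≤]` -/

section MemSle

variable {σ : VectorMeasure (Set.Ici α) (Matrix (Fin q) (Fin q) ℂ)}
  {F : ℂ → Matrix (Fin q) (Fin q) ℂ}

theorem IsStieltjesMeasureOf.sform_eq (h : IsStieltjesMeasureOf σ F) {z : ℂ} (hz : z ∈ slit α)
    (v : Fin q → ℂ) :
    sform (F z) v v = ∫ t : Set.Ici α, (((t : ℝ) : ℂ) - z)⁻¹ ∂(quadMeasure h.1 v) := by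
  obtain ⟨b, hb0, hbd⟩ := exists_norm_inv_sub_le hz
  rw [h.2 z hz, stieltjesTransform_eq_matInt]
  exact sform_matInt h.1 v (continuous_inv_sub hz).stronglyMeasurable hb0 hbd

theorem IsStieltjesMeasureOf.posSemidef_of_lt (h : IsStieltjesMeasureOf σ F) {x : ℝ} (hx : x < α) :
    (F x).PosSemidef := by
  refine posSemidef_of_sform_nonneg fun v => ?_
  rw [h.sform_eq (Or.inr (by simpa using hx))]
  have e : ∀ t : Set.Ici α, (((t : ℝ) : ℂ) - x)⁻¹ = (((((t : ℝ) - x)⁻¹ : ℝ)) : ℂ) := fun t => by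
    push_cast; rfl
  simp only [e]
  rw [integral_complex_ofReal]
  have : 0 ≤ ∫ t : Set.Ici α, ((t : ℝ) - x)⁻¹ ∂(quadMeasure h.1 v) :=
    integral_nonneg fun t => inv_nonneg.mpr (by
      have : α ≤ t := t.2
      linarith)
  exact_mod_cast this

theorem im_inv_ofReal_sub (t : ℝ) (z : ℂ) :
    ((t : ℂ) - z)⁻¹.im = z.im * ‖((t : ℂ) - z)⁻¹‖ ^ 2 := by
  rw [Complex.inv_im, norm_inv, inv_pow, ← Complex.normSq_eq_norm_sq]
  simp [div_eq_mul_inv]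

theorem IsStieltjesMeasureOf.im_sform (h : IsStieltjesMeasureOf σ F) {z : ℂ} (hz : z ∈ slit α)
    (v : Fin q → ℂ) : (sform (F z) v v).im
      = z.im * ∫ t : Set.Ici α, ‖(((t : ℝ) : ℂ) - z)⁻¹‖ ^ 2 ∂(quadMeasure h.1 v) := by
  rw [h.sform_eq hz, integral_eq_re_add_im (integrable_inv_sub _ hz)]
  rw [← integral_const_mul]
  simp only [← im_inv_ofReal_sub, Complex.add_im, Complex.ofReal_im, zero_add, Complex.mul_im,
    Complex.ofReal_re, Complex.I_im, mul_one, Complex.I_re, mul_zero, add_zero]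

theorem IsStieltjesMeasureOf.mul_im_sform_nonneg (h : IsStieltjesMeasureOf σ F) {z : ℂ}
    (hz : z.im ≠ 0) (v : Fin q → ℂ) : 0 ≤ ((z - α) * sform (F z) v v).im / z.im := by
  have hzs : z ∈ slit α := Or.inl hz
  have hi := integrable_inv_sub (quadMeasure h.1 v) hzs
  rw [h.sform_eq hzs, ← integral_const_mul, integral_eq_re_add_im (hi.const_mul _)]
  have e : ∀ t : Set.Ici α, ((z - α) * (((t : ℝ) : ℂ) - z)⁻¹).im
      = z.im * (((t : ℝ) - α) * ‖(((t : ℝ) : ℂ) - z)⁻¹‖ ^ 2) := by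
    intro t
    have hne := sub_ne_zero_of_mem_slit hzs t.2
    have : (z - α) * (((t : ℝ) : ℂ) - z)⁻¹
        = -1 + ((((t : ℝ) - α : ℝ)) : ℂ) * (((t : ℝ) : ℂ) - z)⁻¹ := by
      field_simp
      push_cast
      ring
    rw [this, Complex.add_im, Complex.im_ofReal_mul, im_inv_ofReal_sub]
    simp
    ring
  simp only [e, Complex.add_im, Complex.ofReal_im, zero_add, Complex.mul_im, Complex.ofReal_re,
    Complex.I_im, mul_one, Complex.I_re, mul_zero, add_zero]
  rw [integral_const_mul, mul_div_cancel_left₀ _ hz]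
  refine integral_nonneg fun t => ?_
  have : α ≤ t := t.2
  exact mul_nonneg (by linarith) (by positivity)

theorem IsStieltjesMeasureOf.norm_sform_sq_le (h : IsStieltjesMeasureOf σ F)
    {s₀ : Matrix (Fin q) (Fin q) ℂ} (hle : (s₀ - σ Set.univ).PosSemidef) {z : ℂ}
    (hz : z ∈ slit α) (u v : Fin q → ℂ) : ‖sform (F z) u v‖ ^ 2 ≤ (sform s₀ u u).re *
      ∫ t : Set.Ici α, ‖(((t : ℝ) : ℂ) - z)⁻¹‖ ^ 2 ∂(quadMeasure h.1 v) := by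
  obtain ⟨b, hb0, hbd⟩ := exists_norm_inv_sub_le hz
  rw [h.2 z hz, stieltjesTransform_eq_matInt]
  refine (norm_sform_matInt_sq_le h.1 u v (continuous_inv_sub hz).stronglyMeasurable
    hb0 hbd).trans ?_
  have h1 := sform_self_re_nonneg u hle
  rw [sform_sub, Complex.sub_re] at h1
  have h2 : 0 ≤ ∫ t : Set.Ici α, ‖(((t : ℝ) : ℂ) - z)⁻¹‖ ^ 2 ∂(quadMeasure h.1 v) :=
    integral_nonneg fun t => by positivity
  exact mul_le_mul_of_nonneg_right (by linarith) h2

/-- The column space of `F(z)` is contained in that of `s₀`. -/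
theorem IsStieltjesMeasureOf.mul_mpInv_mul (h : IsStieltjesMeasureOf σ F)
    {s₀ : Matrix (Fin q) (Fin q) ℂ} (hle : (s₀ - σ Set.univ).PosSemidef) {z : ℂ}
    (hz : z ∈ slit α) : s₀ * mpInv s₀ * F z = F z := by
  have hP := isMoorePenroseInverse_mpInv s₀
  have hker : ∀ u v, s₀.mulVec u = 0 → sform (F z) u v = 0 := by
    intro u v hu
    have := h.norm_sform_sq_le hle hz u v
    have e : sform s₀ u u = 0 := by rw [sform, hu, dotProduct_zero]
    rw [e, Complex.zero_re, zero_mul] at this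
    exact norm_eq_zero.mp (pow_eq_zero_iff two_ne_zero |>.mp (le_antisymm this (sq_nonneg _)))
  -- `1 - s₀ s₀⁺` is the orthogonal projection onto the kernel of `s₀`.
  have hs : s₀.IsHermitian := by
    have h1 := hle.isHermitian.add (h.1 Set.univ MeasurableSet.univ).isHermitian
    rwa [sub_add_cancel] at h1
  have h0 : (1 - s₀ * mpInv s₀) * F z = 0 := by
    ext j k
    rw [← sform_single ((1 - s₀ * mpInv s₀) * F z) j k, sform_mul, sform, Matrix.zero_apply]
    have e : (1 - s₀ * mpInv s₀) = (1 - s₀ * mpInv s₀).conjTranspose := by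
      rw [Matrix.conjTranspose_sub, hP.isHermitian_left.eq, Matrix.conjTranspose_one]
    rw [e, ← star_mulVec_dotProduct]
    refine hker _ _ ?_
    rw [Matrix.mulVec_mulVec, Matrix.mul_sub, ← mpInv_mul_comm hs, ← Matrix.mul_assoc,
      hP.mul_mul_self, Matrix.mul_one, sub_self, Matrix.zero_mulVec]
  rw [Matrix.sub_mul, Matrix.one_mul, sub_eq_zero] at h0
  exact h0.symm

end MemSle

/-- Pairing of the two components of the transformed column `W_A (F v; v)`, where `x = F v`. -/
theorem pairing_polyW {A : Matrix (Fin q) (Fin q) ℂ} (hA : A.IsHermitian) {x : Fin q → ℂ}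
    (v : Fin q → ℂ) (hx : A.mulVec ((mpInv A).mulVec x) = x) (w : ℂ) :
    star (-(w • (mpInv A).mulVec x) + (v - (mpInv A).mulVec (A.mulVec v))) ⬝ᵥ
        (w • x + A.mulVec v)
      = -(star w * w * sform (mpInv A) x x) - star (w * (star v ⬝ᵥ x)) := by
  have hP := isMoorePenroseInverse_mpInv A
  have hH := mpInv_isHermitian hA
  have h1 : star ((mpInv A).mulVec x) ⬝ᵥ x = sform (mpInv A) x x := by
    rw [star_mulVec_dotProduct, hH.eq, sform]
  have h2 : star ((mpInv A).mulVec x) ⬝ᵥ A.mulVec v = star (star v ⬝ᵥ x) := by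
    rw [← Matrix.star_dotProduct, star_mulVec_dotProduct, hH.eq, Matrix.mulVec_mulVec]
    have : star x ⬝ᵥ (mpInv A * A).mulVec v = star ((mpInv A * A).mulVec x) ⬝ᵥ v := by
      rw [star_mulVec_dotProduct, hP.isHermitian_right.eq]
    rw [this, mpInv_mul_comm hA, ← Matrix.mulVec_mulVec, hx]
  have h3 : star ((mpInv A).mulVec (A.mulVec v)) ⬝ᵥ x = star v ⬝ᵥ x := by
    rw [star_mulVec_dotProduct, star_mulVec_dotProduct, hH.eq, hA.eq, hx]
  have h4 : star ((mpInv A).mulVec (A.mulVec v)) ⬝ᵥ A.mulVec v = star v ⬝ᵥ A.mulVec v := by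
    rw [star_mulVec_dotProduct, star_mulVec_dotProduct, hH.eq, hA.eq, Matrix.mulVec_mulVec,
      Matrix.mulVec_mulVec, hP.mul_mul_self]
  rw [star_add, star_neg, star_smul, star_sub, add_dotProduct, neg_dotProduct, smul_dotProduct,
    sub_dotProduct, dotProduct_add, dotProduct_add, dotProduct_add, dotProduct_smul,
    dotProduct_smul, dotProduct_smul, h1, h2, h3, h4, star_mul']
  simp only [smul_eq_mul]
  ring

/-! ### Holomorphic and meromorphic matrix functions -/

section Regularity

variable {f g : ℂ → Matrix (Fin q) (Fin q) ℂ} {U : Set ℂ}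

theorem IsHolomorphicOn.congr (hf : IsHolomorphicOn f U) (h : ∀ z ∈ U, g z = f z) :
    IsHolomorphicOn g U := fun j k => (hf j k).congr fun z hz => by rw [h z hz]

theorem IsHolomorphicOn.add (hf : IsHolomorphicOn f U) (hg : IsHolomorphicOn g U) :
    IsHolomorphicOn (fun z => f z + g z) U := fun j k => (hf j k).add (hg j k)

theorem isHolomorphicOn_const (A : Matrix (Fin q) (Fin q) ℂ) :
    IsHolomorphicOn (fun _ => A) U := fun _ _ => differentiableOn_const _

theorem IsHolomorphicOn.smul {c : ℂ → ℂ} (hc : DifferentiableOn ℂ c U) (hf : IsHolomorphicOn f U) :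
    IsHolomorphicOn (fun z => c z • f z) U := fun j k => hc.mul (hf j k)

theorem IsHolomorphicOn.mul (hf : IsHolomorphicOn f U) (hg : IsHolomorphicOn g U) :
    IsHolomorphicOn (fun z => f z * g z) U := fun j k => by
  simp only [Matrix.mul_apply]
  exact DifferentiableOn.fun_sum fun i _ => (hf j i).mul (hg i k)

theorem IsHolomorphicOn.det (hf : IsHolomorphicOn f U) :
    DifferentiableOn ℂ (fun z => (f z).det) U := by
  simp only [Matrix.det_apply]
  refine DifferentiableOn.fun_sum fun p _ => DifferentiableOn.fun_const_smul ?_ _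
  exact DifferentiableOn.fun_finsetProd fun i _ => hf _ _

theorem IsHolomorphicOn.inv (hf : IsHolomorphicOn f U) (hdet : ∀ z ∈ U, (f z).det ≠ 0) :
    IsHolomorphicOn (fun z => (f z)⁻¹) U := by
  have hadj : IsHolomorphicOn (fun z => (f z).adjugate) U := fun j k => by
    simp only [Matrix.adjugate_apply]
    refine IsHolomorphicOn.det fun a b => ?_
    by_cases ha : a = k
    · subst ha
      simp only [Matrix.updateRow_self]
      exact differentiableOn_const _
    · simp only [Matrix.updateRow_ne ha]
      exact hf a b
  refine (IsHolomorphicOn.smul (c := fun z => ((f z).det)⁻¹) (hf.det.inv hdet) hadj).congr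
    fun z _ => ?_
  rw [Matrix.inv_def, Ring.inverse_eq_inv']

theorem IsHolomorphicOn.isHolomorphicAt (hf : IsHolomorphicOn f U) (hU : IsOpen U) {z : ℂ}
    (hz : z ∈ U) : IsHolomorphicAt f z := fun j k =>
  (hf j k).analyticAt (hU.mem_nhds hz)

theorem IsHolomorphicOn.isMeromorphic (hf : IsHolomorphicOn f (slit α)) : IsMeromorphic α f :=
  fun j k _ hz => ((hf j k).analyticAt ((isOpen_slit α).mem_nhds hz)).meromorphicAt

theorem IsMeromorphic.congr (hf : IsMeromorphic α f) (h : ∀ z ∈ slit α, g z = f z) :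
    IsMeromorphic α g := fun j k z hz => (hf j k z hz).congr (by
  filter_upwards [nhdsWithin_le_nhds ((isOpen_slit α).mem_nhds hz)] with w hw
  rw [h w hw])

theorem IsMeromorphic.add (hf : IsMeromorphic α f) (hg : IsMeromorphic α g) :
    IsMeromorphic α (fun z => f z + g z) := fun j k z hz => (hf j k z hz).add (hg j k z hz)

theorem IsMeromorphic.mul (hf : IsMeromorphic α f) (hg : IsMeromorphic α g) :
    IsMeromorphic α (fun z => f z * g z) := fun j k z hz => by
  simp only [Matrix.mul_apply]
  exact MeromorphicAt.fun_sum fun i _ => (hf j i z hz).mul (hg i k z hz)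

theorem continuousAt_pairing {z : ℂ} (hU : IsOpen U) (hf : IsHolomorphicOn f U)
    (hg : IsHolomorphicOn g U) (hz : z ∈ U) (v : Fin q → ℂ) :
    ContinuousAt (fun w => star ((g w).mulVec v) ⬝ᵥ (f w).mulVec v) z := by
  have h : ∀ {f : ℂ → Matrix (Fin q) (Fin q) ℂ}, IsHolomorphicOn f U → ∀ j,
      ContinuousAt (fun w => (f w).mulVec v j) z := by
    intro f hf j
    simp only [Matrix.mulVec, dotProduct]
    exact tendsto_finsetSum _ fun k _ =>
      (((hf j k).differentiableAt (hU.mem_nhds hz)).continuousAt).mul continuousAt_const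
  simp only [dotProduct, Pi.star_apply]
  exact tendsto_finsetSum _ fun j _ => ((h hg j).star).mul (h hf j)

end Regularity

theorem eventually_im_ne_zero {z : ℂ} (hz : z.im ≠ 0) : ∀ᶠ w in 𝓝 z, w.im ≠ 0 :=
  (isOpen_ne_fun Complex.continuous_im continuous_const).mem_nhds hz

/-- A discrete set does not affect inequalities between continuous functions. -/
theorem IsDiscreteSet.le_of_continuousAt {D : Set ℂ} (hD : IsDiscreteSet D) {f g : ℂ → ℝ} {z : ℂ}
    (hz : z.im ≠ 0) (hf : ContinuousAt f z) (hg : ContinuousAt g z)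
    (h : ∀ w : ℂ, w.im ≠ 0 → w ∉ D → f w ≤ g w) : f z ≤ g z := by
  refine le_of_tendsto_of_tendsto (hf.tendsto.mono_left nhdsWithin_le_nhds)
    (hg.tendsto.mono_left nhdsWithin_le_nhds) (b := 𝓝[≠] z) ?_
  filter_upwards [(eventually_im_ne_zero hz).filter_mono nhdsWithin_le_nhds,
    hD.eventually_notMem z] with w h1 h2
  exact h w h1 h2

theorem norm_toEuclideanCLM_le (A : Matrix (Fin q) (Fin q) ℂ) {b : ℝ} (hb : ∀ j k, ‖A j k‖ ≤ b) :
    ‖Matrix.toEuclideanCLM (n := Fin q) (𝕜 := ℂ) A‖ ≤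
      b * ∑ j, ∑ k, ‖Matrix.toEuclideanCLM (n := Fin q) (𝕜 := ℂ) (Matrix.single j k (1 : ℂ))‖ := by
  have e : A = ∑ j, ∑ k, A j k • Matrix.single j k (1 : ℂ) := by
    conv_lhs => rw [Matrix.matrix_eq_sum_single A]
    simp [Matrix.smul_single]
  conv_lhs => rw [e]
  simp only [map_sum, map_smul, Finset.mul_sum]
  refine (norm_sum_le _ _).trans (Finset.sum_le_sum fun j _ => (norm_sum_le _ _).trans
    (Finset.sum_le_sum fun k _ => ?_))
  rw [norm_smul]
  exact mul_le_mul_of_nonneg_right (hb j k) (norm_nonneg _)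

/-- Entries are controlled by the values of the quadratic form. -/
theorem norm_entry_le_sum (A : Matrix (Fin q) (Fin q) ℂ) {c : (Fin q → ℂ) → ℝ} {d : ℝ}
    (h : ∀ v, ‖sform A v v‖ ≤ c v * d) (j k : Fin q) :
    ‖A j k‖ ≤ (1 / 4 * ∑ m : Fin 4, c (Pi.single j 1 + Complex.I ^ (m : ℕ) • Pi.single k 1))
      * d := by
  rw [entry_polarization A, norm_mul, mul_assoc, Finset.sum_mul]
  have h4 : ‖(1 / 4 : ℂ)‖ = 1 / 4 := by norm_num
  rw [h4]
  refine mul_le_mul_of_nonneg_left ((norm_sum_le _ _).trans (Finset.sum_le_sum fun m _ => ?_))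
    (by norm_num)
  rw [norm_mul, norm_pow, norm_neg, Complex.norm_I, one_pow, one_mul]
  exact h _

/-! ### The transformation of Stieltjes pairs -/

section Pair

variable {φ ψ : ℂ → Matrix (Fin q) (Fin q) ℂ} {D : Set ℂ}

theorem IsRegularOff.isOpen (hD : IsRegularOff α φ ψ D) : IsOpen (slit α \ D) :=
  (isOpen_slit α).sdiff hD.discrete.isClosed

/-- By continuity, the positivity conditions hold wherever the pair is holomorphic. -/
theorem IsStieltjesPair.pairing_nonneg (h : IsStieltjesPair α φ ψ) (hD : IsRegularOff α φ ψ D)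
    {z : ℂ} (hz : z.im ≠ 0) (hzD : z ∉ D) (v : Fin q → ℂ) :
    0 ≤ (star ((ψ z).mulVec v) ⬝ᵥ (φ z).mulVec v).im / z.im ∧
      0 ≤ ((z - α) * (star ((ψ z).mulVec v) ⬝ᵥ (φ z).mulVec v)).im / z.im := by
  obtain ⟨-, -, E, hE, hpos⟩ := h
  have hcont := continuousAt_pairing hD.isOpen hD.holomorphic_fst hD.holomorphic_snd
    ⟨Or.inl hz, hzD⟩ v
  have him : ContinuousAt Complex.im z := Complex.continuous_im.continuousAt
  constructor
  · refine hE.discrete.le_of_continuousAt hz continuousAt_const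
      ((Complex.continuous_im.continuousAt.comp hcont).div him hz) fun w hw hwE => ?_
    exact (posSemidef_signatureForm_iff _ _ _).mp (hpos w hw hwE).1 v
  · refine hE.discrete.le_of_continuousAt hz continuousAt_const
      ((Complex.continuous_im.continuousAt.comp
        ((continuousAt_id.sub continuousAt_const).mul hcont)).div him hz) fun w hw hwE => ?_
    exact (posSemidef_signatureForm_smul_iff _ _ _ _).mp (hpos w hw hwE).2 v

/-- To the left of the cut, the two positivity conditions combine into positivity of the real
part; the real axis is reached by continuity. -/
theorem IsStieltjesPair.pairing_re_nonneg (h : IsStieltjesPair α φ ψ) (hD : IsRegularOff α φ ψ D)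
    {z : ℂ} (hz : z.re < α) (hzD : z ∉ D) (v : Fin q → ℂ) :
    0 ≤ (star ((ψ z).mulVec v) ⬝ᵥ (φ z).mulVec v).re := by
  have key : ∀ w : ℂ, w.im ≠ 0 → w.re < α → w ∉ D →
      0 ≤ (star ((ψ w).mulVec v) ⬝ᵥ (φ w).mulVec v).re := by
    intro w hw hre hwD
    obtain ⟨h1, h2⟩ := h.pairing_nonneg hD hw hwD v
    set m := star ((ψ w).mulVec v) ⬝ᵥ (φ w).mulVec v
    have e : ((w - α) * m).im / w.im = m.re - (α - w.re) * (m.im / w.im) := by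
      rw [Complex.mul_im]
      simp
      field_simp
      ring
    rw [e] at h2
    have := mul_nonneg (sub_nonneg.mpr hre.le) h1
    linarith
  by_cases hi : z.im = 0
  · have hcont := Complex.continuous_re.continuousAt.comp (continuousAt_pairing hD.isOpen
      hD.holomorphic_fst hD.holomorphic_snd ⟨Or.inr hz, hzD⟩ v)
    have hlim : Tendsto (fun n : ℕ => z + ((1 / ((n : ℝ) + 1) : ℝ) : ℂ) * Complex.I) atTop
        (𝓝 z) := by
      have := ((Complex.continuous_ofReal.tendsto _).comp
        (tendsto_one_div_add_atTop_nhds_zero_nat (𝕜 := ℝ))).mul_const Complex.I |>.const_add z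
      simpa using this
    refine ge_of_tendsto (hcont.tendsto.comp hlim) ?_
    filter_upwards [hlim.eventually (hD.discrete.isClosed.isOpen_compl.mem_nhds hzD)] with n hn
    refine key _ ?_ (by simpa using hz) hn
    have : (0 : ℝ) < 1 / ((n : ℝ) + 1) := by positivity
    simp only [Complex.add_im, hi, zero_add, Complex.mul_im, Complex.ofReal_re, Complex.I_im,
      mul_one, Complex.ofReal_im, Complex.I_re, mul_zero, add_zero]
    exact this.ne'
  · exact key z hi hz hzD

variable {A : Matrix (Fin q) (Fin q) ℂ}

theorem MemPairClass.mulVec_mpInv (h : MemPairClass α A φ ψ) (hD : IsRegularOff α φ ψ D)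
    {z : ℂ} (hz : z ∈ slit α \ D) (v : Fin q → ℂ) :
    A.mulVec ((mpInv A).mulVec ((φ z).mulVec v)) = (φ z).mulVec v := by
  obtain ⟨w, hw⟩ := h.2 z hz.1 (hD.holomorphic_fst.isHolomorphicAt hD.isOpen hz) ⟨v, rfl⟩
  rw [Matrix.mulVecLin_apply, Matrix.mulVecLin_apply] at hw
  rw [← hw, Matrix.mulVec_mulVec, Matrix.mulVec_mulVec,
    (isMoorePenroseInverse_mpInv A).mul_mul_self]

theorem sub_ofReal_ne_zero {z : ℂ} (hz : z ∈ slit α) : z - (α : ℂ) ≠ 0 := by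
  rw [← neg_sub]
  exact neg_ne_zero.mpr (sub_ne_zero_of_mem_slit hz le_rfl)

/-- The denominator `(z - α) (A⁺ φ + ψ)` is invertible: on its kernel, the positivity conditions
force the nonpositive pairing `-aᴴ A⁺ a`, `a = φ v`, to vanish. -/
theorem MemPairClass.det_ne_zero (hA : A.PosSemidef) (h : MemPairClass α A φ ψ)
    (hD : IsRegularOff α φ ψ D) {z : ℂ} (hz : z ∈ slit α \ D) :
    ((z - α) • (mpInv A * φ z + ψ z)).det ≠ 0 := by
  intro hdet
  obtain ⟨v, hv0, hv⟩ := Matrix.exists_mulVec_eq_zero_iff.mpr hdet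
  refine hv0 ((rank_fromRows_eq_iff _ _).mp (hD.rank_eq z hz) v ?_ ?_)
  all_goals
    rw [Matrix.smul_mulVec, smul_eq_zero_iff_right (sub_ofReal_ne_zero hz.1), Matrix.add_mulVec,
      ← Matrix.mulVec_mulVec] at hv
    set a := (φ z).mulVec v with ha
    have hb : (ψ z).mulVec v = -((mpInv A).mulVec a) := by
      rw [eq_neg_iff_add_eq_zero, add_comm]; exact hv
    have hP := mpInv_posSemidef hA
    have hm : star ((ψ z).mulVec v) ⬝ᵥ a = -(((sform (mpInv A) a a).re : ℝ) : ℂ) := by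
      rw [hb, star_neg, neg_dotProduct, star_mulVec_dotProduct, hP.isHermitian.eq,
        ← sform_self_eq_re a hP, sform]
    have hp := sform_self_re_nonneg a hP
    have hre : 0 ≤ (star ((ψ z).mulVec v) ⬝ᵥ a).re := by
      by_cases hi : z.im = 0
      · exact h.1.pairing_re_nonneg hD (hz.1.resolve_left (not_not.mpr hi)) hz.2 v
      · have h2 := (h.1.pairing_nonneg hD hi hz.2 v).2
        rw [hm] at h2 ⊢
        simp [Complex.mul_im] at h2 ⊢
        rw [neg_div, mul_div_cancel_left₀ _ hi] at h2
        linarith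
    rw [hm, Complex.neg_re, Complex.ofReal_re] at hre
    have hz0 : sform (mpInv A) a a = 0 := by
      rw [sform_self_eq_re a hP, le_antisymm (by linarith) hp, Complex.ofReal_zero]
    have hPa : (mpInv A).mulVec a = 0 := (hP.dotProduct_mulVec_zero_iff a).mp hz0
  · have h5 := h.mulVec_mpInv hD hz v
    rw [← ha, hPa, Matrix.mulVec_zero] at h5
    exact h5.symm
  · rw [hb, hPa, neg_zero]

theorem polyV_mul (α : ℝ) (A a b x y : Matrix (Fin q) (Fin q) ℂ) (z : ℂ) :
    Matrix.fromRows x y = polyV α A z * Matrix.fromRows a b ↔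
      x = -(A * b) ∧ y = (z - α) • (mpInv A * a + b) := by
  rw [polyV, Matrix.fromBlocks_mul_fromRows, Matrix.fromRows_ext_iff]
  simp [smul_add]

theorem polyW_mul (α : ℝ) (A a x y : Matrix (Fin q) (Fin q) ℂ) (z : ℂ) :
    Matrix.fromRows x y = polyW α A z * Matrix.fromRows a (1 : Matrix (Fin q) (Fin q) ℂ) ↔
      x = (z - α) • a + A ∧ y = -((z - α) • (mpInv A * a)) + (1 - mpInv A * A) := by
  rw [polyW, Matrix.fromBlocks_mul_fromRows, Matrix.fromRows_ext_iff]
  simp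

end Pair

/-! ### From Stieltjes pairs to Stieltjes functions -/

section Forward

variable {φ ψ : ℂ → Matrix (Fin q) (Fin q) ℂ} {D : Set ℂ} {A : Matrix (Fin q) (Fin q) ℂ}

/-- The numerator `-A ψ` of the function attached to a pair `(φ, ψ)`. -/
def pairNum (A : Matrix (Fin q) (Fin q) ℂ) (ψ : ℂ → Matrix (Fin q) (Fin q) ℂ) (z : ℂ) :
    Matrix (Fin q) (Fin q) ℂ :=
  -(A * ψ z)

/-- The denominator `(z - α) (A⁺ φ + ψ)` of the function attached to a pair `(φ, ψ)`. -/
noncomputable def pairDen (α : ℝ) (A : Matrix (Fin q) (Fin q) ℂ)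
    (φ ψ : ℂ → Matrix (Fin q) (Fin q) ℂ) (z : ℂ) : Matrix (Fin q) (Fin q) ℂ :=
  (z - α) • (mpInv A * φ z + ψ z)

theorem pairNum_mulVec (ψ : ℂ → Matrix (Fin q) (Fin q) ℂ) (z : ℂ) (v : Fin q → ℂ) :
    (pairNum A ψ z).mulVec v = -(A.mulVec ((ψ z).mulVec v)) := by
  rw [pairNum, Matrix.neg_mulVec, Matrix.mulVec_mulVec]

theorem pairDen_mulVec (φ ψ : ℂ → Matrix (Fin q) (Fin q) ℂ) (z : ℂ) (v : Fin q → ℂ) :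
    (pairDen α A φ ψ z).mulVec v
      = (z - α) • ((mpInv A).mulVec ((φ z).mulVec v) + (ψ z).mulVec v) := by
  rw [pairDen, Matrix.smul_mulVec, Matrix.add_mulVec, Matrix.mulVec_mulVec]

theorem IsRegularOff.holomorphic_pairNum (hD : IsRegularOff α φ ψ D)
    (A : Matrix (Fin q) (Fin q) ℂ) : IsHolomorphicOn (pairNum A ψ) (slit α \ D) :=
  ((isHolomorphicOn_const (-A)).mul hD.holomorphic_snd).congr fun z _ => by
    rw [pairNum, Matrix.neg_mul]

theorem IsRegularOff.holomorphic_pairDen (hD : IsRegularOff α φ ψ D)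
    (A : Matrix (Fin q) (Fin q) ℂ) : IsHolomorphicOn (pairDen α A φ ψ) (slit α \ D) :=
  IsHolomorphicOn.smul (differentiableOn_id.sub (differentiableOn_const _))
    (((isHolomorphicOn_const (mpInv A)).mul hD.holomorphic_fst).add hD.holomorphic_snd)

theorem isMeromorphic_pairNum (hψ : IsMeromorphic α ψ) (A : Matrix (Fin q) (Fin q) ℂ) :
    IsMeromorphic α (pairNum A ψ) :=
  ((isHolomorphicOn_const (-A)).isMeromorphic.mul hψ).congr fun z _ => by
    rw [pairNum, Matrix.neg_mul]

theorem isMeromorphic_pairDen (hφ : IsMeromorphic α φ) (hψ : IsMeromorphic α ψ)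
    (A : Matrix (Fin q) (Fin q) ℂ) : IsMeromorphic α (pairDen α A φ ψ) := by
  have h1 : IsHolomorphicOn (fun z => (z - α) • (1 : Matrix (Fin q) (Fin q) ℂ)) (slit α) :=
    IsHolomorphicOn.smul (differentiableOn_id.sub (differentiableOn_const _))
      (isHolomorphicOn_const 1)
  refine (h1.isMeromorphic.mul
    (((isHolomorphicOn_const (mpInv A)).isMeromorphic.mul hφ).add hψ)).congr fun z _ => ?_
  rw [pairDen, Matrix.smul_mul, Matrix.one_mul]

/-- The transformed column again satisfies the positivity conditions; the second one is the first
condition on `(φ, ψ)` in disguise, since multiplication by `z - α` turns the factor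
`conj (z - α)` of the pairing into `|z - α|²`. -/
theorem MemPairClass.pairing_transform_nonneg (hA : A.PosSemidef) (h : MemPairClass α A φ ψ)
    (hD : IsRegularOff α φ ψ D) {z : ℂ} (hz : z.im ≠ 0) (hzD : z ∉ D) (v : Fin q → ℂ) :
    0 ≤ (star ((pairDen α A φ ψ z).mulVec v) ⬝ᵥ (pairNum A ψ z).mulVec v).im / z.im ∧
      0 ≤ ((z - α) *
        (star ((pairDen α A φ ψ z).mulVec v) ⬝ᵥ (pairNum A ψ z).mulVec v)).im / z.im := by
  obtain ⟨h1, h2⟩ := h.1.pairing_nonneg hD hz hzD v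
  have ha := h.mulVec_mpInv hD ⟨Or.inl hz, hzD⟩ v
  rw [pairNum_mulVec, pairDen_mulVec]
  refine ⟨(sform_self_re_nonneg _ hA).trans (sform_le_im_div hA ha hz h2), ?_⟩
  rw [pairing_polyV hA.isHermitian ha, sform_self_eq_re _ hA]
  set m := star ((ψ z).mulVec v) ⬝ᵥ (φ z).mulVec v
  set t := (sform A ((ψ z).mulVec v) ((ψ z).mulVec v)).re
  have e : ((z - α) * -(star (z - (α : ℂ)) * (star m + (t : ℂ)))).im
      = Complex.normSq (z - α) * m.im := by
    have : (z - (α : ℂ)) * star (z - (α : ℂ)) = (Complex.normSq (z - α) : ℂ) :=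
      Complex.mul_conj _
    rw [mul_neg, ← mul_assoc, this, Complex.neg_im, Complex.im_ofReal_mul]
    simp
  rw [e, mul_div_assoc]
  exact mul_nonneg (Complex.normSq_nonneg _) h1

/-- The distance-like weight in the growth estimate; it is positive exactly on the slit plane. -/
noncomputable def slitWeight (α : ℝ) (z : ℂ) : ℝ := max |z.im| (α - z.re)

theorem slitWeight_pos {z : ℂ} (hz : z ∈ slit α) : 0 < slitWeight α z :=
  hz.elim (fun h => (abs_pos.mpr h).trans_le (le_max_left _ _))
    fun h => (sub_pos.mpr h).trans_le (le_max_right _ _)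

theorem continuous_slitWeight (α : ℝ) : Continuous (slitWeight α) :=
  Complex.continuous_im.abs.max (continuous_const.sub Complex.continuous_re)

/-- Sign and size of the quadratic forms of the quotient. If `η` is the solution of
`pairDen α A φ ψ z η = v` and `t` is the value of the form of `A` at `ψ η`, then the form `f` of the
quotient at `v` satisfies `|f|² ≤ (vᴴ A v) t`, while `t |Im z|` and `t (α - Re z)` are at
most `|f|`; eliminate `t`. -/
theorem MemPairClass.sform_div_bounds (hA : A.PosSemidef) (h : MemPairClass α A φ ψ)
    (hD : IsRegularOff α φ ψ D) {z : ℂ} (hz : z ∈ slit α \ D) (v : Fin q → ℂ) :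
    (z.im ≠ 0 → 0 ≤ (sform (pairNum A ψ z * (pairDen α A φ ψ z)⁻¹) v v).im / z.im) ∧
      ‖sform (pairNum A ψ z * (pairDen α A φ ψ z)⁻¹) v v‖
        ≤ (sform A v v).re / slitWeight α z := by
  have hdet : IsUnit (pairDen α A φ ψ z).det := (h.det_ne_zero hA hD hz).isUnit
  set η := ((pairDen α A φ ψ z)⁻¹).mulVec v with hη
  have hv : (pairDen α A φ ψ z).mulVec η = v := by
    rw [hη, Matrix.mulVec_mulVec, Matrix.mul_nonsing_inv _ hdet, Matrix.one_mulVec]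
  have hf : sform (pairNum A ψ z * (pairDen α A φ ψ z)⁻¹) v v
      = star ((pairDen α A φ ψ z).mulVec η) ⬝ᵥ (pairNum A ψ z).mulVec η := by
    rw [hv, sform, hη, Matrix.mulVec_mulVec]
  refine ⟨fun hi => ?_, ?_⟩
  · rw [hf]
    exact (h.pairing_transform_nonneg hA hD hi hz.2 η).1
  have hsq : ‖sform (pairNum A ψ z * (pairDen α A φ ψ z)⁻¹) v v‖ ^ 2
      ≤ (sform A v v).re * (sform A ((ψ z).mulVec η) ((ψ z).mulVec η)).re := by
    rw [hf, pairNum_mulVec, hv]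
    exact norm_pairing_sq_le hA v
  refine le_div_of_sq_le (slitWeight_pos hz.1) (sform_self_re_nonneg v hA) hsq ?_
  have ha := h.mulVec_mpInv hD hz η
  have ht := sform_self_re_nonneg ((ψ z).mulVec η) hA
  rw [hf, pairNum_mulVec, pairDen_mulVec, slitWeight]
  rcases max_choice |z.im| (α - z.re) with hm | hm
  · rw [hm]
    rcases eq_or_ne z.im 0 with hi | hi
    · rw [hi, abs_zero, zero_mul]
      exact norm_nonneg _
    · have h1 := (sform_le_im_div hA ha hi (h.1.pairing_nonneg hD hi hz.2 η).2).trans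
        (le_abs_self _)
      rw [abs_div, le_div_iff₀ (abs_pos.mpr hi), mul_comm] at h1
      exact h1.trans (Complex.abs_im_le_norm _)
  · rw [hm]
    rcases le_or_gt α z.re with hr | hr
    · exact (mul_nonpos_of_nonpos_of_nonneg (by linarith) ht).trans (norm_nonneg _)
    · exact (mul_sform_le_re hA ha (fun hi => (h.1.pairing_nonneg hD hi hz.2 η).1) hr
        (h.1.pairing_re_nonneg hD hr hz.2 η)).trans (Complex.re_le_norm _)

/-- The quotient extends holomorphically over the exceptional set, since its entries are locally
bounded. -/
theorem MemPairClass.exists_extension (hA : A.PosSemidef) (h : MemPairClass α A φ ψ)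
    (hD : IsRegularOff α φ ψ D) : ∃ F : ℂ → Matrix (Fin q) (Fin q) ℂ,
      IsHolomorphicOn F (slit α) ∧
        ∀ z, z ∉ D → F z = pairNum A ψ z * (pairDen α A φ ψ z)⁻¹ := by
  have hG : IsHolomorphicOn (fun z => pairNum A ψ z * (pairDen α A φ ψ z)⁻¹) (slit α \ D) :=
    (hD.holomorphic_pairNum A).mul
      ((hD.holomorphic_pairDen A).inv fun z hz => h.det_ne_zero hA hD hz)
  have hext := fun j k => exists_differentiableOn_extension (isOpen_slit α) hD.discrete (hG j k)
    fun z hz => by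
      obtain ⟨hpos, hlt⟩ : 0 < slitWeight α z / 2 ∧ slitWeight α z / 2 < slitWeight α z := by
        have := slitWeight_pos hz
        constructor <;> linarith
      refine ⟨(1 / 4 * ∑ m : Fin 4, (fun v : Fin q → ℂ => (sform A v v).re)
        (Pi.single j 1 + Complex.I ^ (m : ℕ) • Pi.single k 1)) * (slitWeight α z / 2)⁻¹, ?_⟩
      filter_upwards [(isOpen_slit α).mem_nhds hz,
        (continuous_slitWeight α).continuousAt.eventually (lt_mem_nhds hlt)] with w hw hlt' hwD
      refine norm_entry_le_sum (c := fun v => (sform A v v).re) _ (fun v =>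
        (h.sform_div_bounds hA hD ⟨hw, hwD⟩ v).2.trans ?_) j k
      rw [div_eq_mul_inv]
      exact mul_le_mul_of_nonneg_left (inv_anti₀ hpos hlt'.le) (sform_self_re_nonneg v hA)
  choose G hGd hGe using hext
  exact ⟨fun z => Matrix.of fun j k => G j k z, hGd, fun z hz => by
    ext j k
    exact hGe j k z hz⟩

/-- Positivity of the imaginary part and the estimate `|vᴴ F v| ≤ vᴴ A v / |Im z|` suffice for
membership in `S[A, ≤]`; the estimate controls both the growth of `F` and the mass of its measure. -/
theorem memSle_of_bounds (hA : A.PosSemidef) {F : ℂ → Matrix (Fin q) (Fin q) ℂ}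
    (hF : IsHolomorphicOn F (slit α))
    (him : ∀ v, ∀ z : ℂ, z.im ≠ 0 → 0 ≤ (sform (F z) v v).im / z.im)
    (hb : ∀ v, ∀ z : ℂ, z.im ≠ 0 → ‖sform (F z) v v‖ ≤ (sform A v v).re / |z.im|) :
    MemSle α A F := by
  obtain ⟨σ, hσ, hle⟩ := exists_isStieltjesMeasureOf (c := fun v => (sform A v v).re) hF him hb
  refine ⟨⟨⟨hF, fun w hw => posSemidef_of_sform_nonneg fun v => ?_,
    fun x hx => hσ.posSemidef_of_lt hx⟩, ?_⟩, σ, hσ, posSemidef_of_sform_nonneg fun v => ?_⟩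
  · rw [sform_imPart]
    have h1 := mul_nonneg (him v w hw.ne') hw.le
    rw [div_mul_cancel₀ _ hw.ne'] at h1
    exact_mod_cast h1
  · set K : Fin q → Fin q → ℝ := fun j k => 1 / 4 * ∑ m : Fin 4,
      (fun v : Fin q → ℂ => (sform A v v).re)
        (Pi.single j 1 + Complex.I ^ (m : ℕ) • Pi.single k 1) with hK
    have hK0 : ∀ j k, 0 ≤ K j k := fun j k =>
      mul_nonneg (by norm_num) (Finset.sum_nonneg fun m _ => sform_self_re_nonneg _ hA)
    refine ⟨(∑ j, ∑ k, K j k) * ∑ j, ∑ k,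
      ‖Matrix.toEuclideanCLM (n := Fin q) (𝕜 := ℂ) (Matrix.single j k (1 : ℂ))‖, fun y hy => ?_⟩
    have hy0 : 0 < y := by linarith
    have hyim : ((y : ℂ) * Complex.I).im = y := by simp
    have hent : ∀ j k, ‖F ((y : ℂ) * Complex.I) j k‖ ≤ (∑ j, ∑ k, K j k) * y⁻¹ := by
      intro j k
      refine (norm_entry_le_sum (c := fun v => (sform A v v).re) _ (fun v => ?_) j k).trans
        (mul_le_mul_of_nonneg_right ?_ (inv_nonneg.mpr hy0.le))
      · have := hb v ((y : ℂ) * Complex.I) (by rw [hyim]; exact hy0.ne')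
        rwa [hyim, abs_of_pos hy0, div_eq_mul_inv] at this
      · exact (Finset.single_le_sum (f := fun k => K j k) (fun k _ => hK0 j k)
          (Finset.mem_univ k)).trans (Finset.single_le_sum (f := fun j => ∑ k, K j k)
            (fun j _ => Finset.sum_nonneg fun k _ => hK0 j k) (Finset.mem_univ j))
    refine (mul_le_mul_of_nonneg_left (norm_toEuclideanCLM_le _ hent) hy0.le).trans (le_of_eq ?_)
    field_simp
  · have hσu := hσ.1 Set.univ MeasurableSet.univ
    rw [sform_sub, sform_self_eq_re v hA, sform_self_eq_re v hσu, ← Complex.ofReal_sub]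
    exact_mod_cast sub_nonneg.mpr (hle v)

theorem MemPairClass.exists_memSle (hA : A.PosSemidef) (h : MemPairClass α A φ ψ)
    (hD : IsRegularOff α φ ψ D) : ∃ F : ℂ → Matrix (Fin q) (Fin q) ℂ, MemSle α A F ∧
      ∀ z ∈ slit α \ D, F z = pairNum A ψ z * (pairDen α A φ ψ z)⁻¹ := by
  obtain ⟨F, hF, hFe⟩ := h.exists_extension hA hD
  have hcont : ∀ v (z : ℂ), z.im ≠ 0 → ContinuousAt (fun w => sform (F w) v v) z := fun v z hz =>
    ((differentiableOn_sform hF v v).differentiableAt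
      ((isOpen_slit α).mem_nhds (Or.inl hz))).continuousAt
  refine ⟨F, memSle_of_bounds hA hF (fun v z hz => ?_) fun v z hz => ?_, fun z hz => hFe z hz.2⟩
  · refine hD.discrete.le_of_continuousAt hz continuousAt_const
      ((Complex.continuous_im.continuousAt.comp (hcont v z hz)).div
        Complex.continuous_im.continuousAt hz) fun w hw hwD => ?_
    simp only [Function.comp_apply, Pi.div_apply, hFe w hwD]
    exact (h.sform_div_bounds hA hD ⟨Or.inl hw, hwD⟩ v).1 hw
  · refine hD.discrete.le_of_continuousAt hz (hcont v z hz).norm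
      (continuousAt_const.div Complex.continuous_im.abs.continuousAt (abs_pos.mpr hz).ne')
      fun w hw hwD => ?_
    rw [hFe w hwD]
    exact (h.sform_div_bounds hA hD ⟨Or.inl hw, hwD⟩ v).2.trans
      (div_le_div_of_nonneg_left (sform_self_re_nonneg v hA) (abs_pos.mpr hw) (le_max_left _ _))

theorem IsRegularOff.nonempty (hD : IsRegularOff α φ ψ D) : (slit α \ D).Nonempty := by
  have hI : Complex.I ∈ slit α := Or.inl (by simp)
  obtain ⟨z, hz, hzD⟩ := (((isOpen_slit α).eventually_mem hI).filter_mono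
    nhdsWithin_le_nhds |>.and (hD.discrete.eventually_notMem Complex.I)).exists
  exact ⟨z, hz, hzD⟩

theorem rank_fromRows_of_det_ne_zero (a : Matrix (Fin q) (Fin q) ℂ)
    {b : Matrix (Fin q) (Fin q) ℂ} (hb : b.det ≠ 0) : (Matrix.fromRows a b).rank = q :=
  (rank_fromRows_eq_iff a b).mpr fun _ _ h =>
    Matrix.eq_zero_of_mulVec_eq_zero hb h

end Forward

/-! ### From Stieltjes functions to Stieltjes pairs -/

section Backward

variable {F : ℂ → Matrix (Fin q) (Fin q) ℂ} {A : Matrix (Fin q) (Fin q) ℂ}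
  {σ : VectorMeasure (Set.Ici α) (Matrix (Fin q) (Fin q) ℂ)}

/-- The inequality `Fᴴ A⁺ F ≤ Im F / Im z`, from the Cauchy-Schwarz inequality for `σ`. -/
theorem IsStieltjesMeasureOf.sform_mpInv_le (h : IsStieltjesMeasureOf σ F) (hA : A.PosSemidef)
    (hle : (A - σ Set.univ).PosSemidef) {z : ℂ} (hz : z.im ≠ 0) (v : Fin q → ℂ) :
    (sform (mpInv A) ((F z).mulVec v) ((F z).mulVec v)).re ≤ (sform (F z) v v).im / z.im := by
  have hzs : z ∈ slit α := Or.inl hz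
  have hP := mpInv_posSemidef hA
  set x := (F z).mulVec v with hx
  set p := (sform (mpInv A) x x).re
  have hp : 0 ≤ p := sform_self_re_nonneg x hP
  have e1 : sform (F z) ((mpInv A).mulVec x) v = sform (mpInv A) x x := by
    rw [sform, star_mulVec_dotProduct, hP.isHermitian.eq, sform]
  have e2 : sform A ((mpInv A).mulVec x) ((mpInv A).mulVec x) = sform (mpInv A) x x := by
    rw [sform, star_mulVec_dotProduct, hP.isHermitian.eq, sform, Matrix.mulVec_mulVec,
      Matrix.mulVec_mulVec, (isMoorePenroseInverse_mpInv A).self_mul_mul]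
  have hcs := h.norm_sform_sq_le hle hzs ((mpInv A).mulVec x) v
  rw [e1, e2, sform_self_eq_re x hP, Complex.norm_real, Real.norm_eq_abs, sq_abs, sq] at hcs
  rw [h.im_sform hzs, mul_div_cancel_left₀ _ hz]
  rcases hp.eq_or_lt with h0 | h0
  · rw [← h0]
    exact integral_nonneg fun t => by positivity
  · exact le_of_mul_le_mul_left hcs h0

theorem mulVec_transformFst (v : Fin q → ℂ) (z w : ℂ) :
    (w • F z + A).mulVec v = w • (F z).mulVec v + A.mulVec v := by
  rw [Matrix.add_mulVec, Matrix.smul_mulVec]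

theorem mulVec_transformSnd (v : Fin q → ℂ) (z w : ℂ) :
    (-(w • (mpInv A * F z)) + (1 - mpInv A * A)).mulVec v
      = -(w • (mpInv A).mulVec ((F z).mulVec v)) + (v - (mpInv A).mulVec (A.mulVec v)) := by
  rw [Matrix.add_mulVec, Matrix.neg_mulVec, Matrix.smul_mulVec, Matrix.sub_mulVec,
    Matrix.one_mulVec, Matrix.mulVec_mulVec, Matrix.mulVec_mulVec]

theorem IsStieltjesMeasureOf.pairing_nonneg (h : IsStieltjesMeasureOf σ F) (hA : A.PosSemidef)
    (hle : (A - σ Set.univ).PosSemidef) {z : ℂ} (hz : z.im ≠ 0) (v : Fin q → ℂ) :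
    0 ≤ (star ((-((z - α) • (mpInv A * F z)) + (1 - mpInv A * A)).mulVec v) ⬝ᵥ
        ((z - α) • F z + A).mulVec v).im / z.im ∧
      0 ≤ ((z - α) * (star ((-((z - α) • (mpInv A * F z)) + (1 - mpInv A * A)).mulVec v) ⬝ᵥ
        ((z - α) • F z + A).mulVec v)).im / z.im := by
  have hx : A.mulVec ((mpInv A).mulVec ((F z).mulVec v)) = (F z).mulVec v := by
    rw [Matrix.mulVec_mulVec, Matrix.mulVec_mulVec, h.mul_mpInv_mul hle (Or.inl hz)]
  rw [mulVec_transformFst, mulVec_transformSnd, pairing_polyW hA.isHermitian v hx,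
    sform_self_eq_re _ (mpInv_posSemidef hA)]
  have h1 := h.mul_im_sform_nonneg hz v
  have h2 := h.sform_mpInv_le hA hle hz v
  rw [sform] at h1
  change _ ≤ (star v ⬝ᵥ (F z).mulVec v).im / z.im at h2
  set f := star v ⬝ᵥ (F z).mulVec v
  set p := (sform (mpInv A) ((F z).mulVec v) ((F z).mulVec v)).re
  have hw : star (z - (α : ℂ)) * (z - α) = (Complex.normSq (z - α) : ℂ) := by
    rw [mul_comm]; exact Complex.mul_conj _
  have e1 : (-(star (z - (α : ℂ)) * (z - α) * (p : ℂ)) - star ((z - α) * f)).im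
      = ((z - α) * f).im := by
    rw [hw, ← Complex.ofReal_mul, Complex.sub_im, Complex.neg_im, Complex.ofReal_im]
    simp
    ring
  have e2 : ((z - α) * (-(star (z - (α : ℂ)) * (z - α) * (p : ℂ)) - star ((z - α) * f))).im
      = Complex.normSq (z - α) * (f.im - z.im * p) := by
    have : (z - α) * (-(star (z - (α : ℂ)) * (z - α) * (p : ℂ)) - star ((z - α) * f))
        = (Complex.normSq (z - α) : ℂ) * (-((z - α) * (p : ℂ)) - star f) := by
      rw [← hw, star_mul']
      ring
    rw [this, Complex.im_ofReal_mul]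
    congr 1
    simp
    ring
  rw [e1, e2]
  refine ⟨h1, ?_⟩
  rw [mul_div_assoc, sub_div, mul_div_cancel_left₀ _ hz]
  exact mul_nonneg (Complex.normSq_nonneg _) (by linarith)

/-- The pair attached to `F` is normalised: `A⁺ φ + ψ = 1`. -/
theorem mpInv_mul_transform_add (z w : ℂ) :
    mpInv A * (w • F z + A) + (-(w • (mpInv A * F z)) + (1 - mpInv A * A)) = 1 := by
  rw [Matrix.mul_add, Matrix.mul_smul]
  abel

end Backward

end MatStieltjes

theorem propositionP1218 {q : ℕ} (hq : 1 ≤ q) (α : ℝ) (s₀ : Matrix (Fin q) (Fin q) ℂ)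
    (hs₀ : s₀.PosSemidef) :
    (∀ φ ψ : ℂ → Matrix (Fin q) (Fin q) ℂ, MatStieltjes.MemPairClass α s₀ φ ψ →
      ∀ X Y : ℂ → Matrix (Fin q) (Fin q) ℂ,
        (∀ z ∈ MatStieltjes.slit α, Matrix.fromRows (X z) (Y z) =
          MatStieltjes.polyV α s₀ z * Matrix.fromRows (φ z) (ψ z)) →
      ∀ D : Set ℂ, MatStieltjes.IsRegularOff α φ ψ D →
        (∀ z ∈ MatStieltjes.slit α \ D, (Y z).det ≠ 0) ∧
        (MatStieltjes.IsHolomorphicOn X (MatStieltjes.slit α \ D) ∧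
          MatStieltjes.IsHolomorphicOn Y (MatStieltjes.slit α \ D)) ∧
        MatStieltjes.IsProperStieltjesPair α X Y ∧
        MatStieltjes.DetNotIdenticallyZero α Y ∧
        ∃ F : ℂ → Matrix (Fin q) (Fin q) ℂ, MatStieltjes.MemSle α s₀ F ∧
          ∀ z ∈ MatStieltjes.slit α \ D, F z = X z * (Y z)⁻¹) ∧
    (∀ F : ℂ → Matrix (Fin q) (Fin q) ℂ, MatStieltjes.MemSle α s₀ F →
      ∀ φ ψ : ℂ → Matrix (Fin q) (Fin q) ℂ,
        (∀ z ∈ MatStieltjes.slit α, Matrix.fromRows (φ z) (ψ z) =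
          MatStieltjes.polyW α s₀ z * Matrix.fromRows (F z) 1) →
        (MatStieltjes.IsHolomorphicOn φ (MatStieltjes.slit α) ∧
          MatStieltjes.IsHolomorphicOn ψ (MatStieltjes.slit α)) ∧
        MatStieltjes.MemPairClass α s₀ φ ψ ∧
        ∀ z ∈ MatStieltjes.slit α,
          ((z - α) • (MatStieltjes.mpInv s₀ * φ z) + (z - α) • ψ z).det ≠ 0 ∧
          F z = (0 * φ z - s₀ * ψ z) *
            ((z - α) • (MatStieltjes.mpInv s₀ * φ z) + (z - α) • ψ z)⁻¹) := by
  constructor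
  · intro φ ψ hmem X Y hXY D hD
    have hX : ∀ z ∈ MatStieltjes.slit α, X z = MatStieltjes.pairNum s₀ ψ z := fun z hz =>
      ((MatStieltjes.polyV_mul α s₀ (φ z) (ψ z) (X z) (Y z) z).mp (hXY z hz)).1
    have hY : ∀ z ∈ MatStieltjes.slit α, Y z = MatStieltjes.pairDen α s₀ φ ψ z := fun z hz =>
      ((MatStieltjes.polyV_mul α s₀ (φ z) (ψ z) (X z) (Y z) z).mp (hXY z hz)).2
    have hdet : ∀ z ∈ MatStieltjes.slit α \ D, (Y z).det ≠ 0 := fun z hz => by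
      rw [hY z hz.1]
      exact hmem.det_ne_zero hs₀ hD hz
    have hXh : MatStieltjes.IsHolomorphicOn X (MatStieltjes.slit α \ D) :=
      (hD.holomorphic_pairNum s₀).congr fun z hz => hX z hz.1
    have hYh : MatStieltjes.IsHolomorphicOn Y (MatStieltjes.slit α \ D) :=
      (hD.holomorphic_pairDen s₀).congr fun z hz => hY z hz.1
    have hY0 : MatStieltjes.DetNotIdenticallyZero α Y := by
      obtain ⟨z, hz⟩ := hD.nonempty
      exact ⟨z, hz.1, hYh.isHolomorphicAt hD.isOpen hz, hdet z hz⟩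
    refine ⟨hdet, ⟨hXh, hYh⟩, ⟨⟨(MatStieltjes.isMeromorphic_pairNum hmem.1.2.1 s₀).congr hX,
      (MatStieltjes.isMeromorphic_pairDen hmem.1.1 hmem.1.2.1 s₀).congr hY, D,
      ⟨hD.subset_slit, hD.discrete, hXh, hYh, fun z hz =>
        MatStieltjes.rank_fromRows_of_det_ne_zero _ (hdet z hz)⟩, fun z hz hzD => ?_⟩, hY0⟩,
      hY0, ?_⟩
    · rw [MatStieltjes.posSemidef_signatureForm_iff,
        MatStieltjes.posSemidef_signatureForm_smul_iff, hX z (Or.inl hz), hY z (Or.inl hz)]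
      exact ⟨fun v => (hmem.pairing_transform_nonneg hs₀ hD hz hzD v).1,
        fun v => (hmem.pairing_transform_nonneg hs₀ hD hz hzD v).2⟩
    · obtain ⟨F, hF, hFe⟩ := hmem.exists_memSle hs₀ hD
      exact ⟨F, hF, fun z hz => by rw [hFe z hz, hX z hz.1, hY z hz.1]⟩
  · intro F hF φ ψ hφψ
    obtain ⟨⟨hSt, -⟩, σ, hσ, hle⟩ := hF
    have hφ : ∀ z ∈ MatStieltjes.slit α, φ z = (z - α) • F z + s₀ := fun z hz =>
      ((MatStieltjes.polyW_mul α s₀ (F z) (φ z) (ψ z) z).mp (hφψ z hz)).1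
    have hψ : ∀ z ∈ MatStieltjes.slit α, ψ z = -((z - α) • (MatStieltjes.mpInv s₀ * F z))
        + (1 - MatStieltjes.mpInv s₀ * s₀) := fun z hz =>
      ((MatStieltjes.polyW_mul α s₀ (F z) (φ z) (ψ z) z).mp (hφψ z hz)).2
    have hsum : ∀ z ∈ MatStieltjes.slit α, MatStieltjes.mpInv s₀ * φ z + ψ z = 1 := fun z hz => by
      rw [hφ z hz, hψ z hz, MatStieltjes.mpInv_mul_transform_add]
    have hlin : DifferentiableOn ℂ (fun z : ℂ => z - (α : ℂ)) (MatStieltjes.slit α) :=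
      differentiableOn_id.sub (differentiableOn_const _)
    have hφh : MatStieltjes.IsHolomorphicOn φ (MatStieltjes.slit α) :=
      ((hSt.holomorphic.smul hlin).add (MatStieltjes.isHolomorphicOn_const s₀)).congr hφ
    have hψh : MatStieltjes.IsHolomorphicOn ψ (MatStieltjes.slit α) := by
      refine (((((MatStieltjes.isHolomorphicOn_const (-MatStieltjes.mpInv s₀)).mul
        hSt.holomorphic).smul hlin)).add (MatStieltjes.isHolomorphicOn_const
          (1 - MatStieltjes.mpInv s₀ * s₀))).congr fun z hz => ?_
      rw [hψ z hz, Matrix.neg_mul, smul_neg]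
    refine ⟨⟨hφh, hψh⟩, ⟨⟨hφh.isMeromorphic, hψh.isMeromorphic, ∅, ⟨Set.empty_subset _,
      fun B _ => by simp, by rwa [Set.sdiff_empty], by rwa [Set.sdiff_empty], fun z hz => ?_⟩,
      fun z hz _ => ?_⟩, fun z hz _ => ?_⟩, fun z hz => ?_⟩
    · refine (MatStieltjes.rank_fromRows_eq_iff _ _).mpr fun v h1 h2 => ?_
      rw [← Matrix.one_mulVec v, ← hsum z hz.1, Matrix.add_mulVec, ← Matrix.mulVec_mulVec, h1, h2,
        Matrix.mulVec_zero, add_zero]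
    · rw [MatStieltjes.posSemidef_signatureForm_iff,
        MatStieltjes.posSemidef_signatureForm_smul_iff, hφ z (Or.inl hz), hψ z (Or.inl hz)]
      exact ⟨fun v => (hσ.pairing_nonneg hs₀ hle hz v).1,
        fun v => (hσ.pairing_nonneg hs₀ hle hz v).2⟩
    · have e : φ z = s₀ * ((z - α) • (MatStieltjes.mpInv s₀ * F z) + 1) := by
        rw [hφ z hz, Matrix.mul_add, Matrix.mul_smul, ← Matrix.mul_assoc,
          hσ.mul_mpInv_mul hle hz, Matrix.mul_one]
      rw [e, Matrix.mulVecLin_mul]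
      exact LinearMap.range_comp_le_range _ _
    · have hz0 := MatStieltjes.sub_ofReal_ne_zero hz
      have hnum : 0 * φ z - s₀ * ψ z = (z - α) • F z := by
        rw [hψ z hz, Matrix.mul_add, Matrix.mul_neg, Matrix.mul_smul, ← Matrix.mul_assoc,
          hσ.mul_mpInv_mul hle hz, Matrix.mul_sub, Matrix.mul_one, ← Matrix.mul_assoc,
          (MatStieltjes.isMoorePenroseInverse_mpInv s₀).mul_mul_self, Matrix.zero_mul]
        abel
      have hdet : ((z - (α : ℂ)) • (1 : Matrix (Fin q) (Fin q) ℂ)).det ≠ 0 := by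
        rw [Matrix.det_smul, Matrix.det_one, mul_one]
        exact pow_ne_zero _ hz0
      rw [hnum, ← smul_add, hsum z hz]
      refine ⟨hdet, ?_⟩
      have : (z - (α : ℂ)) • F z = F z * ((z - (α : ℂ)) • (1 : Matrix (Fin q) (Fin q) ℂ)) := by
        rw [Matrix.mul_smul, Matrix.mul_one]
      rw [this, Matrix.mul_nonsing_inv_cancel_right _ _ hdet.isUnit]
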